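/- Let $\mathbb{S}^2\subseteq\mathbb{R}^3$ be the round sphere of radius $2$ about the origin, and put $\varepsilon=10^{-3}$. For a smooth surface $S\subseteq\mathbb{R}^3$ with unit normal $\nu$, second fundamental form $A$ and position vector $X$, let $$\mathcal{L}_S u=\Delta_S u+|A|^2u-\tfrac12\left(X\cdot\nabla_S u-u\right),$$ and call $S$ a self-shrinker if $H=\tfrac12\langle X,\nu\rangle$, where $H$ is the sum of the principal curvatures, with the sign for which $H>0$ on a round sphere with outward normal. There exists a closed, embedded, smooth self-shrinking torus of revolution $\mathbb{T}^2\subseteq\mathbb{R}^3$ about the $x_1$-axis, generated by a profile curve in the half-plane $\{(x_1,x_2):x_2>0\}$, with the following properties. - $\mathbb{T}^2$ is symmetric under $x_1\mapsto-x_1$. - The profile curve meets the $x_2$-axis at exactly two points $(0,a^+)$ and $(0,a^-)$, orthogonally, where $a^+>a^->0$, $|a^+-\frac{4034}{1217}|<\frac52\varepsilon$ and $|a^--\frac7{16}|<\frac3{98}$. - The profile curve meets the circle of radius $2$ about the origin at exactly two points $p^\pm=(\pm x_{\mathbb{S}^2},y_{\mathbb{S}^2})$, where $\|p^\pm-(\pm\frac{29}{32},\frac{41}{23})\|\le5\varepsilon$,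 and the angles between $\pm\vec e_1$ and $p^\pm$ satisfy $|\angle(\pm\vec e_1,p^\pm)-\frac{11}{10}|\le5\varepsilon$. For this torus, each of the sets $\{x_1\ge0\}\cap\mathbb{S}^2\setminus(\mathbb{S}^2\cap\mathbb{T}^2)$ and $\{x_1\ge0\}\cap\mathbb{T}^2\setminus(\mathbb{S}^2\cap\mathbb{T}^2)$ has exactly two connected components; call them $S_3,S_4$ and $S_5,S_6$ respectively. Let $S_1=\mathbb{S}^2\cap\{x_1\ge0\}$ and $S_2=\mathbb{T}^2\cap\{x_1\ge0\}$. Then there is an integer $N_0>0$ such that for every $N\ge N_0$ and every $i=1,\dots,6$ the following holds. If a function $u$ on the closure of $S_i$ is $C^2$ up to the boundary, is invariant under the rotation by the angle $2\pi/N$ about the $x_1$-axis, and satisfies $\mathcal{L}_{S_i}u=0$ with the boundary conditions 1. for $S_1$ and $S_2$: Neumann conditions (on the boundary, which lies in $\{x_1=0\}$), 2. for $S_3$, $S_4$, $S_5$ and $S_6$: Neumann conditions on the part of the boundary in $\{x_1=0\}$ (if any), and Dirichlet conditions on the rest of the boundary, which lies in $\mathbb{S}^2\cap\mathbb{T}^2$,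 then $u\equiv0$ on $S_i$. -/

import Mathlib

open Set Real
open scoped ContDiff Matrix

noncomputable section

namespace Shrinker

/-- Euclidean space `ℝ³`; the coordinates `x₁, x₂, x₃` are `p 0, p 1, p 2`. -/
abbrev E3 := EuclideanSpace ℝ (Fin 3)

/-- The parameter plane `ℝ²`. -/
abbrev Par := Fin 2 → ℝ

/-! ## Geometry of a parametrized surface `F : ℝ² → ℝ³` -/

/-- The partial derivative `∂ᵢ f` of a map on the parameter plane. -/
def pd {V : Type*} [NormedAddCommGroup V] [NormedSpace ℝ V] (i : Fin 2) (f : Par → V) : Par → V :=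
  fun q => fderiv ℝ f q (Pi.single i 1)

/-- The first fundamental form `g i j = ⟨∂ᵢ F, ∂ⱼ F⟩`. -/
def metric (F : Par → E3) (q : Par) : Matrix (Fin 2) (Fin 2) ℝ :=
  Matrix.of fun i j => inner ℝ (pd i F q) (pd j F q)

/-- The vector product `∂₁ F × ∂₂ F`. -/
def crossNormal (F : Par → E3) (q : Par) : E3 :=
  WithLp.toLp 2 (crossProduct (WithLp.ofLp (pd 0 F q)) (WithLp.ofLp (pd 1 F q)))

/-- The unit normal `ν = (∂₁ F × ∂₂ F) / |∂₁ F × ∂₂ F|`. -/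
def unitNormal (F : Par → E3) (q : Par) : E3 :=
  ‖crossNormal F q‖⁻¹ • crossNormal F q

/-- The second fundamental form `h i j = ⟨∂ᵢ ∂ⱼ F, ν⟩`. -/
def secondForm (F : Par → E3) (q : Par) : Matrix (Fin 2) (Fin 2) ℝ :=
  Matrix.of fun i j => inner ℝ (pd i (pd j F) q) (unitNormal F q)

/-- The mean curvature `H`, the sum of the principal curvatures with respect to `ν`, with the sign
for which a round sphere of radius `r` with outward normal has `H = 2 / r`. -/
def meanCurvature (F : Par → E3) (q : Par) : ℝ :=
  -((metric F q)⁻¹ * secondForm F q).trace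

/-- `|A|²`, the squared norm `g^{ij} h_{jk} g^{kl} h_{li}` of the second fundamental form. -/
def normSqA (F : Par → E3) (q : Par) : ℝ :=
  ((metric F q)⁻¹ * secondForm F q * ((metric F q)⁻¹ * secondForm F q)).trace

/-- The Laplace-Beltrami operator
`Δ v = (det g)^{-1/2} ∑ᵢ ∂ᵢ ((det g)^{1/2} ∑ⱼ g^{ij} ∂ⱼ v)`. -/
def laplaceBeltrami (F : Par → E3) (v : Par → ℝ) (q : Par) : ℝ :=
  (√(metric F q).det)⁻¹ *
    ∑ i, pd i (fun z => √(metric F z).det * ∑ j, (metric F z)⁻¹ i j * pd j v z) q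

/-- The inner product `⟨∇v, ∇w⟩ = ∑ g^{ij} ∂ᵢ v ∂ⱼ w` of two surface gradients. -/
def gradInner (F : Par → E3) (v w : Par → ℝ) (q : Par) : ℝ :=
  ∑ i, ∑ j, (metric F q)⁻¹ i j * pd i v q * pd j w q

/-- `X · ∇v = ∑ g^{ij} ⟨X, ∂ᵢ F⟩ ∂ⱼ v`, with `X = F` the position vector. -/
def positionGrad (F : Par → E3) (v : Par → ℝ) (q : Par) : ℝ :=
  ∑ i, ∑ j, (metric F q)⁻¹ i j * inner ℝ (F q) (pd i F q) * pd j v q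

/-- The stability operator `L v = Δ v + |A|² v - (X · ∇v - v) / 2`. -/
def stabilityOp (F : Par → E3) (v : Par → ℝ) (q : Par) : ℝ :=
  laplaceBeltrami F v q + normSqA F q * v q - (1 / 2) * (positionGrad F v q - v q)

/-- The self-shrinker equation `H = ⟨X, ν⟩ / 2` (it does not depend on the choice of `±ν`). -/
def ShrinkerEq (F : Par → E3) (q : Par) : Prop :=
  meanCurvature F q = (1 / 2) * inner ℝ (F q) (unitNormal F q)

/-! ## Functions on a surface in `ℝ³` -/

/-- `F`, restricted to the open set `W`, is a regular smooth parametrization of a piece of `S`. -/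
structure IsPatch (F : Par → E3) (W : Set Par) (S : Set E3) : Prop where
  isOpen : IsOpen W
  smooth : ContDiffOn ℝ ∞ F W
  regular : ∀ q ∈ W, LinearIndependent ℝ ![pd 0 F q, pd 1 F q]
  mapsTo : MapsTo F W S

/-- `L u = 0` in the interior of the surface `S`: the equation holds in every regular patch. -/
def JacobiOn (S : Set E3) (u : E3 → ℝ) : Prop :=
  ∀ (F : Par → E3) (W : Set Par), IsPatch F W S → ∀ q ∈ W, stabilityOp F (u ∘ F) q = 0

/-- The symmetry plane `{x₁ = 0}`. -/
def symPlane : Set E3 := {p | p 0 = 0}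

/-- The half-space `{x₁ ≥ 0}`. -/
def halfSpace : Set E3 := {p | 0 ≤ p 0}

/-- The Neumann condition for `u` along `B ⊆ M ∩ {x₁ = 0}`, where the surface `M` crosses the plane
`{x₁ = 0}` transversally: the derivative of `u` in the direction of the surface gradient of the
coordinate `x₁`, which is the conormal direction of the curve `M ∩ {x₁ = 0}`, vanishes. -/
def NeumannOn (M B : Set E3) (u : E3 → ℝ) : Prop :=
  ∀ (F : Par → E3) (W : Set Par), IsPatch F W M → ∀ q ∈ W, F q ∈ B →
    gradInner F (u ∘ F) (fun z => F z 0) q = 0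

/-- The rotation by the angle `t` about the `x₁`-axis. -/
def rot (t : ℝ) (p : E3) : E3 :=
  !₂[p 0, cos t * p 1 - sin t * p 2, sin t * p 1 + cos t * p 2]

/-- `S` is a piece, with boundary, of the surface `M`. There is no nonzero `u` on (the closure of)
`S` which is `C²` up to the boundary, i.e. the restriction of a `C²` function on `ℝ³`, invariant
under the rotation by `2π / N`, and which satisfies `L u = 0` with Neumann conditions on `{x₁ = 0}`
and Dirichlet conditions on the part of the closure of `S` that lies in `D`. -/
def TrivialKernel (M S D : Set E3) (N : ℕ) : Prop :=
  ∀ u : E3 → ℝ, ContDiff ℝ 2 u →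
    (∀ p ∈ S, u (rot (2 * π / N) p) = u p) →
    JacobiOn S u →
    NeumannOn M (closure S ∩ symPlane) u →
    (∀ p ∈ closure S ∩ D, u p = 0) →
    ∀ p ∈ S, u p = 0

/-- The set of connected components of `M`. -/
def components (M : Set E3) : Set (Set E3) :=
  {C | ∃ p ∈ M, C = connectedComponentIn M p}

/-! ## The sphere and the torus -/

/-- The round sphere of radius `2` about the origin. -/
def roundSphere : Set E3 := Metric.sphere 0 2

/-- The surface generated by rotating the curve `(x, y)` about the `x₁`-axis. -/
def revolve (x y : ℝ → ℝ) : Par → E3 :=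
  fun q => !₂[x (q 0), y (q 0) * cos (q 1), y (q 0) * sin (q 1)]

/-- `(x, y)` is a smooth regular simple closed curve in the open half-plane `{y > 0}`, so that
rotating it about the `x₁`-axis gives a closed embedded smooth torus. -/
structure IsTorusProfile (x y : ℝ → ℝ) : Prop where
  smooth_x : ContDiff ℝ ∞ x
  smooth_y : ContDiff ℝ ∞ y
  pos : ∀ t, 0 < y t
  regular : ∀ t, deriv x t ≠ 0 ∨ deriv y t ≠ 0
  closed : ∃ P : ℝ, 0 < P ∧ Function.Periodic x P ∧ Function.Periodic y P ∧
    InjOn (fun t => (x t, y t)) (Ico 0 P)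

/-- The size of the gaps in the estimates for the torus. -/
def epsGap : ℝ := 1 / 1000

/-- `T` is a closed embedded self-shrinking torus of revolution about the `x₁`-axis that satisfies
the quantitative estimates. -/
def IsQuantitativeTorus (T : Set E3) : Prop :=
  ∃ x y : ℝ → ℝ, IsTorusProfile x y ∧ T = range (revolve x y) ∧
    (∀ q, ShrinkerEq (revolve x y) q) ∧
    -- symmetry under the reflection in the plane `{x₁ = 0}`
    (∀ p ∈ T, (!₂[-p 0, p 1, p 2] : E3) ∈ T) ∧
    -- the profile meets the `x₂`-axis at exactly two heights, orthogonally
    (∃ aPlus aMinus : ℝ, 0 < aMinus ∧ aMinus < aPlus ∧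
      {a : ℝ | ∃ t, x t = 0 ∧ y t = a} = {aPlus, aMinus} ∧
      (∀ t, x t = 0 → deriv y t = 0) ∧
      |aPlus - 4034 / 1217| < 5 / 2 * epsGap ∧ |aMinus - 7 / 16| < 3 / 98) ∧
    -- the profile meets the circle of radius `2` at exactly two points `(± xS, yS)`
    (∃ xS yS : ℝ,
      {z : ℝ × ℝ | ∃ t, z = (x t, y t) ∧ z.1 ^ 2 + z.2 ^ 2 = 4} = {(xS, yS), (-xS, yS)} ∧
      ‖(!₂[xS, yS] : EuclideanSpace ℝ (Fin 2)) - !₂[29 / 32, 41 / 23]‖ ≤ 5 * epsGap ∧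
      |InnerProductGeometry.angle (!₂[1, 0] : EuclideanSpace ℝ (Fin 2)) !₂[xS, yS] - 11 / 10|
        ≤ 5 * epsGap)

end Shrinker

end

/-!
Rotating a curve parametrized by `x' = y c`, `y' = y s`, where `(c, s)` is its unit tangent, gives a
conformal parametrization of the surface, with metric `y² · 1`. The self-shrinker equation becomes
an ordinary differential equation with polynomial right-hand side for `(x, y, c, s)`
(`IsMeridian.shrinkerEq_iff`), which is symmetric under `(x, s) ↦ (-x, -s)` together with the
reversal of time. A solution that leaves the axis `{x₁ = 0}` orthogonally at time `0` and meets it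
orthogonally again at time `T` therefore extends, by reflection, to a closed curve of period `2 T`
that is symmetric in that axis.

Such a solution is found by shooting from the highest point of the profile (`exists_shooting`): as
the initial height runs through an interval of length `2 ^ (-40)`, the slope at the next point of
the axis changes its sign. The necessary estimates come from a Taylor integrator in exact integer
arithmetic. In each step it computes a polynomial with integer coefficients, and then it checks, by
evaluating the differential equation on this polynomial, that the defect is small; Grönwall's
inequality bounds the distance to the true solution, and this bound is carried along as an error
radius. The checks themselves (`certified_tube`, `certified_low`, `certified_high`) are evaluated by
the kernel, and `certified_sound` turns them into statements about solutions. The system contains,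
besides the profile, two solutions `u` and `v` of the linearized equation along it. The outcome is
`exists_torusData`: the profile, its quantitative properties, and the signs of a few values of `u`
and `v`.

Let now `w` be an invariant solution of the Jacobi equation on one of the six pieces. In the
coordinates of a surface of revolution the equation separates (`IsMeridian.stabilityOp_eq`), and
the Fourier coefficients of `w` in the angular variable solve ordinary differential equations. Only
the frequencies that are multiples of `N` occur, and `w` vanishes if all its coefficients do
(`eq_zero_of_modes`, `eq_zero_on_piece`). For a coefficient of nonzero frequency `m ≥ N`, the
potential has the summand `-m²`, which dominates it as soon as `N` is large, uniformly on the
compact profile. A positive constant is then a strict supersolution, and dividing by it and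
integrating by parts shows that the coefficient vanishes under any combination of Dirichlet and
Neumann conditions (`eq_zero_of_supersolution`). This determines `N₀`.

What is left are the rotationally invariant solutions, for which `N` plays no role. On the two
pieces of the hemisphere there are explicit polynomial supersolutions in the height (`sphere_cap`,
`sphere_band`), and on the hemisphere itself a solution with a zero is excluded by these two cases
and one without a zero by integrating the equation (`sphere_half`). On the torus, the Wronskian with
`u`, or with the combination of `u` and `v` that satisfies the same condition at one end, is
constant up to an explicit factor. So a nonzero solution can exist only if that combination
satisfies the condition at the other end too, which the signs in `TorusData` exclude
(`TorusData.eq_zero_half`, `TorusData.eq_zero_outer`, `TorusData.eq_zero_inner`).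
-/

noncomputable section

namespace Shrinker

/-! ### Flows of bounded Lipschitz vector fields -/

theorem exists_solution_Icc {E : Type*} [NormedAddCommGroup E] [NormedSpace ℝ E] [CompleteSpace E]
    {g : E → E} {K B : NNReal} (hg : LipschitzWith K g) (hB : ∀ z, ‖g z‖ ≤ B) (z₀ : E) (n : ℕ) :
    ∃ z : ℝ → E, z 0 = z₀ ∧
      ∀ t ∈ Icc (-(n : ℝ)) n, HasDerivWithinAt z (g (z t)) (Icc (-(n : ℝ)) n) t := by
  have h0 : (0 : ℝ) ∈ Icc (-(n : ℝ)) n := by simp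
  have h : IsPicardLindelof (fun _ => g) (⟨0, h0⟩ : Icc (-(n : ℝ)) n) z₀ (B * n) 0 B K :=
    { lipschitzOnWith := fun _ _ => hg.lipschitzOnWith
      continuousOn := fun _ _ => continuousOn_const
      norm_le := fun _ _ z _ => hB z
      mul_max_le := by simp }
  exact h.exists_eq_forall_mem_Icc_hasDerivWithinAt₀

theorem exists_global_solution {E : Type*} [NormedAddCommGroup E] [NormedSpace ℝ E]
    [CompleteSpace E] {g : E → E} {K B : NNReal} (hg : LipschitzWith K g) (hB : ∀ z, ‖g z‖ ≤ B)
    (z₀ : E) : ∃ z : ℝ → E, z 0 = z₀ ∧ ∀ t, HasDerivAt z (g (z t)) t := by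
  choose α h0 hα using exists_solution_Icc hg hB z₀
  have hd : ∀ (n : ℕ) (t : ℝ), |t| < n → HasDerivAt (α n) (g (α n t)) t := fun n t ht =>
    (hα n t ⟨(abs_lt.1 ht).1.le, (abs_lt.1 ht).2.le⟩).hasDerivAt
      (Icc_mem_nhds (abs_lt.1 ht).1 (abs_lt.1 ht).2)
  have hag : ∀ (n m : ℕ), n ≤ m → ∀ t : ℝ, |t| < n → α n t = α m t := by
    intro n m hnm t ht
    have hn : (0 : ℝ) < n := (abs_nonneg t).trans_lt ht
    have hnm' : (n : ℝ) ≤ m := by exact_mod_cast hnm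
    have := ODE_solution_unique_of_mem_Ioo (v := fun _ => g) (s := fun _ => univ) (K := K)
      (a := -n) (b := n) (t₀ := 0) (f := α n) (g := α m)
      (fun _ _ => hg.lipschitzOnWith) (by simpa using hn)
      (fun s hs => ⟨hd n s (abs_lt.2 hs), trivial⟩)
      (fun s hs => ⟨hd m s ((abs_lt.2 hs).trans_le hnm'), trivial⟩) (by rw [h0, h0])
    exact this (abs_lt.1 ht)
  have key : ∀ (t : ℝ) (n : ℕ), |t| < n → α (⌊|t|⌋₊ + 1) t = α n t := by
    intro t n ht
    have h1 : |t| < ((⌊|t|⌋₊ + 1 : ℕ) : ℝ) := by push_cast; exact Nat.lt_floor_add_one _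
    rcases le_total (⌊|t|⌋₊ + 1) n with h | h
    · exact hag _ _ h t h1
    · exact (hag _ _ h t ht).symm
  -- the solutions on the intervals `[-n, n]` agree where they overlap, and are glued
  refine ⟨fun t => α (⌊|t|⌋₊ + 1) t, by simp [h0], fun t => ?_⟩
  obtain ⟨n, hn⟩ := exists_nat_gt |t|
  have hev : (fun t => α (⌊|t|⌋₊ + 1) t) =ᶠ[nhds t] α n := by
    filter_upwards [(isOpen_lt continuous_abs continuous_const).mem_nhds hn] with s hs
    exact key s n hs
  have := (hd n t hn).congr_of_eventuallyEq hev
  beta_reduce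
  rwa [key t n hn]

/-- The nearest point projection onto the box `∏ [-M i, M i]`. -/
def clamp {n : ℕ} (M : Fin n → ℝ) (z : Fin n → ℝ) : Fin n → ℝ :=
  fun i => max (-M i) (min (M i) (z i))

theorem clamp_of_mem {n : ℕ} {M z : Fin n → ℝ} (h : ∀ i, |z i| ≤ M i) : clamp M z = z := by
  funext i
  have := abs_le.1 (h i)
  simp [clamp, this.1, this.2]

theorem abs_clamp_le {n : ℕ} {M : Fin n → ℝ} (hM : ∀ i, 0 ≤ M i) (z : Fin n → ℝ) (i : Fin n) :
    |clamp M z i| ≤ M i := by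
  rw [abs_le]
  exact ⟨le_max_left _ _, max_le (by linarith [hM i]) (min_le_left _ _)⟩

theorem lipschitzWith_clamp {n : ℕ} (M : Fin n → ℝ) : LipschitzWith 1 (clamp M) := by
  refine LipschitzWith.of_dist_le_mul fun z w => ?_
  rw [NNReal.coe_one, one_mul]
  refine (dist_pi_le_iff dist_nonneg).2 fun i => le_trans ?_ (dist_le_pi_dist z w i)
  have : LipschitzWith 1 (fun a : ℝ => max (-M i) (min (M i) a)) :=
    (LipschitzWith.id.const_min _).const_max _
  have h := this.dist_le_mul (z i) (w i)
  rwa [NNReal.coe_one, one_mul] at h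

/-- `f` is `κ`-Lipschitz, for the maximum norm, on the box `∏ [-M i, M i]`. -/
def LipOnBox {n : ℕ} (f : (Fin n → ℝ) → Fin n → ℝ) (M : Fin n → ℝ) (κ : ℝ) : Prop :=
  ∀ z w, (∀ i, |z i| ≤ M i) → (∀ i, |w i| ≤ M i) → ∀ i, |f z i - f w i| ≤ κ * dist z w

theorem LipOnBox.lipschitzWith {n : ℕ} {f : (Fin n → ℝ) → Fin n → ℝ} {M : Fin n → ℝ} {κ : NNReal}
    (hf : LipOnBox f M κ) (hM : ∀ i, 0 ≤ M i) : LipschitzWith κ (f ∘ clamp M) := by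
  refine LipschitzWith.of_dist_le_mul fun z w => ?_
  refine (dist_pi_le_iff (by positivity)).2 fun i => ?_
  rw [Real.dist_eq]
  refine (hf _ _ (abs_clamp_le hM z) (abs_clamp_le hM w) i).trans ?_
  have := (lipschitzWith_clamp M).dist_le_mul z w
  rw [NNReal.coe_one, one_mul] at this
  gcongr

theorem LipOnBox.bounded {n : ℕ} {f : (Fin n → ℝ) → Fin n → ℝ} {M : Fin n → ℝ} {κ : NNReal}
    (hf : LipOnBox f M κ) (hM : ∀ i, 0 ≤ M i) : ∃ B : NNReal, ∀ z, ‖(f ∘ clamp M) z‖ ≤ B := by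
  have hd : ∀ z, dist (clamp M z) 0 ≤ ‖M‖ := fun z => by
    rw [dist_zero_right]
    refine (pi_norm_le_iff_of_nonneg (norm_nonneg _)).2 fun i => ?_
    exact ((abs_clamp_le hM z i).trans (le_abs_self _)).trans (norm_le_pi_norm M i)
  refine ⟨‖f 0‖₊ + κ * ‖M‖₊, fun z => (pi_norm_le_iff_of_nonneg (by positivity)).2 fun i => ?_⟩
  have h1 := hf (clamp M z) 0 (abs_clamp_le hM z) (fun i => by simpa using hM i) i
  have h2 : |f 0 i| ≤ ‖f 0‖ := norm_le_pi_norm (f 0) i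
  have h3 : |f (clamp M z) i| ≤ |f (clamp M z) i - f 0 i| + |f 0 i| := by
    simpa using abs_add_le (f (clamp M z) i - f 0 i) (f 0 i)
  have h4 : (κ : ℝ) * dist (clamp M z) 0 ≤ κ * ‖M‖ := by gcongr; exact hd z
  simp only [Function.comp_apply, Real.norm_eq_abs, NNReal.coe_add, coe_nnnorm, NNReal.coe_mul]
  linarith

theorem gronwallBound_one_le {δ K ε E : ℝ} (hδ : 0 ≤ δ) (hK : 0 ≤ K) (hε : 0 ≤ ε)
    (hE : Real.exp K ≤ E) {t : ℝ} (ht : t ∈ Icc (0 : ℝ) 1) : gronwallBound δ K ε t ≤ (δ + ε) * E := by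
  have h1 : gronwallBound δ K ε t ≤ gronwallBound δ K ε 1 := gronwallBound_mono hδ hε hK ht.2
  refine h1.trans (le_trans ?_ (mul_le_mul_of_nonneg_left hE (by positivity)))
  rcases hK.eq_or_lt with h | h
  · subst h; simp [gronwallBound_K0]
  · simp only [gronwallBound_of_K_ne_0 h.ne', mul_one, add_mul]
    have h2 : Real.exp K - 1 ≤ K * Real.exp K := by
      have := Real.add_one_le_exp (-K)
      have h3 : Real.exp (-K) * Real.exp K = 1 := by rw [← Real.exp_add]; simp
      nlinarith [Real.exp_pos K]
    have : ε / K * (Real.exp K - 1) ≤ ε / K * (K * Real.exp K) := by gcongr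
    have h4 : ε / K * (K * Real.exp K) = ε * Real.exp K := by field_simp
    linarith

/-- A quantitative shadowing lemma: a solution of the field `f ∘ clamp M₀` that starts `e`-close
to an approximate solution `p` (with defect `d`, in the rescaled time `τ ∈ [0, 1]`) stays
`(e + d) E`-close to it, where `E` bounds the exponential of the local Lipschitz constant. The
Lipschitz constant is only needed in the box `M` around the approximate solution, because the flow
of `f ∘ clamp M` never leaves that box, and so coincides with the given solution. -/
theorem shadow_step {n : ℕ} {f : (Fin n → ℝ) → Fin n → ℝ} {M₀ M : Fin n → ℝ} {K₀ κ : NNReal}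
    (hf₀ : LipOnBox f M₀ K₀) (hM : ∀ i, 0 ≤ M i) (hMM : ∀ i, M i ≤ M₀ i)
    (hf : LipOnBox f M κ) {h t₀ e d E ρ : ℝ} (hh : 0 < h) (he : 0 ≤ e) (hd : 0 ≤ d)
    (hE : Real.exp (h * κ) ≤ E) (hρ : (e + d) * E ≤ ρ)
    {p p' : ℝ → Fin n → ℝ} (hp : ∀ τ, HasDerivAt p (p' τ) τ)
    (hpM : ∀ τ ∈ Icc (0 : ℝ) 1, ∀ i, |p τ i| + ρ ≤ M i)
    (hdef : ∀ τ ∈ Icc (0 : ℝ) 1, ∀ i, |p' τ i - h * f (p τ) i| ≤ d)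
    {z : ℝ → Fin n → ℝ} (hz : ∀ t ∈ Icc t₀ (t₀ + h), HasDerivAt z (f (clamp M₀ (z t))) t)
    (hz0 : dist (z t₀) (p 0) ≤ e) :
    ∀ τ ∈ Icc (0 : ℝ) 1, dist (z (t₀ + h * τ)) (p τ) ≤ (e + d) * E ∧
      ∀ i, |z (t₀ + h * τ) i| ≤ M i := by
  have hM₀ : ∀ i, 0 ≤ M₀ i := fun i => (hM i).trans (hMM i)
  have hE0 : 0 ≤ E := (Real.exp_pos _).le.trans hE
  have hρ0 : 0 ≤ ρ := le_trans (by positivity) hρ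
  obtain ⟨B, hB⟩ := hf.bounded hM
  obtain ⟨w, hw0, hw⟩ := exists_global_solution (hf.lipschitzWith hM) hB (z t₀)
  -- the auxiliary solution in the rescaled time
  have hw' : ∀ τ, HasDerivAt (fun τ => w (h * τ)) (h • f (clamp M (w (h * τ)))) τ := fun τ => by
    have h1 : HasDerivAt (fun τ : ℝ => h * τ) h τ := by
      simpa using (hasDerivAt_id τ).const_mul h
    exact (hw (h * τ)).scomp τ h1
  let κ' : NNReal := ⟨h, hh.le⟩ * κ
  have hκ' : (κ' : ℝ) = h * κ := rfl
  have hL : LipschitzWith κ' (fun z => h • f (clamp M z)) := by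
    refine LipschitzWith.of_dist_le_mul fun a b => ?_
    rw [dist_smul₀, hκ', Real.norm_eq_abs, abs_of_pos hh, mul_assoc]
    exact mul_le_mul_of_nonneg_left ((hf.lipschitzWith hM).dist_le_mul a b) hh.le
  have hcl : ∀ τ ∈ Icc (0 : ℝ) 1, clamp M (p τ) = p τ := fun τ hτ =>
    clamp_of_mem fun i => by linarith [hpM τ hτ i]
  have hgr : ∀ τ ∈ Icc (0 : ℝ) 1, dist (w (h * τ)) (p τ) ≤ (e + d) * E := by
    intro τ hτ
    have := dist_le_of_approx_trajectories_ODE (v := fun _ z => h • f (clamp M z)) (K := κ')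
      (f := fun τ => w (h * τ)) (f' := fun τ => h • f (clamp M (w (h * τ)))) (g := p) (g' := p')
      (a := 0) (b := 1) (εf := 0) (εg := d) (δ := e) (fun _ => hL)
      (fun s _ => (hw' s).continuousAt.continuousWithinAt)
      (fun s _ => (hw' s).hasDerivWithinAt) (fun s _ => by simp)
      (fun s _ => (hp s).continuousAt.continuousWithinAt)
      (fun s _ => (hp s).hasDerivWithinAt)
      (fun s hs => by
        have hs' : s ∈ Icc (0 : ℝ) 1 := ⟨hs.1, hs.2.le⟩
        refine (dist_pi_le_iff hd).2 fun i => ?_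
        rw [hcl s hs', Real.dist_eq]
        exact hdef s hs' i)
      (by simpa [hw0] using hz0) τ hτ
    rw [zero_add, sub_zero] at this
    exact this.trans (gronwallBound_one_le he (by positivity) hd (by rwa [hκ']) hτ)
  have hwM : ∀ τ ∈ Icc (0 : ℝ) 1, ∀ i, |w (h * τ) i| ≤ M i := by
    intro τ hτ i
    have h1 := (dist_le_pi_dist (w (h * τ)) (p τ) i).trans ((hgr τ hτ).trans hρ)
    rw [Real.dist_eq] at h1
    have h2 := abs_add_le (w (h * τ) i - p τ i) (p τ i)
    simp only [sub_add_cancel] at h2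
    linarith [hpM τ hτ i]
  -- it stays in the box `M`, where no truncation is active, and so it is the given solution
  have huniq : EqOn (fun t => w (t - t₀)) z (Icc t₀ (t₀ + h)) := by
    refine ODE_solution_unique (v := fun _ => f ∘ clamp M₀) (K := K₀)
      (fun _ => hf₀.lipschitzWith hM₀) ?_ ?_
      (fun t ht => (hz t ht).continuousAt.continuousWithinAt)
      (fun t ht => (hz t ⟨ht.1, ht.2.le⟩).hasDerivWithinAt) (by simp [hw0])
    · intro t _
      exact ((hw (t - t₀)).comp_sub_const t t₀).continuousAt.continuousWithinAt
    · intro t ht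
      have h1 := ((hw (t - t₀)).comp_sub_const t t₀).hasDerivWithinAt (s := Ici t)
      have hτ : (t - t₀) / h ∈ Icc (0 : ℝ) 1 :=
        ⟨div_nonneg (by linarith [ht.1]) hh.le, (div_le_one hh).2 (by linarith [ht.2])⟩
      have h2 := hwM _ hτ
      rw [mul_div_cancel₀ _ hh.ne'] at h2
      simp only [Function.comp_apply] at h1 ⊢
      rwa [clamp_of_mem h2, ← clamp_of_mem (M := M₀) fun i => (h2 i).trans (hMM i)] at h1
  intro τ hτ
  have hmem : t₀ + h * τ ∈ Icc t₀ (t₀ + h) :=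
    ⟨by nlinarith [hτ.1], by nlinarith [hτ.2]⟩
  have := huniq hmem
  simp only [add_sub_cancel_left] at this
  rw [← this]
  exact ⟨hgr τ hτ, hwM τ hτ⟩

/-! ### The profile equation and its linearization -/

/-- The derivative of the tangent angle of a profile curve `(x, y)` of a self-shrinker of
revolution, whose unit tangent is `(c, s)`, in the conformal parameter `t` with `|(x', y')| = y`. -/
def turn (x y c s : ℝ) : ℝ := c + y * (x * s - y * c) / 2

/-- The coefficient of `u'` in the Jacobi equation in the conformal parameter. -/
def drift (x y c s : ℝ) : ℝ := y * (x * c + y * s) / 2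

/-- The potential `y² (|A|² + 1 / 2)` of the Jacobi equation in the conformal parameter. -/
def pot (x y c s : ℝ) : ℝ := turn x y c s ^ 2 + c ^ 2 + y ^ 2 / 2

/-- The profile equation for `(x, y, c, s)`, together with two copies `(u, q)` and `(v, r)` of the
rotationally invariant Jacobi equation `u'' = drift * u' - pot * u`, where `u' = 2 q`. -/
def field (z : Fin 8 → ℝ) : Fin 8 → ℝ :=
  ![z 1 * z 2, z 1 * z 3, -(z 3 * turn (z 0) (z 1) (z 2) (z 3)),
    z 2 * turn (z 0) (z 1) (z 2) (z 3),
    2 * z 5, drift (z 0) (z 1) (z 2) (z 3) * z 5 - pot (z 0) (z 1) (z 2) (z 3) * z 4 / 2,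
    2 * z 7, drift (z 0) (z 1) (z 2) (z 3) * z 7 - pot (z 0) (z 1) (z 2) (z 3) * z 6 / 2]

/-- On `S`, the function `g` is bounded by `m` and Lipschitz with constant `L`. -/
structure BddLip {E : Type*} [PseudoMetricSpace E] (S : Set E) (g : E → ℝ) (m L : ℝ) : Prop where
  bdd : ∀ z ∈ S, |g z| ≤ m
  lip : ∀ z ∈ S, ∀ w ∈ S, |g z - g w| ≤ L * dist z w

namespace BddLip
variable {E : Type*} [PseudoMetricSpace E] {S : Set E} {f g : E → ℝ} {m m' L L' : ℝ}

theorem add (hf : BddLip S f m L) (hg : BddLip S g m' L') :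
    BddLip S (fun z => f z + g z) (m + m') (L + L') where
  bdd z hz := (abs_add_le _ _).trans (add_le_add (hf.bdd z hz) (hg.bdd z hz))
  lip z hz w hw := by
    rw [add_mul, add_sub_add_comm]
    exact (abs_add_le _ _).trans (add_le_add (hf.lip z hz w hw) (hg.lip z hz w hw))

theorem neg (hf : BddLip S f m L) : BddLip S (fun z => -f z) m L where
  bdd z hz := by rw [abs_neg]; exact hf.bdd z hz
  lip z hz w hw := by rw [← neg_sub', abs_neg]; exact hf.lip z hz w hw

theorem sub (hf : BddLip S f m L) (hg : BddLip S g m' L') :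
    BddLip S (fun z => f z - g z) (m + m') (L + L') := by
  simpa only [sub_eq_add_neg] using hf.add hg.neg

theorem mul (hf : BddLip S f m L) (hg : BddLip S g m' L') (hm : 0 ≤ m) (hm' : 0 ≤ m') :
    BddLip S (fun z => f z * g z) (m * m') (m * L' + m' * L) where
  bdd z hz := by
    rw [abs_mul]
    exact mul_le_mul (hf.bdd z hz) (hg.bdd z hz) (abs_nonneg _) hm
  lip z hz w hw := by
    have h : f z * g z - f w * g w = f z * (g z - g w) + g w * (f z - f w) := by ring
    rw [h]
    refine (abs_add_le _ _).trans ?_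
    rw [abs_mul, abs_mul, add_mul]
    have h1 := mul_le_mul (hf.bdd z hz) (hg.lip z hz w hw) (abs_nonneg _) hm
    have h2 := mul_le_mul (hg.bdd w hw) (hf.lip z hz w hw) (abs_nonneg _) hm'
    linarith

theorem const_mul (hf : BddLip S f m L) {a : ℝ} (ha : 0 ≤ a) :
    BddLip S (fun z => a * f z) (a * m) (a * L) where
  bdd z hz := by
    rw [abs_mul, abs_of_nonneg ha]
    exact mul_le_mul_of_nonneg_left (hf.bdd z hz) ha
  lip z hz w hw := by
    rw [← mul_sub, abs_mul, abs_of_nonneg ha, mul_assoc]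
    exact mul_le_mul_of_nonneg_left (hf.lip z hz w hw) ha

end BddLip

/-- A Lipschitz constant of `field` on the box with the half-widths `x, y, c, s, u, q, u, q`. The
numbers `m` and `l` with the index `K`, `A` or `B` are a bound and a Lipschitz constant for
`2 * turn`, `8 * drift` and `4 * pot`, respectively. -/
theorem lipOnBox_field {x y c s u q κ : ℝ} (hx : 0 ≤ x) (hy : 0 ≤ y) (hc : 0 ≤ c) (hs : 0 ≤ s)
    (hu : 0 ≤ u) (hq : 0 ≤ q) {e l mK lK mA lA mB lB : ℝ}
    (he : e = x * s + y * c) (hl : l = x + s + y + c)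
    (hmK : mK = 2 * c + y * e) (hlK : lK = 2 + y * l + e)
    (hmA : mA = 4 * (y * (x * c + y * s))) (hlA : lA = 4 * (y * l + (x * c + y * s)))
    (hmB : mB = mK * mK + 4 * (c * c) + 2 * (y * y))
    (hlB : lB = 2 * (mK * lK) + 8 * c + 4 * y)
    (h0 : y + c ≤ κ) (h1 : y + s ≤ κ) (h2 : (s * lK + mK) / 2 ≤ κ) (h3 : (c * lK + mK) / 2 ≤ κ)
    (h4 : 2 ≤ κ) (h5 : (mA + q * lA + (mB + u * lB)) / 8 ≤ κ) :
    LipOnBox field ![x, y, c, s, u, q, u, q] κ := by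
  set S : Set (Fin 8 → ℝ) := {z | ∀ i, |z i| ≤ (![x, y, c, s, u, q, u, q] : Fin 8 → ℝ) i} with hS
  have co : ∀ (i : Fin 8) (m : ℝ), (![x, y, c, s, u, q, u, q] : Fin 8 → ℝ) i = m →
      BddLip S (fun z => z i) m 1 := fun i m hm =>
    ⟨fun z hz => hm ▸ hz i, fun z _ w _ => by
      rw [one_mul, ← Real.dist_eq]; exact dist_le_pi_dist z w i⟩
  have X := co 0 x rfl
  have Y := co 1 y rfl
  have C := co 2 c rfl
  have T := co 3 s rfl
  have he0 : 0 ≤ e := by rw [he]; positivity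
  have hr0 : 0 ≤ x * c + y * s := by positivity
  have hmK0 : 0 ≤ mK := by rw [hmK]; positivity
  have hmA0 : 0 ≤ mA := by rw [hmA]; positivity
  have hmB0 : 0 ≤ mB := by rw [hmB]; positivity
  have EE := (X.mul T hx hs).sub (Y.mul C hy hc)
  rw [← he] at EE
  have KK := (C.const_mul (a := 2) (by norm_num)).add (Y.mul EE hy he0)
  rw [← hmK] at KK
  have RR := (X.mul C hx hc).add (Y.mul T hy hs)
  have AA := (Y.mul RR hy hr0).const_mul (a := 4) (by norm_num)
  rw [← hmA] at AA
  have BB := ((KK.mul KK hmK0 hmK0).add ((C.mul C hc hc).const_mul (a := 4) (by norm_num))).add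
    ((Y.mul Y hy hy).const_mul (a := 2) (by norm_num))
  rw [← hmB] at BB
  have row : ∀ (g : (Fin 8 → ℝ) → ℝ) (m L : ℝ) (i : Fin 8) (a : ℝ), BddLip S g m L → 0 ≤ a →
      (∀ z, field z i = a * g z) → a * L ≤ κ →
      ∀ z ∈ S, ∀ w ∈ S, |field z i - field w i| ≤ κ * dist z w := by
    intro g m L i a hg ha hi hκ z hz w hw
    have h1 := (hg.const_mul ha).lip z hz w hw
    rw [hi, hi]
    exact h1.trans (mul_le_mul_of_nonneg_right hκ dist_nonneg)
  have U := fun (i j : Fin 8) (hi : (![x, y, c, s, u, q, u, q] : Fin 8 → ℝ) i = u)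
    (hj : (![x, y, c, s, u, q, u, q] : Fin 8 → ℝ) j = q) =>
    (AA.mul (co j q hj) hmA0 hq).sub (BB.mul (co i u hi) hmB0 hu)
  intro z w hz hw i
  fin_cases i
  · refine row _ _ _ 0 1 (Y.mul C hy hc) zero_le_one (fun z => ?_) ?_ z hz w hw
    · simp [field]
    · linarith
  · refine row _ _ _ 1 1 (Y.mul T hy hs) zero_le_one (fun z => ?_) ?_ z hz w hw
    · simp [field]
    · linarith
  · refine row _ _ _ 2 (1 / 2) (T.mul KK hs hmK0).neg (by norm_num) (fun z => ?_) ?_ z hz w hw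
    · simp [field, turn]; ring
    · subst hlK hl; linarith
  · refine row _ _ _ 3 (1 / 2) (C.mul KK hc hmK0) (by norm_num) (fun z => ?_) ?_ z hz w hw
    · simp [field, turn]; ring
    · subst hlK hl; linarith
  · refine row _ _ _ 4 2 (co 5 q rfl) (by norm_num) (fun z => ?_) ?_ z hz w hw
    · simp [field]
    · linarith
  · refine row _ _ _ 5 (1 / 8) (U 4 5 rfl rfl) (by norm_num) (fun z => ?_) ?_ z hz w hw
    · simp [field, turn, drift, pot]; ring
    · subst hlB hlA hlK hl; linarith
  · refine row _ _ _ 6 2 (co 7 q rfl) (by norm_num) (fun z => ?_) ?_ z hz w hw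
    · simp [field]
    · linarith
  · refine row _ _ _ 7 (1 / 8) (U 6 7 rfl rfl) (by norm_num) (fun z => ?_) ?_ z hz w hw
    · simp [field, turn, drift, pot]; ring
    · subst hlB hlA hlK hl; linarith

/-! ### A Taylor integrator that the kernel can evaluate

Everything is defined by recursors and by the operations on literals that the kernel performs with
its arithmetic library. A polynomial with integer coefficients is packed into one integer, its value
at `2 ^ slot`, so that a product of polynomials is a single multiplication. Lengths are measured in
units of `2 ^ (-96)`, and times in units of `2 ^ (-48)`. -/

/-- `k n`, with `n` evaluated to a literal before `k` is unfolded. -/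
def forceNat {α : Type} (n : Nat) (k : Nat → α) : α :=
  Nat.rec (motive := fun _ => α) (k Nat.zero) (fun m _ => k (Nat.succ m)) n

/-- `k n`, with `n` evaluated to a literal before `k` is unfolded. -/
def forceInt {α : Type} (n : Int) (k : Int → α) : α :=
  Int.rec (motive := fun _ => α) (fun n => forceNat n fun n => k (Int.ofNat n))
    (fun n => forceNat n fun n => k (Int.negSucc n)) n

/-- The power `2 ^ k` as an integer. -/
def twoPow (k : Nat) : Int := Int.ofNat (Nat.pow 2 k)

/-- The width in bits of the slot reserved for each coefficient of a packed polynomial. The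
coefficients that occur are smaller than `2 ^ 750`, see `defect_sound`. -/
def slot : Nat := 768

/-- The function `2 ^ 289 * turn`, of variables in units of `2 ^ (-96)`. -/
def turnZ (x y c s : Int) : Int :=
  Int.add (Int.mul (twoPow 193) c) (Int.mul y (Int.add (Int.mul x s) (Int.neg (Int.mul y c))))

/-- The function `2 ^ 579 * drift`, of variables in units of `2 ^ (-96)`. -/
def driftZ (x y c s : Int) : Int :=
  Int.mul (twoPow 290) (Int.mul y (Int.add (Int.mul x c) (Int.mul y s)))

/-- The function `2 ^ 578 * pot`, of variables in units of `2 ^ (-96)`, with `K` the value of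
`turnZ`. -/
def potZ (y c K : Int) : Int :=
  Int.add (Int.add (Int.mul K K) (Int.mul (twoPow 386) (Int.mul c c)))
    (Int.mul (twoPow 385) (Int.mul y y))

/-- The packed polynomial `V`, truncated to its digits below the bit `sh`. -/
def trunc (sh : Nat) (V : Int) : Int := Int.emod V (twoPow sh)

/-- The digit of `V` between the bits `sh` and `sh'`, for digits between `-2 ^ (slot - 1)` and
`2 ^ (slot - 1)`. -/
def digit (sh sh' : Nat) (V : Int) : Int :=
  Int.sub (Int.ofNat (Nat.shiftRight (Int.toNat (trunc sh'
    (Int.add V (Int.add (twoPow (Nat.sub sh' 1)) (twoPow (Nat.sub sh 1)))))) sh))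
    (twoPow (Nat.sub slot 1))

/-- The Taylor coefficient of order `n + 1` of a component, from the coefficient of order `n` of its
derivative `V`, whose scale is `2 ^ (b + 48)`. -/
def nextCoeff (hn : Int) (n sh sh' b : Nat) (V : Int) : Int :=
  Int.ediv (Int.mul hn (digit sh sh' V)) (Int.ofNat (Nat.mul (Nat.pow 2 b) (Nat.succ n)))

/-- The difference `a - m`. -/
def subNat (a : Int) (m : Nat) : Int :=
  Int.rec (motive := fun _ => Int) (fun p => Int.subNatNat p m)
    (fun p => Int.negSucc (Nat.add p m)) a

/-- The integer `a + X * p`. It is computed without the intermediate result `X * p` as an integer: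
the kernel hashes literals by their last bits, which would be the same for all multiples of a power
of two. -/
def mulAdd (a : Int) (X : Nat) (p : Int) : Int :=
  Int.rec (motive := fun _ => Int) (fun n => Int.add a (Int.ofNat (Nat.mul X n)))
    (fun n => subNat a (Nat.mul X (Nat.succ n))) p

/-- The polynomial `P`, with one more coefficient. -/
def push (P a : Int) (sh : Nat) : Int := mulAdd P (Nat.pow 2 sh) a

/-- The Taylor coefficients of the solution, up to the order `N`, over a time step `hn`: the
vector field is evaluated on packed polynomials, whose coefficients are the digits of one integer,
and one more coefficient is read off at each order. The result is passed to `k`, and nothing is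
claimed about it: the approximate solution is checked afterwards. -/
def genLoop (hn : Int) (N : Nat) : Nat → (px py pc ps pu pq pv pr : Int) →
    (x y c s u q v r : List Int) → (List Int → List Int → List Int → List Int → List Int →
      List Int → List Int → List Int → Bool) → Bool :=
  Nat.rec (motive := fun _ => (px py pc ps pu pq pv pr : Int) →
    (x y c s u q v r : List Int) → (List Int → List Int → List Int → List Int → List Int →
      List Int → List Int → List Int → Bool) → Bool)
    (fun _ _ _ _ _ _ _ _ x y c s u q v r k => k x.reverse y.reverse c.reverse s.reverse
      u.reverse q.reverse v.reverse r.reverse)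
    (fun m ih px py pc ps pu pq pv pr x y c s u q v r k =>
      forceNat (Nat.sub (Nat.sub N 1) m) fun n =>
      forceNat (Nat.mul slot n) fun sh =>
      forceNat (Nat.mul slot (Nat.succ n)) fun sh' =>
      forceInt (trunc sh' (turnZ px py pc ps)) fun K =>
      forceInt (trunc sh' (driftZ px py pc ps)) fun A =>
      forceInt (trunc sh' (Int.neg (potZ py pc K))) fun B =>
      forceInt (nextCoeff hn n sh sh' 144 (Int.mul py pc)) fun ax =>
      forceInt (nextCoeff hn n sh sh' 144 (Int.mul py ps)) fun ay =>
      forceInt (nextCoeff hn n sh sh' 337 (Int.neg (Int.mul ps K))) fun ac =>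
      forceInt (nextCoeff hn n sh sh' 337 (Int.mul pc K)) fun as =>
      forceInt (nextCoeff hn n sh sh' 48 (Int.mul 2 pq)) fun au =>
      forceInt (nextCoeff hn n sh sh' 627 (Int.add (Int.mul A pq) (Int.mul B pu))) fun aq =>
      forceInt (nextCoeff hn n sh sh' 48 (Int.mul 2 pr)) fun av =>
      forceInt (nextCoeff hn n sh sh' 627 (Int.add (Int.mul A pr) (Int.mul B pv))) fun ar =>
      forceInt (push px ax sh') fun px => forceInt (push py ay sh') fun py =>
      forceInt (push pc ac sh') fun pc => forceInt (push ps as sh') fun ps =>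
      forceInt (push pu au sh') fun pu => forceInt (push pq aq sh') fun pq =>
      forceInt (push pv av sh') fun pv => forceInt (push pr ar sh') fun pr =>
      ih px py pc ps pu pq pv pr (ax :: x) (ay :: y) (ac :: c) (as :: s)
        (au :: u) (aq :: q) (av :: v) (ar :: r) k)

/-- The value and the derivative at `2 ^ slot` of the polynomial with the coefficients `l`. -/
def pack (l : List Int) (k : Int → Int → Bool) : Bool :=
  List.rec (motive := fun _ => (Int → Int → Bool) → Bool) (fun k => k 0 0)
    (fun a _ ih k => ih fun p d =>
      forceInt (mulAdd p (Nat.pow 2 slot) d) fun d' =>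
      forceInt (mulAdd a (Nat.pow 2 slot) p) fun p' => k p' d') l k

/-- The sum of the absolute values of the coefficients. -/
def normOne (l : List Int) : Nat :=
  List.rec (motive := fun _ => Nat) 0 (fun a _ ih => Nat.add (Int.natAbs a) ih) l

/-- The sum of the coefficients. -/
def sumL (l : List Int) : Int :=
  List.rec (motive := fun _ => Int) 0 (fun a _ ih => Int.add a ih) l

/-- The number of coefficients. -/
def lenL (l : List Int) : Nat :=
  List.rec (motive := fun _ => Nat) 0 (fun _ _ ih => Nat.succ ih) l

/-- All digits of `V`, in the slots that `ones` marks, are between `-2 ^ b` and `2 ^ b`: the digits of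
`V + 2 ^ b * ones` have no bits above the lowest `b + 1`. -/
def smallDigits (ones b : Nat) (V : Int) : Bool :=
  Int.rec (motive := fun _ => Bool)
    (fun n => Nat.beq
      (Nat.land n (Nat.mul (Nat.sub (Nat.pow 2 slot) (Nat.pow 2 (Nat.succ b))) ones)) 0)
    (fun _ => false) (Int.add V (Int.mul (twoPow b) (Int.ofNat ones)))

/-- The check of one component of the differential equation: the coefficients of the difference of the
derivative `d` and `hn` times the right-hand side `G`, whose scale is `2 ^ (b + 48)`, are at most
`2 ^ bb` units of length. -/
def defectCheck (ones b bb : Nat) (hn d G : Int) : Bool :=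
  smallDigits ones (Nat.add b bb) (Int.sub (Int.mul (twoPow b) d) (Int.mul hn G))

/-- A bound, in units of `2 ^ (-30)`, for the product of the time step and the Lipschitz constant of
the vector field on a box. -/
def lipBound (hn x y c s u q : Nat) : Nat :=
  forceNat (Nat.add (Nat.mul x s) (Nat.mul y c)) fun e =>
  forceNat (Nat.add (Nat.add x s) (Nat.add y c)) fun l =>
  forceNat (Nat.add (Nat.mul (Nat.pow 2 193) c) (Nat.mul y e)) fun K =>
  forceNat (Nat.add (Nat.add (Nat.pow 2 193) (Nat.mul y l)) e) fun lK =>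
  forceNat (Nat.add (Nat.mul x c) (Nat.mul y s)) fun r =>
  forceNat (Nat.mul (Nat.pow 2 290) (Nat.mul y r)) fun A =>
  forceNat (Nat.mul (Nat.pow 2 290) (Nat.add (Nat.mul y l) r)) fun lA =>
  forceNat (Nat.add (Nat.add (Nat.mul K K) (Nat.mul (Nat.pow 2 386) (Nat.mul c c)))
    (Nat.mul (Nat.pow 2 385) (Nat.mul y y))) fun B =>
  forceNat (Nat.add (Nat.add (Nat.mul 2 (Nat.mul K lK)) (Nat.mul (Nat.pow 2 387) c))
    (Nat.mul (Nat.pow 2 386) y)) fun lB =>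
  Nat.succ (max (max (Nat.div (Nat.mul hn (Nat.add y (max c s))) (Nat.pow 2 114))
    (Nat.div (Nat.mul hn (Nat.add (Nat.mul (max c s) lK) K)) (Nat.pow 2 307)))
    (max (Nat.div (Nat.mul hn 2) (Nat.pow 2 18))
      (Nat.div (Nat.mul hn (Nat.add (Nat.add A (Nat.mul q lA)) (Nat.add B (Nat.mul u lB))))
        (Nat.pow 2 597))))

/-- The error at the end of a step: the error `e` at its beginning, increased by a bound for the
defect (at most 161 coefficients of at most `bb` bits), times a bound for `exp (k / 2 ^ 30)`. -/
def nextErr (e bb k : Nat) : Nat :=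
  Nat.succ (Nat.div (Nat.mul (Nat.add e (Nat.mul 161 (Nat.pow 2 bb)))
    (Nat.add (Nat.add (Nat.pow 2 92) (Nat.mul (Nat.pow 2 62) k))
      (Nat.add (Nat.mul (Nat.pow 2 31) (Nat.mul k k)) (Nat.mul k (Nat.mul k k))))) (Nat.pow 2 92))

/-- One step of the integration: the length `hn` of the step in units of `2 ^ (-48)`, the number
`bb` of bits allowed for the coefficients of the defect, the conditions to be checked during the
step, encoded by `kind`, and bounds for the first coordinates, in units of `2 ^ (-20)`. -/
structure Step where
  hn : Nat
  bb : Nat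
  kind : Nat
  box : List (Int × Int)

/-- The lower end of an interval that contains the values of the polynomial with the coefficients `l`
on `[0, 1]`, enlarged by `e`. -/
def lower (l : List Int) (e : Nat) : Int :=
  List.rec (motive := fun _ => Int) (Int.neg (Int.ofNat e))
    (fun a t _ => Int.sub a (Int.ofNat (Nat.add (normOne t) e))) l

/-- The upper end of an interval that contains the values of the polynomial with the coefficients `l`
on `[0, 1]`, enlarged by `e`. -/
def upper (l : List Int) (e : Nat) : Int :=
  List.rec (motive := fun _ => Int) (Int.ofNat e)
    (fun a t _ => Int.add a (Int.ofNat (Nat.add (normOne t) e))) l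

/-- The test for `a < b`. -/
def ltZ (a b : Int) : Bool := Int.rec (motive := fun _ => Bool) (fun n => Nat.blt 0 n)
  (fun _ => false) (Int.sub b a)

/-- The test for `a ≤ b`. -/
def leZ (a b : Int) : Bool := Int.rec (motive := fun _ => Bool) (fun _ => true)
  (fun _ => false) (Int.sub b a)

/-- Sufficient conditions for `KindSpec`, in terms of intervals for `x, y, c, s`. The three
kinds are the beginning of the profile, its middle part, and its end. -/
def kindCheck (kind : Nat) (xl xh yl yh cl ch sl sh : Int) : Bool :=
  match kind with
  | 0 => true
  | 1 => ltZ 0 cl && ltZ (twoPow 97) yl &&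
      ((ltZ 0 xl && ltZ sh 0) ||
        ltZ (Int.mul (max xh (Int.neg xl)) (Int.mul (max sh (Int.neg sl)) yh))
          (Int.mul (twoPow 193) cl))
  | 2 => ltZ sh 0 && ltZ 0 xl && ltZ 0 yl &&
      ltZ (Int.add (Int.mul xh (max ch 0)) (Int.mul yl sh)) 0
  | _ => ltZ ch 0 && ltZ 0 yl && ltZ yh (twoPow 96) && ltZ xh (twoPow 96) &&
      ltZ (Int.neg (twoPow 96)) xl &&
      ltZ (Int.add (Int.mul (twoPow 96) ch)
        (Int.mul (max xh (Int.neg xl)) (max sh (Int.neg sl)))) 0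

/-- The intervals `l` are contained in the intervals `box`. -/
def boxCheck (box : List (Int × Int)) (l : List (Int × Int)) : Bool :=
  List.rec (motive := fun _ => List (Int × Int) → Bool) (fun _ => true)
    (fun b _ ih l => List.rec (motive := fun _ => Bool) false
      (fun i t _ =>
        leZ (Int.mul (twoPow 76) b.1) i.1 && leZ i.2 (Int.mul (twoPow 76) b.2) && ih t) l)
    box l

/-- The check that the eight polynomials are an approximate solution. -/
def odeCheck (ones : Nat) (hn bb : Nat) (X Y C S U Q V R : List Int) : Bool :=
  pack X fun px dx => pack Y fun py dy => pack C fun pc dc => pack S fun ps ds =>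
  pack U fun pu du => pack Q fun pq dq => pack V fun pv dv => pack R fun pr dr =>
  forceInt (turnZ px py pc ps) fun K =>
  forceInt (driftZ px py pc ps) fun A =>
  forceInt (Int.neg (potZ py pc K)) fun B =>
  defectCheck ones 144 bb (Int.ofNat hn) dx (Int.mul py pc) &&
  defectCheck ones 144 bb (Int.ofNat hn) dy (Int.mul py ps) &&
  defectCheck ones 337 bb (Int.ofNat hn) dc (Int.neg (Int.mul ps K)) &&
  defectCheck ones 337 bb (Int.ofNat hn) ds (Int.mul pc K) &&
  defectCheck ones 48 bb (Int.ofNat hn) du (Int.mul 2 pq) &&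
  defectCheck ones 627 bb (Int.ofNat hn) dq (Int.add (Int.mul A pq) (Int.mul B pu)) &&
  defectCheck ones 48 bb (Int.ofNat hn) dv (Int.mul 2 pr) &&
  defectCheck ones 627 bb (Int.ofNat hn) dr (Int.add (Int.mul A pr) (Int.mul B pv))

/-- The error allowed for, in units of `2 ^ (-96)`. -/
def maxErr : Nat := Nat.pow 2 86

/-- The bound `8` for all quantities, in units of `2 ^ (-96)`. -/
def maxAbs : Nat := Nat.pow 2 99

/-- The check that a polynomial has degree at most 22 and takes values of moderate size. A bound for
the size of these values and of nearby ones is passed to `k`. -/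
def sizeCheck (l : List Int) (k : Nat → Bool) : Bool :=
  Nat.ble (lenL l) 23 && forceNat (Nat.add (normOne l) maxErr) fun n => Nat.ble n maxAbs && k n

/-- The check of one step, which passes the error at the end of the step to `k`. -/
def stepCheck (ones : Nat) (st : Step) (e : Nat) (X Y C S U Q V R : List Int) (k : Nat → Bool) :
    Bool :=
  forceNat st.hn fun hn => Nat.blt 0 hn && Nat.ble hn (Nat.pow 2 48) && Nat.ble st.bb 90 &&
  sizeCheck X fun nx => sizeCheck Y fun ny => sizeCheck C fun nc => sizeCheck S fun ns =>
  sizeCheck U fun nu => sizeCheck Q fun nq => sizeCheck V fun nv => sizeCheck R fun nr =>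
  forceNat (lipBound hn nx ny nc ns (max nu nv) (max nq nr)) fun κ =>
  Nat.ble κ (Nat.pow 2 30) &&
  forceNat (nextErr e st.bb κ) fun e' =>
  Nat.ble e' maxErr &&
  odeCheck ones hn st.bb X Y C S U Q V R &&
  kindCheck st.kind (lower X e') (upper X e') (lower Y e') (upper Y e')
    (lower C e') (upper C e') (lower S e') (upper S e') &&
  boxCheck st.box [(lower X e', upper X e'), (lower Y e', upper Y e'), (lower C e', upper C e'),
    (lower S e', upper S e'), (lower U e', upper U e'), (lower Q e', upper Q e'),
    (lower V e', upper V e'), (lower R e', upper R e')] &&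
  k e'

/-- The integration of the equation, from the initial value `(x, y, c, s, u, q, v, r)`, which is
known up to the error `e`. -/
def run (ones : Nat) (l : List Step) : (e : Nat) → (x y c s u q v r : Int) → Bool :=
  List.rec (motive := fun _ => (e : Nat) → (x y c s u q v r : Int) → Bool)
    (fun _ _ _ _ _ _ _ _ _ => true)
    (fun st _ ih e x y c s u q v r =>
      genLoop (Int.ofNat st.hn) 22 22 x y c s u q v r [] [] [] [] [] [] [] []
      fun X Y C S U Q V R => stepCheck ones st e (x :: X) (y :: Y) (c :: C) (s :: S) (u :: U)
        (q :: Q) (v :: V) (r :: R) fun e' =>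
      forceInt (sumL (x :: X)) fun x => forceInt (sumL (y :: Y)) fun y =>
      forceInt (sumL (c :: C)) fun c => forceInt (sumL (s :: S)) fun s =>
      forceInt (sumL (u :: U)) fun u => forceInt (sumL (q :: Q)) fun q =>
      forceInt (sumL (v :: V)) fun v => forceInt (sumL (r :: R)) fun r =>
      ih e' x y c s u q v r) l

/-- The number whose first 161 digits in the base `2 ^ slot` are one. The degree of the right-hand
side of the equation, on polynomials with 23 coefficients, is less than `7 * 23 = 161`. -/
def allOnes : Nat :=
  Nat.div (Nat.sub (Nat.pow 2 (Nat.mul slot 161)) 1) (Nat.sub (Nat.pow 2 slot) 1)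

/-- The integration, from the initial value `(0, a, 1, 0, u, 0, 0, u)`, with the initial error
`e`. -/
def certified (l : List Step) (e : Nat) (a u : Int) : Bool :=
  forceNat allOnes fun ones => run ones l e 0 a (twoPow 96) 0 u 0 0 u

/-! ### Polynomials as lists of coefficients -/

theorem forceNat_eq {α : Type} (n : Nat) (k : Nat → α) : forceNat n k = k n := by cases n <;> rfl

theorem forceInt_eq {α : Type} (n : Int) (k : Int → α) : forceInt n k = k n := by
  cases n <;> simp only [forceInt, forceNat_eq]

theorem int_add_eq (a b : ℤ) : Int.add a b = a + b := rfl
theorem int_mul_eq (a b : ℤ) : Int.mul a b = a * b := rfl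
theorem int_sub_eq (a b : ℤ) : Int.sub a b = a - b := rfl
theorem int_neg_eq (a : ℤ) : Int.neg a = -a := rfl
theorem nat_add_eq (a b : ℕ) : Nat.add a b = a + b := rfl
theorem nat_mul_eq (a b : ℕ) : Nat.mul a b = a * b := rfl
theorem nat_pow_eq (a b : ℕ) : Nat.pow a b = a ^ b := rfl
theorem nat_div_eq (a b : ℕ) : Nat.div a b = a / b := rfl
theorem nat_sub_eq (a b : ℕ) : Nat.sub a b = a - b := rfl
theorem twoPow_eq (k : ℕ) : twoPow k = 2 ^ k := by
  show ((2 ^ k : ℕ) : ℤ) = 2 ^ k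
  push_cast; rfl

theorem subNat_eq (a : ℤ) (m : ℕ) : subNat a m = a - m := by
  cases a with
  | ofNat p => exact Int.subNatNat_eq_coe
  | negSucc p =>
    show Int.negSucc (p + m) = _
    rw [Int.negSucc_eq, Int.negSucc_eq]; push_cast; ring

theorem mulAdd_eq (a : ℤ) (X : ℕ) (p : ℤ) : mulAdd a X p = a + X * p := by
  cases p with
  | ofNat n => show a + ((X * n : ℕ) : ℤ) = _; push_cast; rfl
  | negSucc n =>
    show subNat a (X * (n + 1)) = _
    rw [subNat_eq, Int.negSucc_eq]; push_cast; ring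

/-- The value at `x` of the polynomial with the coefficients `l`. -/
def evalL {R : Type*} [CommRing R] (x : R) : List ℤ → R
  | [] => 0
  | a :: l => a + x * evalL x l

/-- The sum of two polynomials. -/
def addL : List ℤ → List ℤ → List ℤ
  | [], m => m
  | a :: l, [] => a :: l
  | a :: l, b :: m => (a + b) :: addL l m

/-- The multiple of a polynomial by a constant. -/
def smulL (a : ℤ) (l : List ℤ) : List ℤ := l.map (a * ·)

/-- The product of two polynomials. -/
def mulL : List ℤ → List ℤ → List ℤ
  | [], _ => []
  | a :: l, m => addL (smulL a m) (0 :: mulL l m)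

/-- The derivative of a polynomial, by the rule `(a + x p)' = p + x p'`. -/
def derL : List ℤ → List ℤ
  | [] => []
  | _ :: l => addL l (0 :: derL l)

section
variable {R : Type*} [CommRing R] (x : R)

theorem evalL_addL : ∀ l m, evalL x (addL l m) = evalL x l + evalL x m
  | [], m => by simp [addL, evalL]
  | a :: l, [] => by simp [addL, evalL]
  | a :: l, b :: m => by simp only [addL, evalL, evalL_addL l m]; push_cast; ring

theorem evalL_smulL (a : ℤ) : ∀ l, evalL x (smulL a l) = a * evalL x l
  | [] => by simp [smulL, evalL]
  | b :: l => by
    have := evalL_smulL a l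
    simp only [smulL, List.map_cons, evalL] at this ⊢
    rw [this]; push_cast; ring

theorem evalL_mulL : ∀ l m, evalL x (mulL l m) = evalL x l * evalL x m
  | [], m => by simp [mulL, evalL]
  | a :: l, m => by
    simp only [mulL, evalL_addL, evalL_smulL, evalL, evalL_mulL l m]; push_cast; ring

end

theorem hasDerivAt_evalL : ∀ (l : List ℤ) (t : ℝ),
    HasDerivAt (fun t => evalL t l) (evalL t (derL l)) t
  | [], t => by simpa [evalL, derL] using hasDerivAt_const t (0 : ℝ)
  | a :: l, t => by
    have h := ((hasDerivAt_id t).mul (hasDerivAt_evalL l t)).const_add (a : ℝ)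
    refine h.congr_deriv ?_
    simp [derL, evalL_addL, evalL]

theorem normOne_cons (a : ℤ) (l : List ℤ) : normOne (a :: l) = a.natAbs + normOne l := rfl

theorem normOne_addL : ∀ l m, normOne (addL l m) ≤ normOne l + normOne m
  | [], m => by simp [addL]
  | a :: l, [] => by simp [addL]
  | a :: l, b :: m => by
    have := normOne_addL l m
    have := Int.natAbs_add_le a b
    simp only [addL, normOne_cons]; omega

theorem normOne_smulL (a : ℤ) : ∀ l, normOne (smulL a l) = a.natAbs * normOne l
  | [] => by simp [smulL, normOne]
  | b :: l => by
    have := normOne_smulL a l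
    simp only [smulL, List.map_cons, normOne_cons] at this ⊢
    rw [this, Int.natAbs_mul]; ring

theorem normOne_mulL : ∀ l m, normOne (mulL l m) ≤ normOne l * normOne m
  | [], m => by simp [mulL, normOne]
  | a :: l, m => by
    refine (normOne_addL _ _).trans ?_
    have := normOne_mulL l m
    simp only [normOne_cons, normOne_smulL, Int.natAbs_zero]; linarith

theorem normOne_derL : ∀ l, normOne (derL l) ≤ l.length * normOne l
  | [] => by simp [derL, normOne]
  | a :: l => by
    refine (normOne_addL _ _).trans ?_
    have := normOne_derL l
    simp only [normOne_cons, Int.natAbs_zero, List.length_cons]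
    have h1 : 0 ≤ l.length * a.natAbs := Nat.zero_le _
    have h2 : 0 ≤ a.natAbs := Nat.zero_le _
    calc normOne l + (0 + normOne (derL l)) ≤ normOne l + l.length * normOne l := by omega
      _ ≤ (l.length + 1) * (a.natAbs + normOne l) := by ring_nf; ring_nf at h1; omega

theorem natAbs_le_normOne : ∀ (l : List ℤ), ∀ a ∈ l, a.natAbs ≤ normOne l
  | [], _, h => by simp at h
  | b :: l, a, h => by
    rw [normOne_cons]
    rcases List.mem_cons.1 h with rfl | h
    · omega
    · have := natAbs_le_normOne l a h; omega

theorem length_addL : ∀ l m : List ℤ, (addL l m).length = max l.length m.length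
  | [], m => by simp [addL]
  | a :: l, [] => by simp [addL]
  | a :: l, b :: m => by simp [addL, length_addL l m]

theorem length_smulL (a : ℤ) (l : List ℤ) : (smulL a l).length = l.length := by simp [smulL]

theorem length_mulL : ∀ l m : List ℤ, (mulL l m).length ≤ l.length + m.length
  | [], m => by simp [mulL]
  | a :: l, m => by
    have := length_mulL l m
    simp only [mulL, length_addL, length_smulL, List.length_cons]; omega

theorem length_derL : ∀ l : List ℤ, (derL l).length ≤ l.length
  | [] => by simp [derL]
  | a :: l => by
    have := length_derL l
    simp only [derL, length_addL, List.length_cons]; omega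

theorem lenL_eq : ∀ l : List ℤ, lenL l = l.length
  | [] => rfl
  | _ :: l => congrArg Nat.succ (lenL_eq l)

theorem sumL_eq : ∀ l : List ℤ, (sumL l : ℝ) = evalL 1 l
  | [] => by simp [sumL, evalL]
  | a :: l => by
    have h : sumL (a :: l) = a + sumL l := rfl
    rw [h, evalL, Int.cast_add, sumL_eq l, one_mul]

theorem pack_eq : ∀ (l : List ℤ) (k : ℤ → ℤ → Bool),
    pack l k = k (evalL (2 ^ slot) l) (evalL (2 ^ slot) (derL l))
  | [], k => rfl
  | a :: l, k => by
    show pack l (fun p d => forceInt (mulAdd p (Nat.pow 2 slot) d) fun d' =>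
      forceInt (mulAdd a (Nat.pow 2 slot) p) fun p' => k p' d') = _
    rw [pack_eq l, forceInt_eq, forceInt_eq, mulAdd_eq, mulAdd_eq, nat_pow_eq, Nat.cast_pow,
      Nat.cast_ofNat]
    generalize (2 : ℤ) ^ slot = X
    simp [evalL, derL, evalL_addL]

theorem abs_evalL_le {t : ℝ} (ht : t ∈ Icc (0 : ℝ) 1) : ∀ l : List ℤ, |evalL t l| ≤ normOne l
  | [] => by simp [evalL, normOne]
  | a :: l => by
    have h := abs_evalL_le ht l
    have h1 : |t * evalL t l| ≤ normOne l := by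
      rw [abs_mul, abs_of_nonneg ht.1]
      exact (mul_le_of_le_one_left (abs_nonneg _) ht.2).trans h
    have h2 : ((normOne (a :: l) : ℕ) : ℝ) = |(a : ℝ)| + normOne l := by
      rw [normOne_cons, Nat.cast_add, Nat.cast_natAbs, Int.cast_abs]
    rw [evalL, h2]
    exact (abs_add_le _ _).trans (by gcongr)

theorem normOne_le_of_forall {β : ℕ} : ∀ (l : List ℤ), (∀ a ∈ l, a.natAbs ≤ β) →
    normOne l ≤ l.length * β
  | [], _ => by simp [normOne]
  | a :: l, h => by
    have h1 := normOne_le_of_forall l fun b hb => h b (List.mem_cons_of_mem _ hb)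
    have h2 := h a (List.mem_cons_self)
    rw [normOne_cons, List.length_cons]; nlinarith

/-- The number whose first `n` digits in the base `2 ^ w` are one. -/
def onesN (w : ℕ) : ℕ → ℕ
  | 0 => 0
  | n + 1 => 1 + 2 ^ w * onesN w n

theorem onesN_mul (w : ℕ) : ∀ n, onesN w n * (2 ^ w - 1) = 2 ^ (w * n) - 1
  | 0 => by simp [onesN]
  | n + 1 => by
    have h := onesN_mul w n
    have h1 : 1 ≤ 2 ^ w := Nat.one_le_two_pow
    have h2 : 1 ≤ 2 ^ (w * n) := Nat.one_le_two_pow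
    have h3 : 1 ≤ 2 ^ (w * (n + 1)) := Nat.one_le_two_pow
    zify [h1, h2, h3] at h ⊢
    simp only [onesN]; push_cast
    rw [mul_add w, mul_one, pow_add]
    linear_combination 2 ^ w * h

theorem allOnes_eq : allOnes = onesN slot 161 := by
  have h := onesN_mul slot 161
  have h0 : slot ≠ 0 := by simp [slot]
  have h1 : 0 < 2 ^ slot - 1 := Nat.sub_pos_of_lt (Nat.one_lt_two_pow h0)
  unfold allOnes
  rw [nat_div_eq, nat_sub_eq, nat_sub_eq, nat_pow_eq, nat_pow_eq, nat_mul_eq, ← h,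
    Nat.mul_div_cancel _ h1]

/-- A number below `2 ^ w` without bits between `b` and `w` is below `2 ^ b`. -/
theorem lt_two_pow_of_land_eq_zero {w b u : ℕ} (hb : b ≤ w) (hu : u < 2 ^ w)
    (h : u &&& (2 ^ w - 2 ^ b) = 0) : u < 2 ^ b := by
  have h1 : 2 ^ w - 2 ^ b = (2 ^ (w - b) - 1) * 2 ^ b := by
    rw [Nat.sub_mul, one_mul, ← pow_add, Nat.sub_add_cancel hb]
  have h2 : (u / 2 ^ b) &&& (2 ^ (w - b) - 1) = 0 := by
    have := congrArg (· / 2 ^ b) h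
    simp only [Nat.zero_div, Nat.and_div_two_pow, h1] at this
    rwa [Nat.mul_div_cancel _ (by positivity)] at this
  rw [Nat.and_two_pow_sub_one_eq_mod, Nat.mod_eq_of_lt] at h2
  · by_contra h3
    have := Nat.div_pos (not_lt.1 h3) (by positivity : 0 < 2 ^ b)
    omega
  · rw [Nat.div_lt_iff_lt_mul (by positivity), ← pow_add, Nat.sub_add_cancel hb]
    exact hu

/-- Bounded digits of a packed polynomial are bounds for its coefficients, provided that these are
known to be too small to overflow their slots. -/
theorem natAbs_le_of_land {w b : ℕ} (hb : b + 2 ≤ w) : ∀ (l : List ℤ) (n U : ℕ), l.length ≤ n →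
    (∀ a ∈ l, a.natAbs + 2 ^ b < 2 ^ (w - 1)) →
    (U : ℤ) = evalL (2 ^ w) l + 2 ^ b * onesN w n →
    U &&& ((2 ^ w - 2 ^ (b + 1)) * onesN w n) = 0 → ∀ a ∈ l, a.natAbs ≤ 2 ^ b
  | [], _, _, _, _, _, _, _, h => by simp at h
  | a :: l, 0, _, h, _, _, _, _, _ => by simp at h
  | a :: l, n + 1, U, hlen, hsm, hU, hand, c, hc => by
    have hw : 2 ^ w = 2 * 2 ^ (w - 1) := by rw [← pow_succ']; congr 1; omega
    have hbw : 2 ^ (b + 1) ≤ 2 ^ (w - 1) := Nat.pow_le_pow_right (by norm_num) (by omega)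
    have hb1 : 2 ^ (b + 1) = 2 * 2 ^ b := by ring
    have ha := hsm a List.mem_cons_self
    have hM : (2 ^ w - 2 ^ (b + 1)) * onesN w (n + 1)
        = (2 ^ w - 2 ^ (b + 1)) + 2 ^ w * ((2 ^ w - 2 ^ (b + 1)) * onesN w n) := by
      simp only [onesN]; ring
    have hlow : 2 ^ w - 2 ^ (b + 1) < 2 ^ w := by
      have := Nat.two_pow_pos w; have := Nat.two_pow_pos (b + 1); omega
    have hmod : (U % 2 ^ w) &&& (2 ^ w - 2 ^ (b + 1)) = 0 := by
      have := congrArg (· % 2 ^ w) hand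
      simp only [Nat.zero_mod, Nat.and_mod_two_pow, hM, Nat.add_mul_mod_self_left] at this
      rwa [Nat.mod_eq_of_lt hlow] at this
    have hu := lt_two_pow_of_land_eq_zero (by omega) (Nat.mod_lt _ (by positivity)) hmod
    have hdiv : (U / 2 ^ w) &&& ((2 ^ w - 2 ^ (b + 1)) * onesN w n) = 0 := by
      have := congrArg (· / 2 ^ w) hand
      simp only [Nat.zero_div, Nat.and_div_two_pow, hM] at this
      rwa [Nat.add_mul_div_left _ _ (by positivity), Nat.div_eq_of_lt hlow, zero_add] at this
    have hUd : (U : ℤ) = (U % 2 ^ w : ℕ) + 2 ^ w * (U / 2 ^ w : ℕ) := by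
      exact_mod_cast (Nat.mod_add_div U (2 ^ w)).symm
    -- the lowest digit is determined by its residue class and its size
    have hkey : ((U % 2 ^ w : ℕ) : ℤ) - (a + 2 ^ b) = 0 := by
      refine Int.eq_zero_of_abs_lt_dvd (m := 2 ^ w)
        ⟨evalL (2 ^ w) l + 2 ^ b * onesN w n - (U / 2 ^ w : ℕ), ?_⟩ ?_
      · simp only [evalL, onesN] at hU
        push_cast at hU hUd ⊢
        linear_combination hU - hUd
      · have h1 : ((U % 2 ^ w : ℕ) : ℤ) < 2 ^ (w - 1) := by exact_mod_cast hu.trans_le hbw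
        have h2 : |a| + 2 ^ b < 2 ^ (w - 1) := by
          rw [Int.abs_eq_natAbs]; exact_mod_cast ha
        have h3 : (2 : ℤ) ^ w = 2 * 2 ^ (w - 1) := by exact_mod_cast hw
        have h4 := abs_lt.1 (by linarith [abs_nonneg a] : |a| < 2 ^ (w - 1) - 2 ^ b)
        have h5 : (0 : ℤ) < 2 ^ b := by positivity
        have h6 : (0 : ℤ) ≤ ((U % 2 ^ w : ℕ) : ℤ) := by positivity
        rw [abs_lt]; constructor <;> linarith
    rcases List.mem_cons.1 hc with rfl | hc
    · have h1 : ((U % 2 ^ w : ℕ) : ℤ) < 2 * 2 ^ b := by rw [hb1] at hu; exact_mod_cast hu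
      have h6 : (0 : ℤ) ≤ ((U % 2 ^ w : ℕ) : ℤ) := by positivity
      zify
      rw [abs_le]; constructor <;> linarith
    · refine natAbs_le_of_land hb l n (U / 2 ^ w) (by simpa using hlen)
        (fun d hd => hsm d (List.mem_cons_of_mem _ hd)) ?_ hdiv c hc
      have hpos : (2 : ℤ) ^ w ≠ 0 := by positivity
      refine mul_left_cancel₀ hpos ?_
      simp only [evalL, onesN] at hU
      push_cast at hU hUd hkey ⊢
      linear_combination hU - hUd - hkey

set_option exponentiation.threshold 1000 in
theorem smallDigits_sound {b : ℕ} (hb : b + 2 ≤ slot) {Q : List ℤ} (hlen : Q.length ≤ 161)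
    (hQ : normOne Q + 2 ^ b < 2 ^ (slot - 1))
    (h : smallDigits allOnes b (evalL (2 ^ slot) Q) = true) : normOne Q ≤ 161 * 2 ^ b := by
  have h1 : ∀ a ∈ Q, a.natAbs ≤ 2 ^ b := by
    unfold smallDigits at h
    rw [allOnes_eq] at h
    rcases hU : Int.add (evalL (2 ^ slot) Q) (Int.mul (twoPow b) (Int.ofNat (onesN slot 161)))
      with U | U
    · rw [hU] at h
      refine natAbs_le_of_land hb Q 161 U hlen
        (fun a ha => by have := natAbs_le_normOne Q a ha; omega) ?_ (Nat.eq_of_beq_eq_true h)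
      rw [int_add_eq, int_mul_eq, twoPow_eq] at hU
      exact hU.symm
    · rw [hU] at h; exact absurd h (by simp)
  refine (normOne_le_of_forall Q h1).trans ?_
  gcongr

/-! ### Soundness of the integrator -/

section Soundness
set_option exponentiation.threshold 1000

/-- The list `l` has at most `n` entries, whose absolute values sum up to at most `2 ^ k`. -/
def Small (l : List ℤ) (n k : ℕ) : Prop := l.length ≤ n ∧ normOne l ≤ 2 ^ k

namespace Small
variable {l m : List ℤ} {n n' k k' : ℕ}

theorem mono (h : Small l n k) (hn : n ≤ n') (hk : k ≤ k') : Small l n' k' :=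
  ⟨h.1.trans hn, h.2.trans (Nat.pow_le_pow_right (by norm_num) hk)⟩

theorem add (h : Small l n k) (h' : Small m n' k') :
    Small (addL l m) (max n n') (max k k' + 1) := by
  refine ⟨by rw [length_addL]; exact max_le_max h.1 h'.1, (normOne_addL _ _).trans ?_⟩
  have h1 := (h.mono le_rfl (le_max_left k k')).2
  have h2 := (h'.mono le_rfl (le_max_right k k')).2
  rw [pow_succ]; omega

theorem mul (h : Small l n k) (h' : Small m n' k') : Small (mulL l m) (n + n') (k + k') := by
  refine ⟨(length_mulL _ _).trans (add_le_add h.1 h'.1), (normOne_mulL _ _).trans ?_⟩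
  rw [pow_add]; exact Nat.mul_le_mul h.2 h'.2

theorem smul (h : Small l n k) (j : ℕ) : Small (smulL (2 ^ j) l) n (j + k) := by
  refine ⟨by rw [length_smulL]; exact h.1, ?_⟩
  rw [normOne_smulL, Int.natAbs_pow, pow_add]
  exact Nat.mul_le_mul le_rfl h.2

theorem neg (h : Small l n k) : Small (smulL (-1) l) n k := by
  refine ⟨by rw [length_smulL]; exact h.1, ?_⟩
  rw [normOne_smulL]; simpa using h.2

end Small

/-- The function `turnZ` of polynomials. -/
def turnL (x y c s : List ℤ) : List ℤ :=
  addL (smulL (2 ^ 193) c) (mulL y (addL (mulL x s) (smulL (-1) (mulL y c))))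

/-- The function `driftZ` of polynomials. -/
def driftL (x y c s : List ℤ) : List ℤ := smulL (2 ^ 290) (mulL y (addL (mulL x c) (mulL y s)))

/-- The function `potZ` of polynomials. -/
def potL (y c K : List ℤ) : List ℤ :=
  addL (addL (mulL K K) (smulL (2 ^ 386) (mulL c c))) (smulL (2 ^ 385) (mulL y y))

theorem evalL_turnL (X : ℤ) (x y c s : List ℤ) :
    turnZ (evalL X x) (evalL X y) (evalL X c) (evalL X s) = evalL X (turnL x y c s) := by
  simp only [turnZ, turnL, evalL_addL, evalL_mulL, evalL_smulL, int_add_eq, int_mul_eq, int_neg_eq,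
    twoPow_eq]
  push_cast; ring

theorem evalL_driftL (X : ℤ) (x y c s : List ℤ) :
    driftZ (evalL X x) (evalL X y) (evalL X c) (evalL X s) = evalL X (driftL x y c s) := by
  simp only [driftZ, driftL, evalL_addL, evalL_mulL, evalL_smulL, int_add_eq, int_mul_eq, twoPow_eq]
  push_cast; ring

theorem evalL_potL (X : ℤ) (y c K : List ℤ) :
    potZ (evalL X y) (evalL X c) (evalL X K) = evalL X (potL y c K) := by
  simp only [potZ, potL, evalL_addL, evalL_mulL, evalL_smulL, int_add_eq, int_mul_eq, twoPow_eq]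
  push_cast; ring

theorem defect_sound {b bb hn : ℕ} {P G : List ℤ} (hP : Small P 23 99) (hG : Small G 161 700)
    (hb : b ≤ 627) (hbb : bb ≤ 90) (hhn : hn ≤ 2 ^ 48)
    (h : defectCheck allOnes b bb (Int.ofNat hn) (evalL (2 ^ slot) (derL P))
      (evalL (2 ^ slot) G) = true)
    {τ : ℝ} (hτ : τ ∈ Icc (0 : ℝ) 1) :
    |2 ^ b * evalL τ (derL P) - hn * evalL τ G| ≤ 161 * 2 ^ (b + bb) := by
  set Q := addL (smulL (2 ^ b) (derL P)) (smulL (-(hn : ℤ)) G) with hQ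
  have hev : ∀ {R : Type} [CommRing R] (x : R),
      evalL x Q = 2 ^ b * evalL x (derL P) - hn * evalL x G := by
    intro R _ x
    rw [hQ, evalL_addL, evalL_smulL, evalL_smulL]; push_cast; ring
  have hd : Small (derL P) 23 104 := by
    refine ⟨(length_derL P).trans hP.1, (normOne_derL P).trans ?_⟩
    calc P.length * normOne P ≤ 23 * 2 ^ 99 := Nat.mul_le_mul hP.1 hP.2
      _ ≤ 2 ^ 104 := by norm_num
  have h1 := hd.smul b
  have h2 : Small (smulL (-(hn : ℤ)) G) 161 748 := by
    refine ⟨by rw [length_smulL]; exact hG.1, ?_⟩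
    rw [normOne_smulL, Int.natAbs_neg, Int.natAbs_natCast]
    exact (Nat.mul_le_mul hhn hG.2).trans (by rw [← pow_add])
  have h3 : Small Q 161 749 := (h1.add h2).mono (by norm_num) (by omega)
  have h4 : 2 ^ (b + bb) ≤ 2 ^ 717 := Nat.pow_le_pow_right (by norm_num) (by omega)
  have h5 := smallDigits_sound (b := b + bb) (Q := Q) (by unfold slot; omega) h3.1
    (by
      have h6 := h3.2
      unfold slot
      calc normOne Q + 2 ^ (b + bb) ≤ 2 ^ 749 + 2 ^ 717 := add_le_add h6 h4
        _ < 2 ^ (768 - 1) := by norm_num)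
    (by
      rw [hev]
      unfold defectCheck at h
      rw [twoPow_eq, int_mul_eq, int_mul_eq, int_sub_eq] at h
      exact h)
  rw [← hev]
  exact (abs_evalL_le hτ Q).trans (by exact_mod_cast h5)

/-- The conclusion of `defect_sound` in the natural units. -/
theorem defect_scaled {b bb : ℕ} {h D G g : ℝ} {hn : ℕ} (hh : h = hn / 2 ^ 48)
    (hG : G = 2 ^ (b + 48) * g) (H : |2 ^ b * D - hn * G| ≤ 161 * 2 ^ (b + bb)) :
    |D / 2 ^ 96 - h * g| ≤ 161 * 2 ^ bb / 2 ^ 96 := by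
  have h1 : 2 ^ b * D - hn * G = 2 ^ (b + 96) * (D / 2 ^ 96 - h * g) := by
    rw [hh, hG, pow_add, pow_add]; field_simp
  rw [h1, abs_mul, abs_of_pos (by positivity), pow_add, pow_add] at H
  rw [le_div_iff₀ (by positivity)]
  have h2 : (0 : ℝ) < 2 ^ b := by positivity
  refine le_of_mul_le_mul_left ?_ h2
  linarith

/-- The vector of the values of eight polynomials, in units of `2 ^ (-96)`. -/
def vec8 (τ : ℝ) (X Y C S U Q V R : List ℤ) : Fin 8 → ℝ :=
  ![evalL τ X / 2 ^ 96, evalL τ Y / 2 ^ 96, evalL τ C / 2 ^ 96, evalL τ S / 2 ^ 96,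
    evalL τ U / 2 ^ 96, evalL τ Q / 2 ^ 96, evalL τ V / 2 ^ 96, evalL τ R / 2 ^ 96]

theorem hasDerivAt_vec8 (X Y C S U Q V R : List ℤ) (τ : ℝ) :
    HasDerivAt (fun τ => vec8 τ X Y C S U Q V R)
      (vec8 τ (derL X) (derL Y) (derL C) (derL S) (derL U) (derL Q) (derL V) (derL R)) τ := by
  rw [hasDerivAt_pi]
  intro i
  fin_cases i <;> exact (hasDerivAt_evalL _ τ).div_const _

theorem odeCheck_sound {hn bb : ℕ} {X Y C S U Q V R : List ℤ} (hX : Small X 23 99)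
    (hY : Small Y 23 99) (hC : Small C 23 99) (hS : Small S 23 99) (hU : Small U 23 99)
    (hQ : Small Q 23 99) (hV : Small V 23 99) (hR : Small R 23 99)
    (hbb : bb ≤ 90) (hhn : hn ≤ 2 ^ 48) (H : odeCheck allOnes hn bb X Y C S U Q V R = true)
    {τ : ℝ} (hτ : τ ∈ Icc (0 : ℝ) 1) (i : Fin 8) :
    |vec8 τ (derL X) (derL Y) (derL C) (derL S) (derL U) (derL Q) (derL V) (derL R) i -
      hn / 2 ^ 48 * field (vec8 τ X Y C S U Q V R) i| ≤ 161 * 2 ^ bb / 2 ^ 96 := by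
  simp only [odeCheck, pack_eq, forceInt_eq] at H
  simp only [evalL_turnL, evalL_driftL, evalL_potL, int_neg_eq, int_mul_eq, int_add_eq] at H
  set K := turnL X Y C S with hK
  set A := driftL X Y C S with hA
  set B := potL Y C K with hB
  have sK : Small K 69 299 := ((hC.smul 193).add (hY.mul ((hX.mul hS).add (hY.mul hC).neg))).mono
    (by norm_num) (by norm_num)
  have sA : Small A 69 588 := ((hY.mul ((hX.mul hC).add (hY.mul hS))).smul 290).mono
    (by norm_num) (by norm_num)
  have sB : Small B 138 600 := (((sK.mul sK).add ((hC.mul hC).smul 386)).add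
    ((hY.mul hY).smul 385)).mono (by norm_num) (by norm_num)
  have eK : evalL τ K = 2 ^ 289 * turn (evalL τ X / 2 ^ 96) (evalL τ Y / 2 ^ 96)
      (evalL τ C / 2 ^ 96) (evalL τ S / 2 ^ 96) := by
    simp only [hK, turnL, evalL_addL, evalL_mulL, evalL_smulL, turn]; push_cast; ring
  have eA : evalL τ A = 2 ^ 579 * drift (evalL τ X / 2 ^ 96) (evalL τ Y / 2 ^ 96)
      (evalL τ C / 2 ^ 96) (evalL τ S / 2 ^ 96) := by
    simp only [hA, driftL, evalL_addL, evalL_mulL, evalL_smulL, drift]; push_cast; ring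
  have eB : evalL τ B = 2 ^ 578 * pot (evalL τ X / 2 ^ 96) (evalL τ Y / 2 ^ 96)
      (evalL τ C / 2 ^ 96) (evalL τ S / 2 ^ 96) := by
    simp only [hB, potL, evalL_addL, evalL_mulL, evalL_smulL, eK, pot]; push_cast; ring
  simp only [Bool.and_eq_true] at H
  obtain ⟨⟨⟨⟨⟨⟨⟨h0, h1⟩, h2⟩, h3⟩, h4⟩, h5⟩, h6⟩, h7⟩ := H
  simp only [← evalL_mulL] at h0 h1 h2 h3 h5 h7
  -- the right-hand sides are written as single packed polynomials
  have n2 : ∀ l : List ℤ, -evalL (2 ^ slot : ℤ) l = evalL (2 ^ slot) (smulL (-1) l) := fun l => by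
    rw [evalL_smulL]; push_cast; ring
  have n4 : ∀ l : List ℤ, 2 * evalL (2 ^ slot : ℤ) l = evalL (2 ^ slot) (smulL (2 ^ 1) l) :=
    fun l => by rw [evalL_smulL]; push_cast; ring
  rw [n2] at h2 h5 h7
  rw [n4] at h4 h6
  rw [← evalL_mulL, ← evalL_addL] at h5 h7
  fin_cases i
  · exact defect_scaled rfl (by rw [evalL_mulL]; simp [field, vec8]; ring)
      (defect_sound hX ((hY.mul hC).mono (by norm_num) (by norm_num)) (by norm_num) hbb hhn h0 hτ)
  · exact defect_scaled rfl (by rw [evalL_mulL]; simp [field, vec8]; ring)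
      (defect_sound hY ((hY.mul hS).mono (by norm_num) (by norm_num)) (by norm_num) hbb hhn h1 hτ)
  · exact defect_scaled rfl (by rw [evalL_smulL, evalL_mulL, eK]; simp [field, vec8]; ring)
      (defect_sound hC ((hS.mul sK).neg.mono (by norm_num) (by norm_num)) (by norm_num) hbb hhn h2 hτ)
  · exact defect_scaled rfl (by rw [evalL_mulL, eK]; simp [field, vec8]; ring)
      (defect_sound hS ((hC.mul sK).mono (by norm_num) (by norm_num)) (by norm_num) hbb hhn h3 hτ)
  · exact defect_scaled rfl (by rw [evalL_smulL]; simp [field, vec8]; ring)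
      (defect_sound hU ((hQ.smul 1).mono (by norm_num) (by norm_num)) (by norm_num) hbb hhn h4 hτ)
  · exact defect_scaled rfl
      (by rw [evalL_addL, evalL_mulL, evalL_mulL, evalL_smulL, eA, eB]; simp [field, vec8]; ring)
      (defect_sound hQ (((sA.mul hQ).add (sB.neg.mul hU)).mono (by norm_num) (by norm_num))
        (by norm_num) hbb hhn h5 hτ)
  · exact defect_scaled rfl (by rw [evalL_smulL]; simp [field, vec8]; ring)
      (defect_sound hV ((hR.smul 1).mono (by norm_num) (by norm_num)) (by norm_num) hbb hhn h6 hτ)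
  · exact defect_scaled rfl
      (by rw [evalL_addL, evalL_mulL, evalL_mulL, evalL_smulL, eA, eB]; simp [field, vec8]; ring)
      (defect_sound hR (((sA.mul hR).add (sB.neg.mul hV)).mono (by norm_num) (by norm_num))
        (by norm_num) hbb hhn h7 hτ)

theorem le_of_div_lt {a : ℕ} {j k : ℕ} (h : a / 2 ^ j < k) : (a : ℝ) ≤ 2 ^ j * k := by
  have := Nat.lt_mul_of_div_lt h (by positivity : 0 < 2 ^ j)
  rw [mul_comm]
  exact_mod_cast this.le

theorem lipBound_sound {hn : ℕ} (hhn : 0 < hn) (x y c s u q : ℕ) :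
    LipOnBox field ![x / 2 ^ 96, y / 2 ^ 96, c / 2 ^ 96, s / 2 ^ 96, u / 2 ^ 96, q / 2 ^ 96,
      u / 2 ^ 96, q / 2 ^ 96] ((lipBound hn x y c s u q : ℕ) / 2 ^ 30 / (hn / 2 ^ 48)) := by
  set k := lipBound hn x y c s u q with hk
  simp only [lipBound, forceNat_eq, nat_add_eq, nat_mul_eq, nat_pow_eq, nat_div_eq] at hk
  have hk' := Nat.lt_of_succ_le hk.ge
  rw [max_lt_iff, max_lt_iff, max_lt_iff] at hk'
  obtain ⟨⟨h1, h2⟩, h3, h4⟩ := hk'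
  have h1 := le_of_div_lt h1
  have h2 := le_of_div_lt h2
  have h3 := le_of_div_lt h3
  have h4 := le_of_div_lt h4
  push_cast at h1 h2 h3 h4
  have hn0 : (0 : ℝ) < hn := by exact_mod_cast hhn
  have key : ∀ a : ℝ, hn * a ≤ 2 ^ 18 * k → a ≤ k / 2 ^ 30 / (hn / 2 ^ 48) := fun a ha => by
    rw [div_div, le_div_iff₀ (by positivity)]; linarith
  have m1 : ∀ a : ℝ, 0 ≤ a → a * c ≤ a * max (c : ℝ) s := fun a ha =>
    mul_le_mul_of_nonneg_left (le_max_left _ _) ha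
  have m2 : ∀ a : ℝ, 0 ≤ a → a * s ≤ a * max (c : ℝ) s := fun a ha =>
    mul_le_mul_of_nonneg_left (le_max_right _ _) ha
  refine lipOnBox_field (by positivity) (by positivity) (by positivity) (by positivity)
    (by positivity) (by positivity) rfl rfl rfl rfl rfl rfl rfl rfl ?_ ?_ ?_ ?_ ?_ ?_ <;>
    apply key
  · have := m1 hn hn0.le
    have e : (hn : ℝ) * (y / 2 ^ 96 + c / 2 ^ 96) = (hn * y + hn * c) / 2 ^ 96 := by ring
    rw [e, div_le_iff₀ (by positivity)]; linarith
  · have := m2 hn hn0.le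
    have e : (hn : ℝ) * (y / 2 ^ 96 + s / 2 ^ 96) = (hn * y + hn * s) / 2 ^ 96 := by ring
    rw [e, div_le_iff₀ (by positivity)]; linarith
  · have := m2 (hn * (2 ^ 193 + y * (x + s + (y + c)) + (x * s + y * c))) (by positivity)
    refine le_trans (le_of_eq ?_) (le_trans (div_le_div_of_nonneg_right (c := 2 ^ 289)
      ((add_le_add_left this (hn * (2 ^ 193 * c + y * (x * s + y * c)))).trans
        (le_trans (le_of_eq ?_) h2)) (by positivity)) (le_of_eq ?_)) <;> ring
  · have := m1 (hn * (2 ^ 193 + y * (x + s + (y + c)) + (x * s + y * c))) (by positivity)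
    refine le_trans (le_of_eq ?_) (le_trans (div_le_div_of_nonneg_right (c := 2 ^ 289)
      ((add_le_add_left this (hn * (2 ^ 193 * c + y * (x * s + y * c)))).trans
        (le_trans (le_of_eq ?_) h2)) (by positivity)) (le_of_eq ?_)) <;> ring
  · exact h3
  · refine le_trans (le_of_eq ?_) (le_trans (div_le_div_of_nonneg_right (c := 2 ^ 579)
      h4 (by positivity)) (le_of_eq ?_)) <;> ring

theorem exp_le_cubic {κ : ℝ} (h0 : 0 ≤ κ) (h1 : κ ≤ 1) :
    Real.exp κ ≤ 1 + κ + κ ^ 2 / 2 + κ ^ 3 / 4 := by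
  have := Real.exp_bound' h0 h1 (n := 3) (by norm_num)
  simp [Finset.sum_range_succ, Nat.factorial] at this
  nlinarith [pow_nonneg h0 3]

theorem nextErr_sound (e bb k : ℕ) :
    ((e : ℝ) / 2 ^ 96 + 161 * 2 ^ bb / 2 ^ 96) *
      (1 + k / 2 ^ 30 + (k / 2 ^ 30) ^ 2 / 2 + (k / 2 ^ 30) ^ 3 / 4) ≤ nextErr e bb k / 2 ^ 96 := by
  have h : (nextErr e bb k : ℕ) = nextErr e bb k := rfl
  conv_rhs at h => simp only [nextErr, nat_add_eq, nat_mul_eq, nat_pow_eq, nat_div_eq]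
  have h1 := le_of_div_lt (Nat.lt_of_succ_le h.ge)
  push_cast at h1
  refine le_trans (le_of_eq ?_) (le_trans (div_le_div_of_nonneg_right (c := 2 ^ 188) h1
    (by positivity)) (le_of_eq ?_)) <;> ring

/-! ### Soundness of the checks along a solution -/

theorem ltZ_iff {a b : ℤ} : ltZ a b = true ↔ a < b := by
  unfold ltZ
  rw [int_sub_eq]
  rcases h : b - a with n | n
  · show Nat.blt 0 n = true ↔ _
    rw [Nat.blt_eq]
    simp only [Int.ofNat_eq_natCast] at h; omega
  · simp only [Int.negSucc_eq] at h
    constructor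
    · intro h'; exact absurd h' (by simp)
    · intro h'; omega

theorem leZ_iff {a b : ℤ} : leZ a b = true ↔ a ≤ b := by
  unfold leZ
  rw [int_sub_eq]
  rcases h : b - a with n | n
  · simp only [Int.ofNat_eq_natCast] at h
    simp; omega
  · simp only [Int.negSucc_eq] at h
    simp; omega

/-- The properties of a piece of the profile that are read off from the enclosures: for the
beginning of the profile (`kind = 1`), its middle part (`kind = 2`), and its end. -/
def KindSpec (kind : ℕ) (z : Fin 8 → ℝ) : Prop :=
  match kind with
  | 0 => True
  | 1 => 0 < z 2 ∧ 2 < z 1 ∧ turn (z 0) (z 1) (z 2) (z 3) < 0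
  | 2 => z 3 < 0 ∧ 0 < z 0 ∧ 0 < z 1 ∧ z 0 * z 2 + z 1 * z 3 < 0
  | _ => z 2 < 0 ∧ 0 < z 1 ∧ z 1 < 1 ∧ |z 0| < 1 ∧ turn (z 0) (z 1) (z 2) (z 3) < 0

/-- The numbers `l` are contained in the intervals `box`, whose unit is `2 ^ (-20)`. -/
def InBox : List (ℤ × ℤ) → List ℝ → Prop
  | [], _ => True
  | _ :: _, [] => False
  | b :: box, a :: l => (b.1 / 2 ^ 20 ≤ a ∧ a ≤ b.2 / 2 ^ 20) ∧ InBox box l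

theorem max_abs_le {a l h : ℝ} (h1 : l ≤ a) (h2 : a ≤ h) : |a| ≤ max h (-l) :=
  abs_le'.2 ⟨h2.trans (le_max_left _ _), (neg_le_neg h1).trans (le_max_right _ _)⟩

theorem kindCheck_sound {kind : ℕ} {xl xh yl yh cl ch sl sh : ℤ}
    (H : kindCheck kind xl xh yl yh cl ch sl sh = true) {z : Fin 8 → ℝ}
    (hx : (xl : ℝ) / 2 ^ 96 ≤ z 0 ∧ z 0 ≤ xh / 2 ^ 96)
    (hy : (yl : ℝ) / 2 ^ 96 ≤ z 1 ∧ z 1 ≤ yh / 2 ^ 96)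
    (hc : (cl : ℝ) / 2 ^ 96 ≤ z 2 ∧ z 2 ≤ ch / 2 ^ 96)
    (hs : (sl : ℝ) / 2 ^ 96 ≤ z 3 ∧ z 3 ≤ sh / 2 ^ 96) : KindSpec kind z := by
  have pos : ∀ a : ℤ, 0 < a → (0 : ℝ) < a / 2 ^ 96 := fun a ha => by
    have : (0 : ℝ) < a := by exact_mod_cast ha
    positivity
  have negv : ∀ a : ℤ, a < 0 → (a : ℝ) / 2 ^ 96 < 0 := fun a ha => by
    have : (a : ℝ) < 0 := by exact_mod_cast ha
    exact div_neg_of_neg_of_pos this (by positivity)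
  have mx : ∀ a b : ℤ,
      max ((a : ℝ) / 2 ^ 96) (-((b : ℝ) / 2 ^ 96)) = ((max a (-b) : ℤ) : ℝ) / 2 ^ 96 := by
    intro a b
    rw [← neg_div, max_div_div_right (by positivity : (0 : ℝ) ≤ 2 ^ 96)]; push_cast; rfl
  have hX := max_abs_le hx.1 hx.2
  have hS := max_abs_le hs.1 hs.2
  rw [mx] at hX hS
  have hXS : |z 0| * |z 3| ≤
      ((max xh (-xl) : ℤ) : ℝ) / 2 ^ 96 * (((max sh (-sl) : ℤ) : ℝ) / 2 ^ 96) :=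
    mul_le_mul hX hS (abs_nonneg _) ((abs_nonneg _).trans hX)
  have hxs : z 0 * z 3 ≤ |z 0| * |z 3| := by rw [← abs_mul]; exact le_abs_self _
  unfold kindCheck at H
  simp only [int_mul_eq, int_neg_eq, int_add_eq, twoPow_eq] at H
  unfold KindSpec
  rcases kind with _ | _ | _ | kind <;> simp only [zero_add, Nat.reduceAdd] at H ⊢
  · simp only [Bool.and_eq_true, Bool.or_eq_true, ltZ_iff] at H
    obtain ⟨⟨h1, h2⟩, h3⟩ := H
    have h1' := (pos _ h1).trans_le hc.1
    have h2' : (2 : ℝ) < z 1 := by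
      refine lt_of_lt_of_le ?_ hy.1
      rw [lt_div_iff₀ (by positivity)]
      have : ((2 ^ 97 : ℤ) : ℝ) < yl := by exact_mod_cast h2
      push_cast at this; linarith
    refine ⟨h1', h2', ?_⟩
    have h4 : z 1 * (z 0 * z 3) < 2 * z 2 := by
      rcases h3 with ⟨h3, h4⟩ | h3
      · have := mul_neg_of_pos_of_neg ((pos _ h3).trans_le hx.1) (hs.2.trans_lt (negv _ h4))
        nlinarith
      · have h5 : (((max xh (-xl) : ℤ) : ℝ) * ((((max sh (-sl) : ℤ) : ℝ) * yh))) < 2 ^ 193 * cl := by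
          exact_mod_cast h3
        have h6 : z 1 * (z 0 * z 3) ≤ (yh / 2 ^ 96) *
            (((max xh (-xl) : ℤ) : ℝ) / 2 ^ 96 * (((max sh (-sl) : ℤ) : ℝ) / 2 ^ 96)) :=
          (mul_le_mul_of_nonneg_left (hxs.trans hXS) (by linarith)).trans
            (mul_le_mul_of_nonneg_right hy.2
              (mul_nonneg ((abs_nonneg _).trans hX) ((abs_nonneg _).trans hS)))
        have h7 : (yh : ℝ) / 2 ^ 96 *
            (((max xh (-xl) : ℤ) : ℝ) / 2 ^ 96 * (((max sh (-sl) : ℤ) : ℝ) / 2 ^ 96)) =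
            (((max xh (-xl) : ℤ) : ℝ) * ((((max sh (-sl) : ℤ) : ℝ) * yh))) / 2 ^ 288 := by ring
        have h8 : (((max xh (-xl) : ℤ) : ℝ) * ((((max sh (-sl) : ℤ) : ℝ) * yh))) / 2 ^ 288 <
            (2 ^ 193 * cl) / 2 ^ 288 := div_lt_div_of_pos_right h5 (by positivity)
        have h9 : ((2 : ℝ) ^ 193 * cl) / 2 ^ 288 = 2 * (cl / 2 ^ 96) := by ring
        linarith [hc.1]
    have h5 : z 1 * (z 1 * z 2) > 2 * (2 * z 2) := by nlinarith [mul_pos h1' (sub_pos.2 h2')]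
    unfold turn
    linarith
  · simp only [Bool.and_eq_true, ltZ_iff] at H
    obtain ⟨⟨⟨h1, h2⟩, h3⟩, h4⟩ := H
    have h1' := hs.2.trans_lt (negv _ h1)
    have h2' := (pos _ h2).trans_le hx.1
    have h3' := (pos _ h3).trans_le hy.1
    refine ⟨h1', h2', h3', ?_⟩
    have h5 : (xh : ℝ) * ((max ch 0 : ℤ) : ℝ) + yl * sh < 0 := by exact_mod_cast h4
    have h6 : z 2 ≤ ((max ch 0 : ℤ) : ℝ) / 2 ^ 96 :=
      hc.2.trans (div_le_div_of_nonneg_right (by exact_mod_cast le_max_left _ _) (by positivity))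
    have h6' : (0 : ℝ) ≤ ((max ch 0 : ℤ) : ℝ) / 2 ^ 96 := by
      have : (0 : ℝ) ≤ ((max ch 0 : ℤ) : ℝ) := by exact_mod_cast le_max_right _ _
      positivity
    have h7 : z 0 * z 2 ≤ xh / 2 ^ 96 * (((max ch 0 : ℤ) : ℝ) / 2 ^ 96) :=
      (mul_le_mul_of_nonneg_left h6 h2'.le).trans (mul_le_mul_of_nonneg_right hx.2 h6')
    have h8 : z 1 * z 3 ≤ yl / 2 ^ 96 * (sh / 2 ^ 96) :=
      (mul_le_mul_of_nonneg_left hs.2 h3'.le).trans (mul_le_mul_of_nonpos_right hy.1 (negv _ h1).le)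
    have h9 : (xh : ℝ) / 2 ^ 96 * (((max ch 0 : ℤ) : ℝ) / 2 ^ 96) + yl / 2 ^ 96 * (sh / 2 ^ 96) =
        (xh * ((max ch 0 : ℤ) : ℝ) + yl * sh) / 2 ^ 192 := by ring
    have h10 := div_neg_of_neg_of_pos h5 (by positivity : (0 : ℝ) < 2 ^ 192)
    linarith
  · simp only [Bool.and_eq_true, ltZ_iff] at H
    obtain ⟨⟨⟨⟨⟨h1, h2⟩, h3⟩, h4⟩, h5⟩, h6⟩ := H
    have h1' := hc.2.trans_lt (negv _ h1)
    have h2' := (pos _ h2).trans_le hy.1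
    have one : ∀ a : ℤ, a < 2 ^ 96 → (a : ℝ) / 2 ^ 96 < 1 := fun a ha => by
      rw [div_lt_one (by positivity)]; exact_mod_cast ha
    have h3' := hy.2.trans_lt (one _ h3)
    have h4' := hx.2.trans_lt (one _ h4)
    have h5' := one (-xl) (by linarith)
    push_cast at h5'
    refine ⟨h1', h2', h3', abs_lt.2 ⟨by linarith [hx.1, neg_div ((2 : ℝ) ^ 96) xl], h4'⟩, ?_⟩
    have h7 : (2 : ℝ) ^ 96 * ch + ((max xh (-xl) : ℤ) : ℝ) * ((max sh (-sl) : ℤ) : ℝ) < 0 := by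
      exact_mod_cast h6
    have h8 : ((2 : ℝ) ^ 96 * ch + ((max xh (-xl) : ℤ) : ℝ) * ((max sh (-sl) : ℤ) : ℝ)) / 2 ^ 192 =
      ch / 2 ^ 96 + ((max xh (-xl) : ℤ) : ℝ) / 2 ^ 96 * (((max sh (-sl) : ℤ) : ℝ) / 2 ^ 96) := by ring
    have h9 := div_neg_of_neg_of_pos h7 (by positivity : (0 : ℝ) < 2 ^ 192)
    have h10 : z 0 * z 3 < -z 2 := by linarith [hc.2]
    have h11 : z 1 * (z 0 * z 3) < z 1 * (-z 2) := mul_lt_mul_of_pos_left h10 h2'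
    have h12 : z 1 * z 2 > z 2 := by nlinarith
    have h13 : z 1 * (z 1 * z 2) > z 2 := by nlinarith
    unfold turn
    linarith

/-- The enclosure of a function that is close to a polynomial. -/
theorem lower_upper {l : List ℤ} {e : ℕ} {τ w : ℝ} (hτ : τ ∈ Icc (0 : ℝ) 1)
    (h : |w - evalL τ l / 2 ^ 96| ≤ (e : ℝ) / 2 ^ 96) :
    (lower l e : ℝ) / 2 ^ 96 ≤ w ∧ w ≤ upper l e / 2 ^ 96 := by
  have h' := abs_le.1 h
  cases l with
  | nil =>
    have e1 : lower [] e = -(e : ℤ) := rfl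
    have e2 : upper [] e = (e : ℤ) := rfl
    rw [e1, e2]
    simp only [evalL, zero_div, sub_zero] at h'
    push_cast
    rw [neg_div]; exact h'
  | cons a t =>
    have e1 : lower (a :: t) e = a - ((normOne t + e : ℕ) : ℤ) := rfl
    have e2 : upper (a :: t) e = a + ((normOne t + e : ℕ) : ℤ) := rfl
    rw [e1, e2]
    push_cast
    have h1 : |τ * evalL τ t| ≤ normOne t := by
      rw [abs_mul, abs_of_nonneg hτ.1]
      exact (mul_le_of_le_one_left (abs_nonneg _) hτ.2).trans (abs_evalL_le hτ t)
    have h1 := abs_le.1 h1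
    simp only [evalL] at h'
    have h3 : (w - (a + τ * evalL τ t) / 2 ^ 96) = (2 ^ 96 * w - (a + τ * evalL τ t)) / 2 ^ 96 := by
      ring
    rw [h3, ← neg_div, div_le_div_iff_of_pos_right (by positivity),
      div_le_div_iff_of_pos_right (by positivity)] at h'
    rw [div_le_iff₀ (by positivity), le_div_iff₀ (by positivity)]
    constructor <;> linarith

theorem boxCheck_sound : ∀ (box : List (ℤ × ℤ)) (l : List (ℤ × ℤ)) (w : List ℝ),
    List.Forall₂ (fun i a => (i.1 : ℝ) / 2 ^ 96 ≤ a ∧ a ≤ i.2 / 2 ^ 96) l w →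
    boxCheck box l = true → InBox box w
  | [], _, _, _, _ => trivial
  | _ :: _, [], _, _, h => absurd h (by simp [boxCheck])
  | b :: box, i :: l, _, .cons (b := a) (l₂ := w) hi hl, h => by
    have h' : (leZ (Int.mul (twoPow 76) b.1) i.1 && leZ i.2 (Int.mul (twoPow 76) b.2) &&
      boxCheck box l) = true := h
    simp only [Bool.and_eq_true, leZ_iff, int_mul_eq, twoPow_eq] at h'
    obtain ⟨⟨h1, h2⟩, h3⟩ := h'
    have h1 : (2 : ℝ) ^ 76 * b.1 ≤ i.1 := by exact_mod_cast h1
    have h2 : (i.2 : ℝ) ≤ 2 ^ 76 * b.2 := by exact_mod_cast h2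
    have h4 := div_le_div_of_nonneg_right h1 (by positivity : (0 : ℝ) ≤ 2 ^ 96)
    have h5 := div_le_div_of_nonneg_right h2 (by positivity : (0 : ℝ) ≤ 2 ^ 96)
    have e : ∀ v : ℝ, 2 ^ 76 * v / 2 ^ 96 = v / 2 ^ 20 := fun v => by ring
    rw [e] at h4 h5
    exact ⟨⟨h4.trans hi.1, hi.2.trans h5⟩, boxCheck_sound box l w hl h3⟩

theorem sizeCheck_sound {l : List ℤ} {k : ℕ → Bool} (h : sizeCheck l k = true) :
    Small l 23 99 ∧ normOne l + 2 ^ 86 ≤ 2 ^ 99 ∧ k (normOne l + 2 ^ 86) = true := by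
  simp only [sizeCheck, forceNat_eq, Bool.and_eq_true, lenL_eq, Nat.ble_eq, nat_add_eq, maxErr,
    maxAbs, nat_pow_eq] at h
  exact ⟨⟨h.1, by omega⟩, h.2.1, h.2.2⟩

/-- The duration of a step. -/
def Step.time (st : Step) : ℝ := (st.hn : ℝ) / 2 ^ 48

/-- The truncation that makes `field` globally Lipschitz. It is never active in practice. -/
def truncField (z : Fin 8 → ℝ) : Fin 8 → ℝ := field (clamp (fun _ => 8) z)

theorem lipOnBox_field_eight : LipOnBox field (fun _ => 8) 1000000 := by
  have := lipOnBox_field (x := 8) (y := 8) (c := 8) (s := 8) (u := 8) (q := 8) (κ := 1000000)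
    (by norm_num) (by norm_num) (by norm_num) (by norm_num) (by norm_num) (by norm_num)
    rfl rfl rfl rfl rfl rfl rfl rfl (by norm_num) (by norm_num) (by norm_num) (by norm_num)
    (by norm_num) (by norm_num)
  have e : (![8, 8, 8, 8, 8, 8, 8, 8] : Fin 8 → ℝ) = fun _ => 8 := by
    funext i; fin_cases i <;> rfl
  rwa [e] at this

/-- The information on a solution that a step of the integration provides. -/
def StepSpec (st : Step) (w : Fin 8 → ℝ) : Prop :=
  (∀ i, |w i| ≤ 8) ∧ KindSpec st.kind w ∧
    InBox st.box [w 0, w 1, w 2, w 3, w 4, w 5, w 6, w 7]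

/-- A step that passes the checks propagates the error bound from its beginning to its end, and
encloses the solution in between, by `shadow_step`. -/
theorem stepCheck_sound {st : Step} {e : ℕ} {X Y C S U Q V R : List ℤ} {k : ℕ → Bool}
    (H : stepCheck allOnes st e X Y C S U Q V R k = true) :
    0 < st.hn ∧ ∃ e', k e' = true ∧ ∀ (z : ℝ → Fin 8 → ℝ) (t₀ : ℝ),
      (∀ t, HasDerivAt z (truncField (z t)) t) →
      dist (z t₀) (vec8 0 X Y C S U Q V R) ≤ e / 2 ^ 96 →
      dist (z (t₀ + st.time)) (vec8 1 X Y C S U Q V R) ≤ (e' : ℕ) / 2 ^ 96 ∧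
        ∀ t ∈ Icc t₀ (t₀ + st.time), StepSpec st (z t) := by
  unfold stepCheck at H
  simp only [forceNat_eq, Bool.and_eq_true, Nat.ble_eq, Nat.blt_eq, nat_pow_eq] at H
  obtain ⟨⟨⟨h1, h2⟩, h3⟩, H⟩ := H
  obtain ⟨sX, nX, H⟩ := sizeCheck_sound H
  obtain ⟨sY, nY, H⟩ := sizeCheck_sound H
  obtain ⟨sC, nC, H⟩ := sizeCheck_sound H
  obtain ⟨sS, nS, H⟩ := sizeCheck_sound H
  obtain ⟨sU, nU, H⟩ := sizeCheck_sound H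
  obtain ⟨sQ, nQ, H⟩ := sizeCheck_sound H
  obtain ⟨sV, nV, H⟩ := sizeCheck_sound H
  obtain ⟨sR, nR, H⟩ := sizeCheck_sound H
  simp only [Bool.and_eq_true, Nat.ble_eq] at H
  set κ := lipBound st.hn (normOne X + 2 ^ 86) (normOne Y + 2 ^ 86) (normOne C + 2 ^ 86)
    (normOne S + 2 ^ 86) (max (normOne U + 2 ^ 86) (normOne V + 2 ^ 86))
    (max (normOne Q + 2 ^ 86) (normOne R + 2 ^ 86)) with hκ
  obtain ⟨hκ1, ⟨⟨⟨h4, h5⟩, h6⟩, h7⟩, h8⟩ := H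
  set e' := nextErr e st.bb κ with he'
  refine ⟨h1, e', h8, fun z t₀ hz hz0 => ?_⟩
  have hlip := lipBound_sound h1 (normOne X + 2 ^ 86) (normOne Y + 2 ^ 86) (normOne C + 2 ^ 86)
    (normOne S + 2 ^ 86) (max (normOne U + 2 ^ 86) (normOne V + 2 ^ 86))
    (max (normOne Q + 2 ^ 86) (normOne R + 2 ^ 86))
  rw [← hκ] at hlip
  have hn0 : (0 : ℝ) < st.time := by
    have : (0 : ℝ) < st.hn := by exact_mod_cast h1
    unfold Step.time; positivity
  have hκ0 : 0 ≤ (κ : ℝ) / 2 ^ 30 / (st.hn / 2 ^ 48) := by positivity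
  have hE := exp_le_cubic (κ := (κ : ℝ) / 2 ^ 30) (by positivity)
    (by rw [div_le_one (by positivity)]; exact_mod_cast hκ1)
  have hmax : (maxErr : ℕ) = 2 ^ 86 := rfl
  rw [hmax] at h4
  have he'1 : (e' : ℝ) / 2 ^ 96 ≤ 2 ^ 86 / 2 ^ 96 :=
    div_le_div_of_nonneg_right (by exact_mod_cast h4) (by positivity)
  have bound : ∀ (l : List ℤ) (m : ℕ), normOne l + 2 ^ 86 ≤ m → ∀ τ ∈ Icc (0 : ℝ) 1,
      |evalL τ l / 2 ^ 96| + e' / 2 ^ 96 ≤ (m : ℝ) / 2 ^ 96 := by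
    intro l m hm τ hτ
    have a1 := abs_evalL_le hτ l
    have a2 : (normOne l : ℝ) + 2 ^ 86 ≤ m := by exact_mod_cast hm
    rw [abs_div, abs_of_pos (by positivity : (0 : ℝ) < 2 ^ 96)]
    have a3 := div_le_div_of_nonneg_right ((add_le_add_left a1 (2 ^ 86)).trans a2)
      (by positivity : (0 : ℝ) ≤ 2 ^ 96)
    rw [add_div] at a3
    linarith
  have eight : ∀ m : ℕ, m ≤ 2 ^ 99 → (m : ℝ) / 2 ^ 96 ≤ 8 := fun m hm => by
    rw [div_le_iff₀ (by positivity)]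
    have : (m : ℝ) ≤ 2 ^ 99 := by exact_mod_cast hm
    linarith
  have main := shadow_step (f := field) (M₀ := fun _ => 8) (K₀ := 1000000)
    (κ := ⟨_, hκ0⟩) lipOnBox_field_eight (fun i => ?_) (fun i => ?_) hlip hn0
    (by positivity : (0 : ℝ) ≤ e / 2 ^ 96) (by positivity : (0 : ℝ) ≤ 161 * 2 ^ st.bb / 2 ^ 96)
    (E := 1 + κ / 2 ^ 30 + (κ / 2 ^ 30) ^ 2 / 2 + (κ / 2 ^ 30) ^ 3 / 4)
    (le_trans (Real.exp_le_exp.2 (le_of_eq ?_)) hE) (nextErr_sound e st.bb κ)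
    (fun τ => hasDerivAt_vec8 X Y C S U Q V R τ) (fun τ hτ i => ?_)
    (fun τ hτ i => odeCheck_sound sX sY sC sS sU sQ sV sR h3 h2 h5 hτ i)
    (fun t _ => hz t) hz0
  · have key : ∀ τ ∈ Icc (0 : ℝ) 1, dist (z (t₀ + st.time * τ)) (vec8 τ X Y C S U Q V R) ≤
        (e' : ℝ) / 2 ^ 96 := fun τ hτ => (main τ hτ).1.trans (nextErr_sound e st.bb κ)
    refine ⟨by simpa using key 1 (by simp), fun t ht => ?_⟩
    have hτ : (t - t₀) / st.time ∈ Icc (0 : ℝ) 1 :=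
      ⟨div_nonneg (by linarith [ht.1]) hn0.le, (div_le_one hn0).2 (by linarith [ht.2])⟩
    have k1 := key _ hτ
    have k2 := (main _ hτ).2
    rw [mul_div_cancel₀ _ hn0.ne', add_sub_cancel] at k1 k2
    have comp : ∀ i, |z t i - vec8 ((t - t₀) / st.time) X Y C S U Q V R i| ≤ (e' : ℝ) / 2 ^ 96 :=
      fun i => by
        have := (dist_le_pi_dist (z t) _ i).trans k1
        rwa [Real.dist_eq] at this
    refine ⟨fun i => (k2 i).trans ?_, kindCheck_sound h6 (lower_upper hτ (comp 0))
      (lower_upper hτ (comp 1)) (lower_upper hτ (comp 2)) (lower_upper hτ (comp 3)),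
      boxCheck_sound _ _ _ ?_ h7⟩
    · fin_cases i
      · exact eight _ nX
      · exact eight _ nY
      · exact eight _ nC
      · exact eight _ nS
      · exact eight _ (max_le nU nV)
      · exact eight _ (max_le nQ nR)
      · exact eight _ (max_le nU nV)
      · exact eight _ (max_le nQ nR)
    · exact .cons (lower_upper hτ (comp 0)) (.cons (lower_upper hτ (comp 1))
        (.cons (lower_upper hτ (comp 2)) (.cons (lower_upper hτ (comp 3))
        (.cons (lower_upper hτ (comp 4)) (.cons (lower_upper hτ (comp 5))
        (.cons (lower_upper hτ (comp 6)) (.cons (lower_upper hτ (comp 7)) .nil)))))))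
  · fin_cases i <;> exact div_nonneg (Nat.cast_nonneg _) (by positivity)
  · fin_cases i
    · exact eight _ nX
    · exact eight _ nY
    · exact eight _ nC
    · exact eight _ nS
    · exact eight _ (max_le nU nV)
    · exact eight _ (max_le nQ nR)
    · exact eight _ (max_le nU nV)
    · exact eight _ (max_le nQ nR)
  · show st.time * ((κ : ℝ) / 2 ^ 30 / (st.hn / 2 ^ 48)) = _
    exact mul_div_cancel₀ _ hn0.ne'
  · fin_cases i
    · exact bound _ _ le_rfl τ hτ
    · exact bound _ _ le_rfl τ hτ
    · exact bound _ _ le_rfl τ hτ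
    · exact bound _ _ le_rfl τ hτ
    · exact bound _ _ (le_max_left _ _) τ hτ
    · exact bound _ _ (le_max_left _ _) τ hτ
    · exact bound _ _ (le_max_right _ _) τ hτ
    · exact bound _ _ (le_max_right _ _) τ hτ

theorem genLoop_succ (hn : ℤ) (N m : ℕ) (px py pc ps pu pq pv pr : ℤ)
    (x y c s u q v r : List ℤ) (k : List ℤ → List ℤ → List ℤ → List ℤ → List ℤ →
      List ℤ → List ℤ → List ℤ → Bool) :
    genLoop hn N (m + 1) px py pc ps pu pq pv pr x y c s u q v r k =
      forceNat (Nat.sub (Nat.sub N 1) m) fun n =>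
      forceNat (Nat.mul slot n) fun sh =>
      forceNat (Nat.mul slot (Nat.succ n)) fun sh' =>
      forceInt (trunc sh' (turnZ px py pc ps)) fun K =>
      forceInt (trunc sh' (driftZ px py pc ps)) fun A =>
      forceInt (trunc sh' (Int.neg (potZ py pc K))) fun B =>
      forceInt (nextCoeff hn n sh sh' 144 (Int.mul py pc)) fun ax =>
      forceInt (nextCoeff hn n sh sh' 144 (Int.mul py ps)) fun ay =>
      forceInt (nextCoeff hn n sh sh' 337 (Int.neg (Int.mul ps K))) fun ac =>
      forceInt (nextCoeff hn n sh sh' 337 (Int.mul pc K)) fun as =>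
      forceInt (nextCoeff hn n sh sh' 48 (Int.mul 2 pq)) fun au =>
      forceInt (nextCoeff hn n sh sh' 627 (Int.add (Int.mul A pq) (Int.mul B pu))) fun aq =>
      forceInt (nextCoeff hn n sh sh' 48 (Int.mul 2 pr)) fun av =>
      forceInt (nextCoeff hn n sh sh' 627 (Int.add (Int.mul A pr) (Int.mul B pv))) fun ar =>
      forceInt (push px ax sh') fun px => forceInt (push py ay sh') fun py =>
      forceInt (push pc ac sh') fun pc => forceInt (push ps as sh') fun ps =>
      forceInt (push pu au sh') fun pu => forceInt (push pq aq sh') fun pq =>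
      forceInt (push pv av sh') fun pv => forceInt (push pr ar sh') fun pr =>
      genLoop hn N m px py pc ps pu pq pv pr (ax :: x) (ay :: y) (ac :: c) (as :: s)
        (au :: u) (aq :: q) (av :: v) (ar :: r) k := rfl

/-- Whatever polynomials the loop produces, they satisfy the check `k`. -/
theorem exists_of_genLoop (hn : ℤ) (N : ℕ) : ∀ (m : ℕ) (px py pc ps pu pq pv pr : ℤ)
    (x y c s u q v r : List ℤ) (k : List ℤ → List ℤ → List ℤ → List ℤ → List ℤ →
      List ℤ → List ℤ → List ℤ → Bool),
    genLoop hn N m px py pc ps pu pq pv pr x y c s u q v r k = true →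
    ∃ X Y C S U Q V R, k X Y C S U Q V R = true
  | 0, _, _, _, _, _, _, _, _, _, _, _, _, _, _, _, _, _, h => ⟨_, _, _, _, _, _, _, _, h⟩
  | m + 1, _, _, _, _, _, _, _, _, _, _, _, _, _, _, _, _, _, h => by
    rw [genLoop_succ] at h
    simp only [forceNat_eq, forceInt_eq] at h
    exact exists_of_genLoop hn N m _ _ _ _ _ _ _ _ _ _ _ _ _ _ _ _ _ h

/-- The information on a solution that an integration provides. -/
def RunSpec (z : ℝ → Fin 8 → ℝ) : List Step → ℝ → Prop
  | [], _ => True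
  | st :: l, t₀ => (0 < st.hn ∧ ∀ t ∈ Icc t₀ (t₀ + st.time), StepSpec st (z t)) ∧
      RunSpec z l (t₀ + st.time)

theorem run_sound {z : ℝ → Fin 8 → ℝ} (hz : ∀ t, HasDerivAt z (truncField (z t)) t) :
    ∀ (l : List Step) (e : ℕ) (x y c s u q v r : ℤ) (t₀ : ℝ),
    run allOnes l e x y c s u q v r = true →
    dist (z t₀) ![(x : ℝ) / 2 ^ 96, y / 2 ^ 96, c / 2 ^ 96, s / 2 ^ 96, u / 2 ^ 96, q / 2 ^ 96,
      v / 2 ^ 96, r / 2 ^ 96] ≤ e / 2 ^ 96 → RunSpec z l t₀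
  | [], _, _, _, _, _, _, _, _, _, _, _, _ => trivial
  | st :: l, e, x, y, c, s, u, q, v, r, t₀, h, h0 => by
    have h' : genLoop (Int.ofNat st.hn) 22 22 x y c s u q v r [] [] [] [] [] [] [] []
      (fun X Y C S U Q V R => stepCheck allOnes st e (x :: X) (y :: Y) (c :: C) (s :: S) (u :: U)
        (q :: Q) (v :: V) (r :: R) fun e' =>
      forceInt (sumL (x :: X)) fun x => forceInt (sumL (y :: Y)) fun y =>
      forceInt (sumL (c :: C)) fun c => forceInt (sumL (s :: S)) fun s =>
      forceInt (sumL (u :: U)) fun u => forceInt (sumL (q :: Q)) fun q =>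
      forceInt (sumL (v :: V)) fun v => forceInt (sumL (r :: R)) fun r =>
      run allOnes l e' x y c s u q v r) = true := h
    obtain ⟨X, Y, C, S, U, Q, V, R, h⟩ :=
      exists_of_genLoop _ _ _ _ _ _ _ _ _ _ _ _ _ _ _ _ _ _ _ _ h'
    obtain ⟨hn, e', h, hs⟩ := stepCheck_sound h
    simp only [forceInt_eq] at h
    obtain ⟨h1, h2⟩ := hs z t₀ hz (by simpa [vec8, evalL] using h0)
    refine ⟨⟨hn, h2⟩, run_sound hz l _ _ _ _ _ _ _ _ _ _ h ?_⟩
    simpa only [sumL_eq, vec8] using h1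

theorem certified_sound {l : List Step} {e : ℕ} {a u : ℤ} (h : certified l e a u = true)
    {z : ℝ → Fin 8 → ℝ} (hz : ∀ t, HasDerivAt z (truncField (z t)) t)
    (h0 : dist (z 0) ![0, (a : ℝ) / 2 ^ 96, 1, 0, u / 2 ^ 96, 0, 0, u / 2 ^ 96] ≤ e / 2 ^ 96) :
    RunSpec z l 0 := by
  simp only [certified, forceNat_eq] at h
  refine run_sound hz l _ _ _ _ _ _ _ _ _ _ h ?_
  rw [twoPow_eq]
  have e1 : (((2 : ℤ) ^ 96 : ℤ) : ℝ) / 2 ^ 96 = 1 := by norm_num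
  rwa [Int.cast_zero, zero_div, e1]

end Soundness

/-! ### The certificates for the profile of the torus -/

/-- No information: the interval `[-8, 8]`. -/
def free : ℤ × ℤ := (-8388608, 8388608)

/-- The initial height is at least `heightLo / 2 ^ 44`. -/
def heightLo : ℤ := 58312964508184

/-- The initial height is at most `heightHi / 2 ^ 44`. -/
def heightHi : ℤ := 58312964508200

/-- The first part of the profile, close to its highest point. -/
def topSteps : List Step := List.replicate 20 ⟨7036874417766, 15, 1, []⟩

/-- The steps down to the point where the profile meets the circle of radius `2`. -/
def beforeSteps : List Step :=
  List.replicate 4 ⟨17592186044416, 25, 2, []⟩ ++ [⟨5432467050523, 8, 2, []⟩]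

/-- The steps around the point where the profile meets the circle of radius `2`. -/
def crossSteps : List Step :=
  [⟨1, 8, 2, [(950400, 951000), (1871000, 1871300)]⟩,
    ⟨562949953421, 8, 2,
      [(949000, 952000), (1865000, 1878000), free, free, (-7300, -7000), free, (4500, 4800), free]⟩,
    ⟨1, 8, 2, [(949900, 950300), (1867300, 1867600)]⟩]

/-- The steps from there to the part where the profile turns back. -/
def afterSteps : List Step :=
  List.replicate 5 ⟨17592186044416, 16, 2, []⟩ ++ List.replicate 7 ⟨35184372088832, 28, 2, []⟩

/-- The steps along the final part of the profile, where it approaches its lowest point. -/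
def lastSteps : List Step := List.replicate 7 ⟨37404003333750, 17, 3, []⟩

/-- The steps around the lowest point of the profile. -/
def endSteps : List Step :=
  [⟨1, 8, 3, [(100, 8388608)]⟩,
    ⟨5629499534213, 16, 3, [free, (450000, 465000), free, free, free, (5000, 7000), free,
      (-1000, 1000)]⟩,
    ⟨1, 8, 3, [(-8388608, -100)]⟩]

/-- The steps of an integration for all initial heights in the interval at once. -/
def tubeSteps : List Step :=
  topSteps ++ (beforeSteps ++ (crossSteps ++ (afterSteps ++ (lastSteps ++ endSteps))))

/-- The steps of a precise integration for one initial height, without intermediate conditions. -/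
def shootSteps : List Step :=
  List.replicate 20 ⟨7036874417766, 15, 0, []⟩ ++ (List.replicate 4 ⟨17592186044416, 25, 0, []⟩ ++
    ([⟨5432467050523, 8, 0, []⟩, ⟨562949953421, 8, 0, []⟩] ++
    (List.replicate 5 ⟨17592186044416, 16, 0, []⟩ ++ List.replicate 7 ⟨35184372088832, 28, 0, []⟩)))

/-- The precise integration for the smallest initial height: at its end, the profile has not yet
returned to the axis `{x₁ = 0}`, and the sine of its tangent angle is nonnegative. -/
def lowSteps : List Step := shootSteps ++ (List.replicate 7 ⟨37812766779696, 17, 0, []⟩ ++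
  [⟨1, 8, 0, [(0, 8388608), free, free, (0, 8388608)]⟩])

/-- The precise integration for the largest initial height: at its end, the profile has already
returned to the axis `{x₁ = 0}`, and the sine of its tangent angle is nonpositive. -/
def highSteps : List Step := shootSteps ++ (List.replicate 6 ⟨37812766779668, 17, 0, []⟩ ++
  [⟨37812766779669, 17, 0, []⟩, ⟨1, 8, 0, [(-8388608, 0), free, free, (-8388608, 0)]⟩])

set_option maxRecDepth 100000 in
/-- The initial error `2 ^ 56`, in units of `2 ^ (-96)`, is the length of the interval of initial
heights. -/
theorem certified_tube :
    certified tubeSteps (Nat.pow 2 56) (Int.mul heightLo (twoPow 52)) (twoPow 90) = true := by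
  decide +kernel

set_option maxRecDepth 100000 in
theorem certified_low :
    certified lowSteps 0 (Int.mul heightLo (twoPow 52)) (twoPow 90) = true := by
  decide +kernel

set_option maxRecDepth 100000 in
theorem certified_high :
    certified highSteps 0 (Int.mul heightHi (twoPow 52)) (twoPow 90) = true := by
  decide +kernel

/-! ### Shooting -/

/-- The initial value: the profile starts at height `a` above the origin, horizontally; the two
solutions of the linearized equation are the even and the odd one. -/
def initState (a : ℝ) : Fin 8 → ℝ := ![0, a, 1, 0, 1 / 64, 0, 0, 1 / 64]

theorem lipschitzWith_truncField : LipschitzWith 1000000 truncField :=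
  LipOnBox.lipschitzWith lipOnBox_field_eight (fun _ => by norm_num)

theorem exists_flow (z₀ : Fin 8 → ℝ) :
    ∃ z : ℝ → Fin 8 → ℝ, z 0 = z₀ ∧ ∀ t, HasDerivAt z (truncField (z t)) t := by
  obtain ⟨B, hB⟩ := LipOnBox.bounded (κ := 1000000) lipOnBox_field_eight (fun _ => by norm_num)
  exact exists_global_solution lipschitzWith_truncField hB z₀

/-- The solutions depend continuously on the time and on the initial height. -/
theorem continuousOn_flow {Z : ℝ → ℝ → Fin 8 → ℝ} (h0 : ∀ a, Z a 0 = initState a)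
    (hZ : ∀ a t, HasDerivAt (Z a) (truncField (Z a t)) t) :
    ContinuousOn (fun p : ℝ × ℝ => Z p.1 p.2) (univ ×ˢ Icc 0 3) := by
  refine continuousOn_prod_of_continuousOn_lipschitzOnWith _ (Real.exp (1000000 * 3)).toNNReal
    (fun a _ => ?_) (fun t ht => ?_)
  · exact fun t _ => (hZ a t).continuousAt.continuousWithinAt
  · refine LipschitzOnWith.of_dist_le_mul fun a _ b _ => ?_
    have h1 : dist (Z a 0) (Z b 0) ≤ dist a b := by
      rw [h0, h0]
      refine (dist_pi_le_iff dist_nonneg).2 fun i => ?_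
      fin_cases i <;> simp [initState]
    have := dist_le_of_trajectories_ODE (v := fun _ => truncField) (K := 1000000) (f := Z a)
      (g := Z b) (a := 0) (b := 3) (fun _ => lipschitzWith_truncField)
      (fun s _ => (hZ a s).continuousAt.continuousWithinAt)
      (fun s _ => (hZ a s).hasDerivWithinAt)
      (fun s _ => (hZ b s).continuousAt.continuousWithinAt)
      (fun s _ => (hZ b s).hasDerivWithinAt) h1 t ht
    refine this.trans ?_
    rw [mul_comm, Real.coe_toNNReal _ (Real.exp_pos _).le]
    refine mul_le_mul_of_nonneg_right (Real.exp_le_exp.2 ?_) dist_nonneg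
    have e : ((1000000 : NNReal) : ℝ) = 1000000 := by norm_num
    rw [e]
    linarith [ht.2]

/-- The total duration of a list of steps. -/
def totalTime (l : List Step) : ℝ := (l.map Step.time).sum

theorem RunSpec.append {z : ℝ → Fin 8 → ℝ} : ∀ {l m : List Step} {t₀ : ℝ}, RunSpec z (l ++ m) t₀ →
    RunSpec z l t₀ ∧ RunSpec z m (t₀ + totalTime l)
  | [], m, t₀, h => ⟨trivial, by simpa [totalTime] using h⟩
  | st :: l, m, t₀, h => by
    obtain ⟨h1, h2⟩ := RunSpec.append (l := l) h.2
    refine ⟨⟨h.1, h1⟩, ?_⟩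
    simpa [totalTime, add_assoc] using h2

theorem RunSpec.forall {z : ℝ → Fin 8 → ℝ} {P : (Fin 8 → ℝ) → Prop} :
    ∀ {l : List Step} {t₀ : ℝ}, RunSpec z l t₀ → l ≠ [] → (∀ st ∈ l, ∀ w, StepSpec st w → P w) →
    ∀ t ∈ Icc t₀ (t₀ + totalTime l), P (z t)
  | [], _, _, h, _, _, _ => absurd rfl h
  | st :: l, t₀, h, _, hP, t, ht => by
    rcases le_or_gt t (t₀ + st.time) with h1 | h1
    · exact hP st List.mem_cons_self _ (h.1.2 t ⟨ht.1, h1⟩)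
    · have e : totalTime (st :: l) = st.time + totalTime l := by simp [totalTime]
      rcases eq_or_ne l [] with h2 | h2
      · subst h2
        have := ht.2
        rw [e] at this
        simp only [totalTime, List.map_nil, List.sum_nil, add_zero] at this
        linarith
      · refine RunSpec.forall h.2 h2 (fun st' h' => hP st' (List.mem_cons_of_mem _ h')) t
          ⟨h1.le, ?_⟩
        have := ht.2
        rw [e] at this; linarith

/-- The time after `n` units. -/
def tick (n : ℕ) : ℝ := n / 2 ^ 48

theorem RunSpec.kind {z : ℝ → Fin 8 → ℝ} {l : List Step} {m n k : ℕ} (h : RunSpec z l (tick m))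
    (hl : l ≠ []) (hk : ∀ st ∈ l, st.kind = k) (hn : tick m + totalTime l = tick n) :
    ∀ t ∈ Icc (tick m) (tick n), (∀ i, |z t i| ≤ 8) ∧ KindSpec k (z t) := by
  rw [← hn]
  exact RunSpec.forall (P := fun w => (∀ i, |w i| ≤ 8) ∧ KindSpec k w) h hl
    (fun st hst w hw => ⟨hw.1, hk st hst ▸ hw.2.1⟩)

/-- What the enclosures say about the solutions with initial heights in the given interval. The times
that occur are sums of durations of steps in `tubeSteps`. -/
structure TubeFacts (z : ℝ → Fin 8 → ℝ) : Prop where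
  top : ∀ t ∈ Icc (tick 0) (tick 140737488355320), (∀ i, |z t i| ≤ 8) ∧ KindSpec 1 (z t)
  middle : ∀ t ∈ Icc (tick 140737488355320) (tick 551353184380834),
    (∀ i, |z t i| ≤ 8) ∧ KindSpec 2 (z t)
  bottom : ∀ t ∈ Icc (tick 551353184380834) (tick 818810707251298),
    (∀ i, |z t i| ≤ 8) ∧ KindSpec 3 (z t)
  crossStart : 950400 / 2 ^ 20 ≤ z (tick 216538699583508) 0 ∧
    1871000 / 2 ^ 20 ≤ z (tick 216538699583508) 1
  crossEnd : z (tick 217101649536929) 0 ≤ 950300 / 2 ^ 20 ∧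
    z (tick 217101649536929) 1 ≤ 1867600 / 2 ^ 20
  cross : ∀ t ∈ Icc (tick 216538699583508) (tick 217101649536929),
    (949000 / 2 ^ 20 ≤ z t 0 ∧ z t 0 ≤ 952000 / 2 ^ 20) ∧
    (-7300 / 2 ^ 20 ≤ z t 4 ∧ z t 4 ≤ -7000 / 2 ^ 20) ∧
    (4500 / 2 ^ 20 ≤ z t 6 ∧ z t 6 ≤ 4800 / 2 ^ 20)
  endStart : 0 < z (tick 813181207717085) 0
  endEnd : z (tick 818810707251298) 0 < 0
  window : ∀ t ∈ Icc (tick 813181207717085) (tick 818810707251298),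
    (450000 / 2 ^ 20 ≤ z t 1 ∧ z t 1 ≤ 465000 / 2 ^ 20) ∧
    (5000 / 2 ^ 20 ≤ z t 5 ∧ z t 5 ≤ 7000 / 2 ^ 20) ∧
    (-1000 / 2 ^ 20 ≤ z t 7 ∧ z t 7 ≤ 1000 / 2 ^ 20)

theorem tubeFacts {z : ℝ → Fin 8 → ℝ} (hz : ∀ t, HasDerivAt z (truncField (z t)) t) {a : ℝ}
    (ha : a ∈ Icc ((heightLo : ℝ) / 2 ^ 44) ((heightHi : ℝ) / 2 ^ 44)) (h0 : z 0 = initState a) :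
    TubeFacts z := by
  have e0 : tick 0 = 0 := by simp [tick]
  have h := certified_sound certified_tube hz (by
    rw [h0]
    refine (dist_pi_le_iff (by positivity)).2 fun i => ?_
    have e2 : ((Nat.pow 2 56 : ℕ) : ℝ) = 2 ^ 56 := by norm_num
    rw [e2, twoPow_eq, int_mul_eq, twoPow_eq]
    push_cast
    have h1 := ha.1
    have h2 := ha.2
    fin_cases i <;> simp [initState] <;> try norm_num
    rw [Real.dist_eq, abs_le]
    simp only [heightLo, heightHi] at h1 h2 ⊢
    push_cast at h1 h2 ⊢
    constructor <;> linarith)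
  rw [← e0] at h
  obtain ⟨hTop, h⟩ := h.append
  have e1 : tick 0 + totalTime topSteps = tick 140737488355320 := by
    simp [totalTime, topSteps, Step.time, tick]; norm_num
  rw [e1] at h
  obtain ⟨hBefore, h⟩ := h.append
  have e2 : tick 140737488355320 + totalTime beforeSteps = tick 216538699583507 := by
    simp [totalTime, beforeSteps, Step.time, tick]; norm_num
  rw [e2] at h
  obtain ⟨hCross, h⟩ := h.append
  have e3 : tick 216538699583507 + totalTime crossSteps = tick 217101649536930 := by
    simp [totalTime, crossSteps, Step.time, tick]; norm_num
  rw [e3] at h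
  obtain ⟨hAfter, h⟩ := h.append
  have e4 : tick 217101649536930 + totalTime afterSteps = tick 551353184380834 := by
    simp [totalTime, afterSteps, Step.time, tick]; norm_num
  rw [e4] at h
  obtain ⟨hLast, hEnd⟩ := h.append
  have e5 : tick 551353184380834 + totalTime lastSteps = tick 813181207717084 := by
    simp [totalTime, lastSteps, Step.time, tick]; norm_num
  rw [e5] at hEnd
  have e6 : tick 813181207717084 + totalTime endSteps = tick 818810707251299 := by
    simp [totalTime, endSteps, Step.time, tick]; norm_num
  have c1 : tick 216538699583507 + Step.time ⟨1, 8, 2, [(950400, 951000), (1871000, 1871300)]⟩ =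
      tick 216538699583508 := by norm_num [Step.time, tick]
  have c2 : tick 216538699583508 + Step.time ⟨562949953421, 8, 2,
      [(949000, 952000), (1865000, 1878000), free, free, (-7300, -7000), free, (4500, 4800), free]⟩ =
      tick 217101649536929 := by norm_num [Step.time, tick]
  have c3 : tick 813181207717084 + Step.time ⟨1, 8, 3, [(100, 8388608)]⟩ =
      tick 813181207717085 := by norm_num [Step.time, tick]
  have c4 : tick 813181207717085 + Step.time ⟨5629499534213, 16, 3,
      [free, (450000, 465000), free, free, free, (5000, 7000), free, (-1000, 1000)]⟩ =
      tick 818810707251298 := by norm_num [Step.time, tick]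
  have hC := hCross
  have hE := hEnd
  simp only [crossSteps, RunSpec, c1, c2] at hC
  simp only [endSteps, RunSpec, c3, c4] at hE
  obtain ⟨⟨_, hC1⟩, ⟨_, hC2⟩, ⟨_, hC3⟩, _⟩ := hC
  obtain ⟨⟨_, hE1⟩, ⟨_, hE2⟩, ⟨_, hE3⟩, _⟩ := hE
  have mid1 := hBefore.kind (by simp [beforeSteps]) (k := 2) (by
    intro st hst; simp [beforeSteps] at hst; rcases hst with rfl | rfl <;> rfl) e2
  have mid2 := hCross.kind (by simp [crossSteps]) (k := 2) (by
    intro st hst; simp [crossSteps] at hst; rcases hst with rfl | rfl | rfl <;> rfl) e3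
  have mid3 := hAfter.kind (by simp [afterSteps]) (k := 2) (by
    intro st hst; simp [afterSteps] at hst; rcases hst with rfl | rfl <;> rfl) e4
  have bot1 := hLast.kind (by simp [lastSteps]) (k := 3) (by
    intro st hst; simp [lastSteps] at hst; rw [hst]) e5
  have bot2 := hEnd.kind (by simp [endSteps]) (k := 3) (by
    intro st hst; simp [endSteps] at hst; rcases hst with rfl | rfl | rfl <;> rfl) e6
  have tk : ∀ m n : ℕ, m ≤ n → tick m ≤ tick n := fun m n h =>
    div_le_div_of_nonneg_right (by exact_mod_cast h) (by positivity)
  refine ⟨hTop.kind (by simp [topSteps]) (by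
    intro st hst; simp [topSteps] at hst; rw [hst]) e1, ?_, ?_, ?_, ?_, ?_, ?_, ?_, ?_⟩
  · intro t ht
    rcases le_or_gt t (tick 216538699583507) with h1 | h1
    · exact mid1 t ⟨ht.1, h1⟩
    · rcases le_or_gt t (tick 217101649536930) with h2 | h2
      · exact mid2 t ⟨h1.le, h2⟩
      · exact mid3 t ⟨h2.le, ht.2⟩
  · intro t ht
    rcases le_or_gt t (tick 813181207717084) with h1 | h1
    · exact bot1 t ⟨ht.1, h1⟩
    · exact bot2 t ⟨h1.le, ht.2.trans (tk _ _ (by norm_num))⟩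
  · obtain ⟨⟨a1, _⟩, ⟨a2, _⟩, _⟩ := (hC1 _ (right_mem_Icc.2 (tk _ _ (by norm_num)))).2.2
    push_cast at a1 a2
    exact ⟨a1, a2⟩
  · obtain ⟨⟨_, a1⟩, ⟨_, a2⟩, _⟩ := (hC3 _ (left_mem_Icc.2 (by
      have : 0 ≤ Step.time ⟨1, 8, 2, [(949900, 950300), (1867300, 1867600)]⟩ := by
        unfold Step.time; positivity
      linarith))).2.2
    push_cast at a1 a2
    exact ⟨a1, a2⟩
  · intro t ht
    obtain ⟨a1, a2, _, _, a3, _, a4, _⟩ := (hC2 t ht).2.2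
    push_cast at a1 a3 a4
    exact ⟨a1, a3, a4⟩
  · obtain ⟨⟨a1, _⟩, _⟩ := (hE1 _ (right_mem_Icc.2 (tk _ _ (by norm_num)))).2.2
    push_cast at a1
    exact lt_of_lt_of_le (by norm_num) a1
  · obtain ⟨⟨_, a1⟩, _⟩ := (hE3 _ (left_mem_Icc.2 (by
      have : 0 ≤ Step.time ⟨1, 8, 3, [(-8388608, -100)]⟩ := by
        unfold Step.time; positivity
      linarith))).2.2
    push_cast at a1
    exact lt_of_le_of_lt a1 (by norm_num)
  · intro t ht
    obtain ⟨_, a1, _, _, _, a2, _, a3, _⟩ := (hE2 t ht).2.2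
    push_cast at a1 a2 a3
    exact ⟨a1, a2, a3⟩

theorem totalTime_shootSteps : totalTime shootSteps = tick 551353184380832 := by
  simp [totalTime, shootSteps, Step.time, tick]; norm_num

theorem low_facts {z : ℝ → Fin 8 → ℝ} (hz : ∀ t, HasDerivAt z (truncField (z t)) t)
    (h0 : z 0 = initState (heightLo / 2 ^ 44)) :
    0 ≤ z (tick 816042551838704) 0 ∧ 0 ≤ z (tick 816042551838704) 3 := by
  have h := certified_sound certified_low hz (by
    rw [h0, twoPow_eq, int_mul_eq, twoPow_eq]
    push_cast
    refine (dist_pi_le_iff (by positivity)).2 fun i => ?_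
    fin_cases i <;> simp [initState] <;> norm_num
    ring)
  have h2 := h.append.2.append.2
  obtain ⟨⟨_, h3⟩, _⟩ := h2
  rw [totalTime_shootSteps] at h3
  have e : 0 + tick 551353184380832 + totalTime (List.replicate 7 ⟨37812766779696, 17, 0, []⟩) =
      tick 816042551838704 := by
    simp [totalTime, Step.time, tick]; norm_num
  rw [e] at h3
  obtain ⟨⟨a1, _⟩, _, _, ⟨a2, _⟩, _⟩ := (h3 _ (left_mem_Icc.2 (by
      have : 0 ≤ Step.time ⟨1, 8, 0, [(0, 8388608), free, free, (0, 8388608)]⟩ := by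
        unfold Step.time; positivity
      linarith))).2.2
  push_cast at a1 a2
  rw [zero_div] at a1 a2
  exact ⟨a1, a2⟩

theorem high_facts {z : ℝ → Fin 8 → ℝ} (hz : ∀ t, HasDerivAt z (truncField (z t)) t)
    (h0 : z 0 = initState (heightHi / 2 ^ 44)) :
    z (tick 816042551838509) 0 ≤ 0 ∧ z (tick 816042551838509) 3 ≤ 0 := by
  have h := certified_sound certified_high hz (by
    rw [h0, twoPow_eq, int_mul_eq, twoPow_eq]
    push_cast
    refine (dist_pi_le_iff (by positivity)).2 fun i => ?_
    fin_cases i <;> simp [initState] <;> norm_num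
    ring)
  have h2 := h.append.2.append.2
  obtain ⟨_, ⟨_, h3⟩, _⟩ := h2
  rw [totalTime_shootSteps] at h3
  have e : 0 + tick 551353184380832 + totalTime (List.replicate 6 ⟨37812766779668, 17, 0, []⟩) +
      Step.time ⟨37812766779669, 17, 0, []⟩ = tick 816042551838509 := by
    simp [totalTime, Step.time, tick]; norm_num
  rw [e] at h3
  obtain ⟨⟨_, a1⟩, _, _, ⟨_, a2⟩, _⟩ := (h3 _ (left_mem_Icc.2 (by
      have : 0 ≤ Step.time ⟨1, 8, 0, [(-8388608, 0), free, free, (-8388608, 0)]⟩ := by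
        unfold Step.time; positivity
      linarith))).2.2
  push_cast at a1 a2
  rw [zero_div] at a1 a2
  exact ⟨a1, a2⟩

theorem truncField_of_le {z : Fin 8 → ℝ} (h : ∀ i, |z i| ≤ 8) : truncField z = field z := by
  rw [truncField, clamp_of_mem h]

/-- The components of a solution, as long as it stays in the box. -/
theorem hasDerivAt_components {z : ℝ → Fin 8 → ℝ} {t : ℝ}
    (hz : HasDerivAt z (truncField (z t)) t) (h : ∀ i, |z t i| ≤ 8) :
    HasDerivAt (fun t => z t 0) (z t 1 * z t 2) t ∧ HasDerivAt (fun t => z t 1) (z t 1 * z t 3) t ∧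
    HasDerivAt (fun t => z t 2) (-(z t 3 * turn (z t 0) (z t 1) (z t 2) (z t 3))) t ∧
    HasDerivAt (fun t => z t 3) (z t 2 * turn (z t 0) (z t 1) (z t 2) (z t 3)) t := by
  rw [truncField_of_le h, hasDerivAt_pi] at hz
  exact ⟨hz 0, hz 1, hz 2, hz 3⟩

theorem tick_le {m n : ℕ} (h : m ≤ n) : tick m ≤ tick n :=
  div_le_div_of_nonneg_right (by exact_mod_cast h) (by positivity)

theorem tick_zero : tick 0 = 0 := by simp [tick]

namespace TubeFacts
variable {z : ℝ → Fin 8 → ℝ}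

theorem abs_le (h : TubeFacts z) {t : ℝ} (ht : t ∈ Icc (0 : ℝ) (tick 818810707251298)) :
    ∀ i, |z t i| ≤ 8 := by
  rw [← tick_zero] at ht
  rcases le_or_gt t (tick 140737488355320) with h1 | h1
  · exact (h.top t ⟨ht.1, h1⟩).1
  · rcases le_or_gt t (tick 551353184380834) with h2 | h2
    · exact (h.middle t ⟨h1.le, h2⟩).1
    · exact (h.bottom t ⟨h2.le, ht.2⟩).1

theorem strictAntiOn_x (h : TubeFacts z) (hz : ∀ t, HasDerivAt z (truncField (z t)) t) :
    StrictAntiOn (fun t => z t 0) (Icc (tick 551353184380834) (tick 818810707251298)) := by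
  have hd := fun t ht => (hasDerivAt_components (hz t) (h.bottom t ht).1).1
  refine strictAntiOn_of_deriv_neg (convex_Icc _ _)
    (fun t ht => (hd t ht).continuousAt.continuousWithinAt) fun t ht => ?_
  rw [interior_Icc] at ht
  have ht := Ioo_subset_Icc_self ht
  rw [(hd t ht).deriv]
  obtain ⟨h1, h2, _⟩ := (h.bottom t ht).2
  exact mul_neg_of_pos_of_neg h2 h1

theorem strictMonoOn_s (h : TubeFacts z) (hz : ∀ t, HasDerivAt z (truncField (z t)) t) :
    StrictMonoOn (fun t => z t 3) (Icc (tick 551353184380834) (tick 818810707251298)) := by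
  have hd := fun t ht => (hasDerivAt_components (hz t) (h.bottom t ht).1).2.2.2
  refine strictMonoOn_of_deriv_pos (convex_Icc _ _)
    (fun t ht => (hd t ht).continuousAt.continuousWithinAt) fun t ht => ?_
  rw [interior_Icc] at ht
  have ht := Ioo_subset_Icc_self ht
  rw [(hd t ht).deriv]
  obtain ⟨h1, h2, _, _, h3⟩ := (h.bottom t ht).2
  exact mul_pos_of_neg_of_neg h1 h3

theorem exists_x_eq_zero (h : TubeFacts z) (hz : ∀ t, HasDerivAt z (truncField (z t)) t) :
    ∃ T ∈ Icc (tick 813181207717085) (tick 818810707251298), z T 0 = 0 := by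
  have hc : ContinuousOn (fun t => z t 0) (Icc (tick 813181207717085) (tick 818810707251298)) :=
    fun t _ => ((hasDerivAt_pi.1 (hz t)) 0).continuousAt.continuousWithinAt
  have := intermediate_value_Icc' (tick_le (by norm_num)) hc ⟨h.endEnd.le, h.endStart.le⟩
  exact this

end TubeFacts

/-- The shooting argument: for one initial height, the profile returns to the axis `{x₁ = 0}`
horizontally. The sine of the tangent angle at the point of return is nonnegative for the smallest
initial height and nonpositive for the largest one. The sets of initial heights for which it is
nonnegative or nonpositive are closed, as projections of compact sets, and they cover an interval,
so that they meet. -/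
theorem exists_shooting : ∃ (a T : ℝ) (z : ℝ → Fin 8 → ℝ),
    a ∈ Icc ((heightLo : ℝ) / 2 ^ 44) ((heightHi : ℝ) / 2 ^ 44) ∧ z 0 = initState a ∧
    (∀ t, HasDerivAt z (truncField (z t)) t) ∧ TubeFacts z ∧
    T ∈ Icc (tick 813181207717085) (tick 818810707251298) ∧ z T 0 = 0 ∧ z T 3 = 0 := by
  choose Z h0 hZ using fun a => exists_flow (initState a)
  set lo : ℝ := (heightLo : ℝ) / 2 ^ 44 with hlo
  set hi : ℝ := (heightHi : ℝ) / 2 ^ 44 with hhi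
  have hlohi : lo ≤ hi := by
    rw [hlo, hhi]; norm_num [heightLo, heightHi]
  have tube : ∀ a ∈ Icc lo hi, TubeFacts (Z a) := fun a ha => tubeFacts (hZ a) ha (h0 a)
  have mem : ∀ t ∈ Icc (tick 813181207717085) (tick 818810707251298),
      t ∈ Icc (tick 551353184380834) (tick 818810707251298) := fun t ht =>
    ⟨(tick_le (by norm_num)).trans ht.1, ht.2⟩
  set C : Set (ℝ × ℝ) := Icc lo hi ×ˢ Icc (tick 813181207717085) (tick 818810707251298) with hC
  have hCc : IsCompact C := isCompact_Icc.prod isCompact_Icc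
  have hZc : ContinuousOn (fun p : ℝ × ℝ => Z p.1 p.2) C := by
    refine (continuousOn_flow h0 hZ).mono (prod_mono (subset_univ _) fun t ht => ⟨?_, ht.2.trans ?_⟩)
    · rw [← tick_zero]; exact (tick_le (by norm_num)).trans ht.1
    · norm_num [tick]
  have hcomp : ∀ i, ContinuousOn (fun p : ℝ × ℝ => Z p.1 p.2 i) C := fun i =>
    (continuous_apply i).comp_continuousOn hZc
  have closed : ∀ S : Set ℝ, IsClosed S →
      IsClosed (Prod.fst '' (C ∩ {p : ℝ × ℝ | Z p.1 p.2 0 = 0 ∧ Z p.1 p.2 3 ∈ S})) := by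
    intro S hS
    have h1 := (hcomp 0).preimage_isClosed_of_isClosed hCc.isClosed (isClosed_singleton (x := 0))
    have h2 := (hcomp 3).preimage_isClosed_of_isClosed hCc.isClosed hS
    have h3 : C ∩ {p : ℝ × ℝ | Z p.1 p.2 0 = 0 ∧ Z p.1 p.2 3 ∈ S} =
        (C ∩ (fun p : ℝ × ℝ => Z p.1 p.2 0) ⁻¹' {0}) ∩
          (C ∩ (fun p : ℝ × ℝ => Z p.1 p.2 3) ⁻¹' S) := by
      ext p; simp; tauto
    rw [h3]
    exact ((hCc.of_isClosed_subset (h1.inter h2)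
      (fun p hp => hp.1.1)).image continuous_fst).isClosed
  have hmemA : ∀ a ∈ Icc lo hi, ∀ S : Set ℝ,
      ∀ T ∈ Icc (tick 813181207717085) (tick 818810707251298),
      Z a T 0 = 0 → Z a T 3 ∈ S →
      a ∈ Prod.fst '' (C ∩ {p : ℝ × ℝ | Z p.1 p.2 0 = 0 ∧ Z p.1 p.2 3 ∈ S}) :=
    fun a ha S T hT h1 h2 => ⟨(a, T), ⟨⟨ha, hT⟩, h1, h2⟩, rfl⟩
  have key := isPreconnected_closed_iff.1 (isPreconnected_Icc (a := lo) (b := hi)) _ _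
    (closed (Ici 0) isClosed_Ici) (closed (Iic 0) isClosed_Iic) (fun a ha => ?_) ?_ ?_
  · obtain ⟨a, ha, ⟨⟨a₁, T₁⟩, ⟨⟨ha₁, hT₁⟩, hx₁, hs₁⟩, rfl⟩,
      ⟨⟨a₂, T₂⟩, ⟨⟨ha₂, hT₂⟩, hx₂, hs₂⟩, e⟩⟩ := key
    simp only at e ha₁ hT₁ hx₁ hs₁ ha₂ hT₂ hx₂ hs₂
    subst e
    have eT : T₁ = T₂ := ((tube _ ha₁).strictAntiOn_x (hZ _)).injOn (mem _ hT₁) (mem _ hT₂)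
      (hx₁.trans hx₂.symm)
    subst eT
    exact ⟨a₂, T₁, Z a₂, ha₁, h0 _, hZ _, tube _ ha₁, hT₁, hx₁, le_antisymm hs₂ hs₁⟩
  · obtain ⟨T, hT, hx⟩ := (tube a ha).exists_x_eq_zero (hZ a)
    rcases le_total 0 (Z a T 3) with h | h
    · exact Or.inl (hmemA a ha _ T hT hx h)
    · exact Or.inr (hmemA a ha _ T hT hx h)
  · have ha : lo ∈ Icc lo hi := left_mem_Icc.2 hlohi
    obtain ⟨T, hT, hx⟩ := (tube lo ha).exists_x_eq_zero (hZ lo)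
    obtain ⟨h1, h2⟩ := low_facts (hZ lo) (h0 lo)
    have hm : tick 816042551838704 ∈ Icc (tick 551353184380834) (tick 818810707251298) :=
      ⟨tick_le (by norm_num), tick_le (by norm_num)⟩
    refine ⟨lo, ha, hmemA lo ha _ T hT hx ?_⟩
    have h3 : tick 816042551838704 ≤ T := by
      by_contra! h3
      have := (tube lo ha).strictAntiOn_x (hZ lo) (mem T hT) hm h3
      simp only [hx] at this
      linarith
    exact h2.trans (((tube lo ha).strictMonoOn_s (hZ lo)).monotoneOn hm (mem T hT) h3)
  · have ha : hi ∈ Icc lo hi := right_mem_Icc.2 hlohi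
    obtain ⟨T, hT, hx⟩ := (tube hi ha).exists_x_eq_zero (hZ hi)
    obtain ⟨h1, h2⟩ := high_facts (hZ hi) (h0 hi)
    have hm : tick 816042551838509 ∈ Icc (tick 551353184380834) (tick 818810707251298) :=
      ⟨tick_le (by norm_num), tick_le (by norm_num)⟩
    refine ⟨hi, ha, hmemA hi ha _ T hT hx ?_⟩
    have h3 : T ≤ tick 816042551838509 := by
      by_contra! h3
      have := (tube hi ha).strictAntiOn_x (hZ hi) hm (mem T hT) h3
      simp only [hx] at this
      linarith
    exact (((tube hi ha).strictMonoOn_s (hZ hi)).monotoneOn (mem T hT) hm h3).trans h2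

/-! ### Reflection and periodicity -/

/-- The first four components of `truncField`, which depend on the first four variables. -/
def profField (w : Fin 4 → ℝ) : Fin 4 → ℝ :=
  let v := truncField ![w 0, w 1, w 2, w 3, 0, 0, 0, 0]
  ![v 0, v 1, v 2, v 3]

/-- The part of the state that describes the profile. -/
def proj (z : Fin 8 → ℝ) : Fin 4 → ℝ := ![z 0, z 1, z 2, z 3]

/-- The reflection of the state under `x₁ ↦ -x₁` and the reversal of time. -/
def reflect (w : Fin 4 → ℝ) : Fin 4 → ℝ := ![-w 0, w 1, w 2, -w 3]

theorem lipschitzWith_profField : LipschitzWith 1000000 profField := by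
  refine LipschitzWith.of_dist_le_mul fun v w => ?_
  have h1 := lipschitzWith_truncField.dist_le_mul ![v 0, v 1, v 2, v 3, 0, 0, 0, 0]
    ![w 0, w 1, w 2, w 3, 0, 0, 0, 0]
  have h2 : dist (![v 0, v 1, v 2, v 3, 0, 0, 0, 0] : Fin 8 → ℝ) ![w 0, w 1, w 2, w 3, 0, 0, 0, 0] ≤
      dist v w := by
    refine (dist_pi_le_iff dist_nonneg).2 fun i => ?_
    fin_cases i
    · exact dist_le_pi_dist v w 0
    · exact dist_le_pi_dist v w 1
    · exact dist_le_pi_dist v w 2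
    · exact dist_le_pi_dist v w 3
    all_goals simp
  refine ((dist_pi_le_iff dist_nonneg).2 fun i => ?_).trans
    (h1.trans (mul_le_mul_of_nonneg_left h2 (NNReal.coe_nonneg _)))
  have h3 := dist_le_pi_dist (truncField ![v 0, v 1, v 2, v 3, 0, 0, 0, 0])
    (truncField ![w 0, w 1, w 2, w 3, 0, 0, 0, 0])
  fin_cases i
  · exact h3 0
  · exact h3 1
  · exact h3 2
  · exact h3 3

theorem proj_truncField (z : Fin 8 → ℝ) : proj (truncField z) = profField (proj z) := by
  funext i
  fin_cases i <;> simp [proj, profField, truncField, field, clamp]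

theorem max_min_neg (v : ℝ) : max (-8) (min 8 (-v)) = -max (-8) (min 8 v) := by
  rcases le_total v 8 with h | h <;> rcases le_total (-8) v with h' | h' <;>
    simp only [max_def, min_def] <;> split_ifs <;> linarith

theorem profField_reflect (w : Fin 4 → ℝ) : profField (reflect w) = -reflect (profField w) := by
  funext i
  fin_cases i <;> simp [reflect, profField, truncField, field, clamp, turn, max_min_neg]

/-- A solution that meets the axis `{x₁ = 0}` horizontally at the time `T` is symmetric. -/
theorem eq_reflect {P : ℝ → Fin 4 → ℝ} (hP : ∀ t, HasDerivAt P (profField (P t)) t) {T : ℝ}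
    (h0 : P T 0 = 0) (h3 : P T 3 = 0) (t : ℝ) : P t = reflect (P (2 * T - t)) := by
  have hQ : ∀ t, HasDerivAt (fun t => reflect (P (2 * T - t)))
      (profField (reflect (P (2 * T - t)))) t := by
    intro t
    have h1 : HasDerivAt (fun t => P (2 * T - t)) (-profField (P (2 * T - t))) t :=
      (hP (2 * T - t)).comp_const_sub (2 * T) t
    rw [hasDerivAt_pi] at h1
    rw [profField_reflect, hasDerivAt_pi]
    intro i
    fin_cases i
    · exact (h1 0).neg
    · exact h1 1
    · exact h1 2
    · exact (h1 3).neg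
  have := ODE_solution_unique_univ (v := fun _ => profField) (s := fun _ => univ) (K := 1000000)
    (t₀ := T) (fun _ => lipschitzWith_profField.lipschitzOnWith) (fun t => ⟨hP t, trivial⟩)
    (fun t => ⟨hQ t, trivial⟩) (by
      funext i
      have e : 2 * T - T = T := by ring
      rw [e]
      fin_cases i <;> simp [reflect, h0, h3])
  exact congrFun this t

/-- `(x, y)` is the profile of a self-shrinking torus of revolution, in the conformal parameter and
with unit tangent `(c, s)`. It is symmetric, and it crosses the axis `{x₁ = 0}` at the times `0` and
`T` (half a period). In between, it lies on the right of the axis and descends. -/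
structure ProfileCurve (x y c s : ℝ → ℝ) (T : ℝ) : Prop where
  hx : ∀ t, HasDerivAt x (y t * c t) t
  hy : ∀ t, HasDerivAt y (y t * s t) t
  hc : ∀ t, HasDerivAt c (-(s t * turn (x t) (y t) (c t) (s t))) t
  hs : ∀ t, HasDerivAt s (c t * turn (x t) (y t) (c t) (s t)) t
  unit : ∀ t, c t ^ 2 + s t ^ 2 = 1
  T_pos : 0 < T
  symm : ∀ t, x (-t) = -x t ∧ y (-t) = y t ∧ c (-t) = c t ∧ s (-t) = -s t
  per : ∀ t, x (t + 2 * T) = x t ∧ y (t + 2 * T) = y t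
  x_T : x T = 0
  s_T : s T = 0
  y_pos : ∀ t, 0 < y t
  x_pos : ∀ t ∈ Ioo 0 T, 0 < x t
  s_neg : ∀ t ∈ Ioo 0 T, s t < 0

/-- The profile of the torus, and the two solutions `(u, q)` and `(v, r)` of the linearized equation
along its right half, with the data that decide about the nondegeneracy. -/
structure TorusData (x y c s : ℝ → ℝ) (T tc : ℝ) (u q v r : ℝ → ℝ) : Prop
    extends ProfileCurve x y c s T where
  y_zero : |y 0 - 4034 / 1217| < 5 / 2 * epsGap
  y_T : |y T - 7 / 16| < 3 / 98
  tc_mem : tc ∈ Ioo 0 T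
  outside : ∀ t ∈ Ico 0 tc, 4 < x t ^ 2 + y t ^ 2
  inside : ∀ t ∈ Ioc tc T, x t ^ 2 + y t ^ 2 < 4
  norm_tc : x tc ^ 2 + y tc ^ 2 = 4
  x_tc : x tc ∈ Icc (949000 / 2 ^ 20 : ℝ) (952000 / 2 ^ 20)
  hu : ∀ t ∈ Icc 0 T, HasDerivAt u (2 * q t) t
  hq : ∀ t ∈ Icc 0 T, HasDerivAt q
    (drift (x t) (y t) (c t) (s t) * q t - pot (x t) (y t) (c t) (s t) * u t / 2) t
  hv : ∀ t ∈ Icc 0 T, HasDerivAt v (2 * r t) t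
  hr : ∀ t ∈ Icc 0 T, HasDerivAt r
    (drift (x t) (y t) (c t) (s t) * r t - pot (x t) (y t) (c t) (s t) * v t / 2) t
  init : u 0 = 1 / 64 ∧ q 0 = 0 ∧ v 0 = 0 ∧ r 0 = 1 / 64
  q_T : q T ≠ 0
  u_tc : u tc ≠ 0
  wronskian : u tc * r T - v tc * q T ≠ 0

/-- The enclosures decide all the signs that are needed: the profile is inside the sphere at its end,
outside at its beginning, and its distance from the origin decreases in the part between. The values
of `u` and `v` at the sphere and of `q` and `r` at the end are known well enough to exclude zeros of
`q T`, `u tc` and the determinant. -/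
theorem exists_torusData : ∃ (x y c s : ℝ → ℝ) (T tc : ℝ) (u q v r : ℝ → ℝ),
    TorusData x y c s T tc u q v r := by
  obtain ⟨a, T, z, ha, h0, hz, F, hT, hxT, hsT⟩ := exists_shooting
  have hT0 : 0 < T := lt_of_lt_of_le (by norm_num [tick]) hT.1
  have z0 : ∀ i, z 0 i = initState a i := fun i => by rw [h0]
  have hbox : ∀ t ∈ Icc 0 T, ∀ i, |z t i| ≤ 8 := fun t ht => F.abs_le ⟨ht.1, ht.2.trans hT.2⟩
  set P : ℝ → Fin 4 → ℝ := fun t => proj (z t) with hPdef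
  have hP : ∀ t, HasDerivAt P (profField (P t)) t := fun t => by
    rw [hPdef]
    beta_reduce
    rw [← proj_truncField, hasDerivAt_pi]
    have := hasDerivAt_pi.1 (hz t)
    intro i
    fin_cases i
    · exact this 0
    · exact this 1
    · exact this 2
    · exact this 3
  have refl0 : ∀ t, P (-t) = reflect (P t) := fun t => by
    have := eq_reflect hP (T := 0) (by simp [hPdef, proj, z0, initState])
      (by simp [hPdef, proj, z0, initState]) (-t)
    simpa using this
  have hper : Function.Periodic P (2 * T) := fun t => by
    have := eq_reflect hP (T := T) hxT hsT (t + 2 * T)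
    rw [this]
    have e : 2 * T - (t + 2 * T) = -t := by ring
    rw [e, refl0]
    funext i; fin_cases i <;> simp [reflect]
  -- every state is, up to a reflection, a state at a time between `0` and `T`
  have red : ∀ t, ∃ t' ∈ Icc 0 T, P t = P t' ∨ P t = reflect (P t') := fun t => by
    obtain ⟨t', ht', e⟩ := hper.exists_mem_Ico (by linarith) t (-T)
    rcases le_total 0 t' with h | h
    · exact ⟨t', ⟨h, by linarith [ht'.2]⟩, Or.inl e⟩
    · refine ⟨-t', ⟨by linarith, by linarith [ht'.1]⟩, Or.inr ?_⟩
      rw [e, ← refl0, neg_neg]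
  have hbd : ∀ t, |P t 0| ≤ 8 ∧ |P t 1| ≤ 8 ∧ |P t 2| ≤ 8 ∧ |P t 3| ≤ 8 := fun t => by
    obtain ⟨t', ht', e⟩ := red t
    have := hbox t' ht'
    rcases e with e | e <;> rw [e] <;>
      simpa [reflect, hPdef, proj] using ⟨this 0, this 1, this 2, this 3⟩
  have hfield : ∀ t, profField (P t) = ![P t 1 * P t 2, P t 1 * P t 3,
      -(P t 3 * turn (P t 0) (P t 1) (P t 2) (P t 3)),
      P t 2 * turn (P t 0) (P t 1) (P t 2) (P t 3)] := fun t => by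
    obtain ⟨b0, b1, b2, b3⟩ := hbd t
    unfold profField
    rw [truncField_of_le]
    · funext i; fin_cases i <;> simp [field]
    · intro i
      fin_cases i
      · exact b0
      · exact b1
      · exact b2
      · exact b3
      all_goals simp
  have hPc := fun t => hasDerivAt_pi.1 (hfield t ▸ hP t)
  have hx : ∀ t, HasDerivAt (fun t => z t 0) (z t 1 * z t 2) t := fun t => hPc t 0
  have hy : ∀ t, HasDerivAt (fun t => z t 1) (z t 1 * z t 3) t := fun t => hPc t 1
  have hc : ∀ t, HasDerivAt (fun t => z t 2)
    (-(z t 3 * turn (z t 0) (z t 1) (z t 2) (z t 3))) t := fun t => hPc t 2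
  have hs : ∀ t, HasDerivAt (fun t => z t 3)
    (z t 2 * turn (z t 0) (z t 1) (z t 2) (z t 3)) t := fun t => hPc t 3
  have kTop : ∀ t ∈ Icc 0 (tick 140737488355320),
      0 < z t 2 ∧ 2 < z t 1 ∧ turn (z t 0) (z t 1) (z t 2) (z t 3) < 0 := fun t ht =>
    (F.top t (by rwa [tick_zero])).2
  have kMid : ∀ t ∈ Icc (tick 140737488355320) (tick 551353184380834),
      z t 3 < 0 ∧ 0 < z t 0 ∧ 0 < z t 1 ∧ z t 0 * z t 2 + z t 1 * z t 3 < 0 :=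
    fun t ht => (F.middle t ht).2
  have kBot : ∀ t ∈ Icc (tick 551353184380834) T,
      z t 2 < 0 ∧ 0 < z t 1 ∧ z t 1 < 1 ∧ |z t 0| < 1 ∧ turn (z t 0) (z t 1) (z t 2) (z t 3) < 0 :=
    fun t ht => (F.bottom t ⟨ht.1, ht.2.trans hT.2⟩).2
  have tp0 : 0 < tick 140737488355320 := by norm_num [tick]
  have tpb : tick 140737488355320 ≤ tick 551353184380834 := tick_le (by norm_num)
  have tbT : tick 551353184380834 ≤ T := (tick_le (by norm_num)).trans hT.1
  have ypos0 : ∀ t ∈ Icc 0 T, 0 < z t 1 := fun t ht => by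
    rcases le_or_gt t (tick 140737488355320) with h1 | h1
    · linarith [(kTop t ⟨ht.1, h1⟩).2.1]
    · rcases le_or_gt t (tick 551353184380834) with h2 | h2
      · exact (kMid t ⟨h1.le, h2⟩).2.2.1
      · exact (kBot t ⟨h2.le, ht.2⟩).2.1
  have xz : z 0 0 = 0 := by rw [z0]; rfl
  have sz : z 0 3 = 0 := by rw [z0]; rfl
  have xpos : ∀ t ∈ Ioo 0 T, 0 < z t 0 := fun t ht => by
    rcases le_or_gt t (tick 140737488355320) with h1 | h1
    · have hm : StrictMonoOn (fun t => z t 0) (Icc 0 (tick 140737488355320)) := by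
        refine strictMonoOn_of_deriv_pos (convex_Icc _ _)
          (fun t _ => (hx t).continuousAt.continuousWithinAt) fun t ht => ?_
        rw [interior_Icc] at ht
        rw [(hx t).deriv]
        obtain ⟨h1, h2, _⟩ := kTop t (Ioo_subset_Icc_self ht)
        exact mul_pos (by linarith) h1
      have := hm (left_mem_Icc.2 tp0.le) ⟨ht.1.le, h1⟩ ht.1
      simpa only [xz] using this
    · rcases le_or_gt t (tick 551353184380834) with h2 | h2
      · exact (kMid t ⟨h1.le, h2⟩).2.1
      · have := F.strictAntiOn_x hz ⟨h2.le, ht.2.le.trans hT.2⟩ ⟨tbT, hT.2⟩ ht.2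
        simpa only [hxT] using this
  have sneg : ∀ t ∈ Ioo 0 T, z t 3 < 0 := fun t ht => by
    rcases le_or_gt t (tick 140737488355320) with h1 | h1
    · have hm : StrictAntiOn (fun t => z t 3) (Icc 0 (tick 140737488355320)) := by
        refine strictAntiOn_of_deriv_neg (convex_Icc _ _)
          (fun t _ => (hs t).continuousAt.continuousWithinAt) fun t ht => ?_
        rw [interior_Icc] at ht
        rw [(hs t).deriv]
        obtain ⟨h1, h2, h3⟩ := kTop t (Ioo_subset_Icc_self ht)
        exact mul_neg_of_pos_of_neg h1 h3
      have := hm (left_mem_Icc.2 tp0.le) ⟨ht.1.le, h1⟩ ht.1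
      simpa only [sz] using this
    · rcases le_or_gt t (tick 551353184380834) with h2 | h2
      · exact (kMid t ⟨h1.le, h2⟩).1
      · have := F.strictMonoOn_s hz ⟨h2.le, ht.2.le.trans hT.2⟩ ⟨tbT, hT.2⟩ ht.2
        simpa only [hsT] using this
  -- the distance from the origin
  have hN : ∀ t, HasDerivAt (fun t => z t 0 ^ 2 + z t 1 ^ 2)
      (2 * (z t 1 * (z t 0 * z t 2 + z t 1 * z t 3))) t := fun t =>
    (((hx t).pow 2).add ((hy t).pow 2)).congr_deriv (by ring)
  have hanti : StrictAntiOn (fun t => z t 0 ^ 2 + z t 1 ^ 2)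
      (Icc (tick 140737488355320) (tick 551353184380834)) := by
    refine strictAntiOn_of_deriv_neg (convex_Icc _ _)
      (fun t _ => (hN t).continuousAt.continuousWithinAt) fun t ht => ?_
    rw [interior_Icc] at ht
    rw [(hN t).deriv]
    obtain ⟨_, _, h1, h2⟩ := kMid t (Ioo_subset_Icc_self ht)
    linarith [mul_neg_of_pos_of_neg h1 h2]
  have c1 : tick 140737488355320 ≤ tick 216538699583508 := tick_le (by norm_num)
  have c2 : tick 216538699583508 ≤ tick 217101649536929 := tick_le (by norm_num)
  have c3 : tick 217101649536929 ≤ tick 551353184380834 := tick_le (by norm_num)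
  obtain ⟨tc, htc, htc4⟩ : ∃ tc ∈ Icc (tick 216538699583508) (tick 217101649536929),
      z tc 0 ^ 2 + z tc 1 ^ 2 = 4 := by
    refine intermediate_value_Icc' c2 (fun t _ => (hN t).continuousAt.continuousWithinAt) ⟨?_, ?_⟩
    · obtain ⟨_, h1, h2, _⟩ := kMid (tick 217101649536929) ⟨c1.trans c2, c3⟩
      have h3 := pow_le_pow_left₀ h1.le F.crossEnd.1 2
      have h4 := pow_le_pow_left₀ h2.le F.crossEnd.2 2
      norm_num at h3 h4 ⊢
      linarith
    · have h3 := pow_le_pow_left₀ (by norm_num) F.crossStart.1 2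
      have h4 := pow_le_pow_left₀ (by norm_num) F.crossStart.2 2
      norm_num at h3 h4 ⊢
      linarith
  have htcm : tc ∈ Icc (tick 140737488355320) (tick 551353184380834) :=
    ⟨c1.trans htc.1, htc.2.trans c3⟩
  obtain ⟨x1, u1, v1⟩ := F.cross tc htc
  obtain ⟨y2, q2, r2⟩ := F.window T hT
  have hcomp := fun t ht => hasDerivAt_pi.1 (truncField_of_le (hbox t ht) ▸ hz t)
  refine ⟨fun t => z t 0, fun t => z t 1, fun t => z t 2, fun t => z t 3, T, tc, fun t => z t 4,
    fun t => z t 5, fun t => z t 6, fun t => z t 7,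
    { hx := hx, hy := hy, hc := hc, hs := hs, unit := fun t => ?_, T_pos := hT0,
      symm := fun t => ?_, per := fun t => ?_, x_T := hxT, s_T := hsT, y_pos := fun t => ?_,
      x_pos := xpos, s_neg := sneg, y_zero := ?_, y_T := ?_, tc_mem := ?_, outside := ?_,
      inside := ?_, norm_tc := htc4, x_tc := x1, hu := fun t ht => hcomp t ht 4,
      hq := fun t ht => hcomp t ht 5, hv := fun t ht => hcomp t ht 6,
      hr := fun t ht => hcomp t ht 7, init := ?_, q_T := ?_, u_tc := ?_, wronskian := ?_ }⟩
  · have hd : ∀ t, HasDerivAt (fun t => z t 2 ^ 2 + z t 3 ^ 2) 0 t := fun t =>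
      (((hc t).pow 2).add ((hs t).pow 2)).congr_deriv (by ring)
    have := is_const_of_deriv_eq_zero (fun t => (hd t).differentiableAt) (fun t => (hd t).deriv) t 0
    rw [this]; simp [z0, initState]
  · have := refl0 t
    exact ⟨congrFun this 0, congrFun this 1, congrFun this 2, congrFun this 3⟩
  · have := hper t
    exact ⟨congrFun this 0, congrFun this 1⟩
  · obtain ⟨t', ht', e⟩ := red t
    have h1 : P t 1 = P t' 1 := by rcases e with e | e <;> rw [e] <;> simp [reflect]
    have h2 : z t 1 = z t' 1 := h1
    rw [h2]; exact ypos0 t' ht'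
  · simp only [z0, initState, Matrix.cons_val]
    have h1 := ha.1
    have h2 := ha.2
    simp only [heightLo, heightHi, epsGap] at h1 h2 ⊢
    norm_num at h1 h2
    rw [abs_lt]; constructor <;> norm_num <;> linarith
  · rw [abs_lt]; constructor <;> linarith [y2.1, y2.2]
  · exact ⟨tp0.trans_le htcm.1, lt_of_lt_of_le (lt_of_le_of_lt htc.2 (by norm_num [tick])) hT.1⟩
  · intro t ht
    rcases le_or_gt t (tick 140737488355320) with h1 | h1
    · have := (kTop t ⟨ht.1, h1⟩).2.1
      nlinarith [sq_nonneg (z t 0)]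
    · have := hanti ⟨h1.le, ht.2.le.trans htcm.2⟩ htcm ht.2
      simp only [htc4] at this
      exact this
  · intro t ht
    rcases le_or_gt t (tick 551353184380834) with h1 | h1
    · have := hanti htcm ⟨htcm.1.trans ht.1.le, h1⟩ ht.1
      simp only [htc4] at this
      exact this
    · obtain ⟨_, h2, h3, h4, _⟩ := kBot t ⟨h1.le, ht.2⟩
      have := (sq_lt_one_iff_abs_lt_one _).2 h4
      nlinarith
  · simp [z0, initState]
  · intro h; linarith [q2.1]
  · intro h; linarith [u1.2]
  · have h1 : z tc 4 * z T 7 ≤ 7300 / 2 ^ 20 * (1000 / 2 ^ 20) := by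
      refine (le_abs_self _).trans ?_
      rw [abs_mul]
      refine mul_le_mul (abs_le.2 ⟨?_, ?_⟩) (abs_le.2 ⟨?_, ?_⟩) (abs_nonneg _) (by norm_num) <;>
        linarith [u1.1, u1.2, r2.1, r2.2]
    have h2 : 4500 / 2 ^ 20 * (5000 / 2 ^ 20) ≤ z tc 6 * z T 5 :=
      mul_le_mul v1.1 q2.1 (by norm_num) (le_trans (by norm_num) v1.1)
    intro h
    norm_num at h1 h2
    linarith

/-! ### The geometry of surfaces of revolution -/

section pd
variable {V : Type*} [NormedAddCommGroup V] [NormedSpace ℝ V] {f : Par → V} {q : Par} {L : V}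

theorem par_eta (q : Par) : ![q 0, q 1] = q := by funext i; fin_cases i <;> rfl

theorem hasDerivAt_par_zero (θ t : ℝ) : HasDerivAt (fun t => (![t, θ] : Par)) (Pi.single 0 1) t := by
  rw [hasDerivAt_pi]
  intro i
  fin_cases i
  · exact hasDerivAt_id' t
  · simpa using hasDerivAt_const t θ

theorem hasDerivAt_par_one (θ t : ℝ) : HasDerivAt (fun θ => (![t, θ] : Par)) (Pi.single 1 1) θ := by
  rw [hasDerivAt_pi]
  intro i
  fin_cases i
  · simpa using hasDerivAt_const θ t
  · exact hasDerivAt_id' θ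

theorem hasDerivAt_pd_zero {t θ : ℝ} (hf : DifferentiableAt ℝ f ![t, θ]) :
    HasDerivAt (fun t => f ![t, θ]) (pd 0 f ![t, θ]) t :=
  hf.hasFDerivAt.comp_hasDerivAt t (hasDerivAt_par_zero θ t)

theorem hasDerivAt_pd_one {t θ : ℝ} (hf : DifferentiableAt ℝ f ![t, θ]) :
    HasDerivAt (fun θ => f ![t, θ]) (pd 1 f ![t, θ]) θ :=
  hf.hasFDerivAt.comp_hasDerivAt θ (hasDerivAt_par_one θ t)

theorem pd_zero_eq (hf : DifferentiableAt ℝ f q)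
    (h : HasDerivAt (fun t => f ![t, q 1]) L (q 0)) : pd 0 f q = L := by
  have := hasDerivAt_pd_zero (t := q 0) (θ := q 1) (f := f) (by rwa [par_eta])
  rw [par_eta] at this
  exact this.unique h

theorem pd_one_eq (hf : DifferentiableAt ℝ f q)
    (h : HasDerivAt (fun θ => f ![q 0, θ]) L (q 1)) : pd 1 f q = L := by
  have := hasDerivAt_pd_one (t := q 0) (θ := q 1) (f := f) (by rwa [par_eta])
  rw [par_eta] at this
  exact this.unique h

theorem pd_congr {g : Par → V} {i : Fin 2} (h : f =ᶠ[nhds q] g) : pd i f q = pd i g q := by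
  unfold pd; rw [h.fderiv_eq]

theorem contDiff_pd {n m : WithTop ℕ∞} (hf : ContDiff ℝ n f) (hmn : m + 1 ≤ n) (i : Fin 2) :
    ContDiff ℝ m (pd i f) :=
  (hf.fderiv_right hmn).clm_apply contDiff_const

end pd

theorem hasDerivAt_vec3 {f g h : ℝ → ℝ} {f' g' h' t : ℝ} (hf : HasDerivAt f f' t)
    (hg : HasDerivAt g g' t) (hh : HasDerivAt h h' t) :
    HasDerivAt (fun t => (!₂[f t, g t, h t] : E3)) !₂[f', g', h'] t := by
  refine (PiLp.hasFDerivAt_toLp 2 _).comp_hasDerivAt t (f := fun t => ![f t, g t, h t]) ?_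
  rw [hasDerivAt_pi]
  intro i
  fin_cases i
  · exact hf
  · exact hg
  · exact hh

theorem inner_vec3 (a b c d e f : ℝ) :
    inner ℝ (!₂[a, b, c] : E3) !₂[d, e, f] = a * d + b * e + c * f := by
  simp [PiLp.inner_apply, Fin.sum_univ_three]; ring

/-- The curve `(x, y)` has speed `w`, unit tangent `(c, s)`, and its tangent angle has the
derivative `κ`. The derivative of `w` is `dw`. -/
structure IsMeridian (x y w c s κ dw : ℝ → ℝ) : Prop where
  hx : ∀ t, HasDerivAt x (w t * c t) t
  hy : ∀ t, HasDerivAt y (w t * s t) t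
  hc : ∀ t, HasDerivAt c (-(s t * κ t)) t
  hs : ∀ t, HasDerivAt s (c t * κ t) t
  hw : ∀ t, HasDerivAt w (dw t) t
  unit : ∀ t, c t ^ 2 + s t ^ 2 = 1
  w_pos : ∀ t, 0 < w t
  smooth_x : ContDiff ℝ ∞ x
  smooth_y : ContDiff ℝ ∞ y

theorem contDiff_revolve {x y : ℝ → ℝ} (hx : ContDiff ℝ ∞ x) (hy : ContDiff ℝ ∞ y) :
    ContDiff ℝ ∞ (revolve x y) := by
  have h0 : ContDiff ℝ ∞ (fun q : Par => q 0) := contDiff_apply ℝ ℝ 0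
  have h1 : ContDiff ℝ ∞ (fun q : Par => q 1) := contDiff_apply ℝ ℝ 1
  rw [contDiff_euclidean]
  intro i
  fin_cases i
  · exact hx.comp h0
  · exact (hy.comp h0).mul (Real.contDiff_cos.comp h1)
  · exact (hy.comp h0).mul (Real.contDiff_sin.comp h1)

namespace IsMeridian
variable {x y w c s κ dw : ℝ → ℝ}

theorem contDiff (h : IsMeridian x y w c s κ dw) : ContDiff ℝ ∞ (revolve x y) :=
  contDiff_revolve h.smooth_x h.smooth_y

theorem pd_zero (h : IsMeridian x y w c s κ dw) : pd 0 (revolve x y) = fun q =>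
    !₂[w (q 0) * c (q 0), w (q 0) * s (q 0) * cos (q 1), w (q 0) * s (q 0) * sin (q 1)] := by
  funext q
  exact pd_zero_eq (h.contDiff.differentiable (by simp) q)
    (hasDerivAt_vec3 (h.hx (q 0)) ((h.hy (q 0)).mul_const (cos (q 1)))
      ((h.hy (q 0)).mul_const (sin (q 1))))

theorem pd_one (h : IsMeridian x y w c s κ dw) : pd 1 (revolve x y) = fun q =>
    !₂[0, y (q 0) * -sin (q 1), y (q 0) * cos (q 1)] := by
  funext q
  exact pd_one_eq (h.contDiff.differentiable (by simp) q)
    (hasDerivAt_vec3 (hasDerivAt_const (q 1) (x (q 0)))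
      ((Real.hasDerivAt_cos (q 1)).const_mul (y (q 0)))
      ((Real.hasDerivAt_sin (q 1)).const_mul (y (q 0))))

theorem differentiable_pd (h : IsMeridian x y w c s κ dw) (i : Fin 2) :
    Differentiable ℝ (pd i (revolve x y)) :=
  (contDiff_pd (m := 1) h.contDiff (by norm_cast) i).differentiable (by simp)

theorem pd_zero_zero (h : IsMeridian x y w c s κ dw) (q : Par) : pd 0 (pd 0 (revolve x y)) q =
    !₂[dw (q 0) * c (q 0) + w (q 0) * -(s (q 0) * κ (q 0)),
      (dw (q 0) * s (q 0) + w (q 0) * (c (q 0) * κ (q 0))) * cos (q 1),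
      (dw (q 0) * s (q 0) + w (q 0) * (c (q 0) * κ (q 0))) * sin (q 1)] := by
  refine pd_zero_eq (h.differentiable_pd 0 q) ?_
  rw [h.pd_zero]
  exact hasDerivAt_vec3 ((h.hw (q 0)).mul (h.hc (q 0)))
    (((h.hw (q 0)).mul (h.hs (q 0))).mul_const (cos (q 1)))
    (((h.hw (q 0)).mul (h.hs (q 0))).mul_const (sin (q 1)))

theorem pd_one_zero (h : IsMeridian x y w c s κ dw) (q : Par) : pd 1 (pd 0 (revolve x y)) q =
    !₂[0, w (q 0) * s (q 0) * -sin (q 1), w (q 0) * s (q 0) * cos (q 1)] := by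
  refine pd_one_eq (h.differentiable_pd 0 q) ?_
  rw [h.pd_zero]
  exact hasDerivAt_vec3 (hasDerivAt_const (q 1) (w (q 0) * c (q 0)))
    ((Real.hasDerivAt_cos (q 1)).const_mul (w (q 0) * s (q 0)))
    ((Real.hasDerivAt_sin (q 1)).const_mul (w (q 0) * s (q 0)))

theorem pd_zero_one (h : IsMeridian x y w c s κ dw) (q : Par) : pd 0 (pd 1 (revolve x y)) q =
    !₂[0, w (q 0) * s (q 0) * -sin (q 1), w (q 0) * s (q 0) * cos (q 1)] := by
  refine pd_zero_eq (h.differentiable_pd 1 q) ?_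
  rw [h.pd_one]
  exact hasDerivAt_vec3 (hasDerivAt_const (q 0) 0) ((h.hy (q 0)).mul_const (-sin (q 1)))
    ((h.hy (q 0)).mul_const (cos (q 1)))

theorem pd_one_one (h : IsMeridian x y w c s κ dw) (q : Par) : pd 1 (pd 1 (revolve x y)) q =
    !₂[0, y (q 0) * -cos (q 1), y (q 0) * -sin (q 1)] := by
  refine pd_one_eq (h.differentiable_pd 1 q) ?_
  rw [h.pd_one]
  exact hasDerivAt_vec3 (hasDerivAt_const (q 1) 0)
    ((Real.hasDerivAt_sin (q 1)).neg.const_mul (y (q 0)))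
    ((Real.hasDerivAt_cos (q 1)).const_mul (y (q 0)))

theorem metric_eq (h : IsMeridian x y w c s κ dw) (q : Par) :
    metric (revolve x y) q = Matrix.diagonal ![w (q 0) ^ 2, y (q 0) ^ 2] := by
  have h1 := h.unit (q 0)
  have h2 := Real.sin_sq_add_cos_sq (q 1)
  ext i j
  simp only [metric, Matrix.of_apply]
  fin_cases i <;> fin_cases j <;>
    simp only [Fin.zero_eta, Fin.mk_one, Fin.isValue, h.pd_zero, h.pd_one, inner_vec3] <;> simp
  · linear_combination w (q 0) ^ 2 * h1 + w (q 0) ^ 2 * s (q 0) ^ 2 * h2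
  · ring
  · ring
  · linear_combination y (q 0) ^ 2 * h2

theorem metric_inv (h : IsMeridian x y w c s κ dw) {q : Par} (hy : 0 < y (q 0)) :
    (metric (revolve x y) q)⁻¹ = Matrix.diagonal ![(w (q 0) ^ 2)⁻¹, (y (q 0) ^ 2)⁻¹] := by
  have hw := h.w_pos (q 0)
  rw [h.metric_eq]
  refine Matrix.inv_eq_left_inv ?_
  rw [Matrix.diagonal_mul_diagonal, ← Matrix.diagonal_one]
  congr 1
  funext i
  fin_cases i
  · simp [hw.ne']
  · simp [hy.ne']

theorem sqrt_det (h : IsMeridian x y w c s κ dw) {q : Par} (hy : 0 < y (q 0)) :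
    √(metric (revolve x y) q).det = w (q 0) * y (q 0) := by
  have hw := h.w_pos (q 0)
  rw [h.metric_eq, Matrix.det_diagonal, Fin.prod_univ_two]
  simp only [Matrix.cons_val_zero, Matrix.cons_val_one]
  rw [← mul_pow, Real.sqrt_sq (by positivity)]

theorem unitNormal_eq (h : IsMeridian x y w c s κ dw) {q : Par} (hy : 0 < y (q 0)) :
    unitNormal (revolve x y) q = !₂[s (q 0), -(c (q 0) * cos (q 1)), -(c (q 0) * sin (q 1))] := by
  have hw := h.w_pos (q 0)
  have h1 := h.unit (q 0)
  have h2 := Real.sin_sq_add_cos_sq (q 1)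
  have hcr : crossNormal (revolve x y) q = (w (q 0) * y (q 0)) •
      (!₂[s (q 0), -(c (q 0) * cos (q 1)), -(c (q 0) * sin (q 1))] : E3) := by
    rw [crossNormal, h.pd_zero, h.pd_one]
    ext i
    fin_cases i <;> simp [cross_apply]
    · linear_combination w (q 0) * s (q 0) * y (q 0) * h2
    · ring
    · ring
  have hn : ‖(!₂[s (q 0), -(c (q 0) * cos (q 1)), -(c (q 0) * sin (q 1))] : E3)‖ = 1 := by
    rw [EuclideanSpace.norm_eq, Real.sqrt_eq_one]
    simp [Fin.sum_univ_three, mul_pow]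
    linear_combination h1 + c (q 0) ^ 2 * h2
  rw [unitNormal, hcr, norm_smul, hn, mul_one, smul_smul, Real.norm_of_nonneg (by positivity),
    inv_mul_cancel₀ (by positivity), one_smul]

theorem secondForm_eq (h : IsMeridian x y w c s κ dw) {q : Par} (hy : 0 < y (q 0)) :
    secondForm (revolve x y) q =
      Matrix.diagonal ![-(w (q 0) * κ (q 0)), y (q 0) * c (q 0)] := by
  have h1 := h.unit (q 0)
  have h2 := Real.sin_sq_add_cos_sq (q 1)
  ext i j
  simp only [secondForm, Matrix.of_apply, h.unitNormal_eq hy]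
  fin_cases i <;> fin_cases j <;>
    simp [h.pd_zero_zero, h.pd_one_zero, h.pd_zero_one, h.pd_one_one, PiLp.inner_apply,
      Fin.sum_univ_three]
  · linear_combination (-w (q 0) * κ (q 0)) * h1 -
      (c (q 0) * (dw (q 0) * s (q 0) + w (q 0) * (c (q 0) * κ (q 0)))) * h2
  · ring
  · ring
  · linear_combination y (q 0) * c (q 0) * h2

theorem meanCurvature_eq (h : IsMeridian x y w c s κ dw) {q : Par} (hy : 0 < y (q 0)) :
    meanCurvature (revolve x y) q = κ (q 0) / w (q 0) - c (q 0) / y (q 0) := by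
  have hw := h.w_pos (q 0)
  rw [meanCurvature, h.metric_inv hy, h.secondForm_eq hy, Matrix.diagonal_mul_diagonal,
    Matrix.trace_diagonal, Fin.sum_univ_two]
  simp only [Matrix.cons_val_zero, Matrix.cons_val_one]
  field_simp; ring

theorem normSqA_eq (h : IsMeridian x y w c s κ dw) {q : Par} (hy : 0 < y (q 0)) :
    normSqA (revolve x y) q = (κ (q 0) / w (q 0)) ^ 2 + (c (q 0) / y (q 0)) ^ 2 := by
  have hw := h.w_pos (q 0)
  rw [normSqA, h.metric_inv hy, h.secondForm_eq hy, Matrix.diagonal_mul_diagonal,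
    Matrix.diagonal_mul_diagonal, Matrix.trace_diagonal, Fin.sum_univ_two]
  simp only [Matrix.cons_val_zero, Matrix.cons_val_one]
  field_simp

theorem shrinkerEq_iff (h : IsMeridian x y w c s κ dw) {q : Par} (hy : 0 < y (q 0)) :
    ShrinkerEq (revolve x y) q ↔ κ (q 0) / w (q 0) - c (q 0) / y (q 0) =
      1 / 2 * (x (q 0) * s (q 0) - y (q 0) * c (q 0)) := by
  have h2 := Real.sin_sq_add_cos_sq (q 1)
  rw [ShrinkerEq, h.meanCurvature_eq hy, h.unitNormal_eq hy]
  have e : inner ℝ (revolve x y q)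
      (!₂[s (q 0), -(c (q 0) * cos (q 1)), -(c (q 0) * sin (q 1))] : E3) =
      x (q 0) * s (q 0) - y (q 0) * c (q 0) := by
    simp [revolve, PiLp.inner_apply, Fin.sum_univ_three]
    linear_combination (-y (q 0) * c (q 0)) * h2
  rw [e]

theorem gradInner_eq (h : IsMeridian x y w c s κ dw) {q : Par} (hy : 0 < y (q 0)) (v : Par → ℝ) :
    gradInner (revolve x y) v (fun z => revolve x y z 0) q =
      c (q 0) / w (q 0) * pd 0 v q := by
  have hw := h.w_pos (q 0)
  have hd : DifferentiableAt ℝ (fun z => revolve x y z 0) q := by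
    have := h.contDiff.differentiable (by simp) q
    exact differentiableAt_euclidean.1 this 0
  have e0 : pd 0 (fun z => revolve x y z 0) q = w (q 0) * c (q 0) :=
    pd_zero_eq hd (h.hx _)
  have e1 : pd 1 (fun z => revolve x y z 0) q = 0 := pd_one_eq hd (hasDerivAt_const (q 1) (x (q 0)))
  rw [gradInner, h.metric_inv hy]
  simp only [Fin.sum_univ_two, e0, e1, Matrix.diagonal_apply]
  simp
  field_simp

/-- The stability operator of a surface of revolution. -/
theorem stabilityOp_eq (h : IsMeridian x y w c s κ dw) {q : Par} (hy : 0 < y (q 0)) {v : Par → ℝ}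
    (hv : ContDiff ℝ 2 v) :
    stabilityOp (revolve x y) v q =
      (pd 0 (pd 0 v) q + (w (q 0) * s (q 0) / y (q 0) - dw (q 0) / w (q 0)) * pd 0 v q) /
        w (q 0) ^ 2 +
      pd 1 (pd 1 v) q / y (q 0) ^ 2 +
      ((κ (q 0) / w (q 0)) ^ 2 + (c (q 0) / y (q 0)) ^ 2) * v q -
      1 / 2 * ((x (q 0) * c (q 0) + y (q 0) * s (q 0)) / w (q 0) * pd 0 v q - v q) := by
  have hw := h.w_pos (q 0)
  have h2 := Real.sin_sq_add_cos_sq (q 1)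
  have hv1 : ∀ i, Differentiable ℝ (pd i v) := fun i =>
    (contDiff_pd (m := 1) hv (by norm_num) i).differentiable (by simp)
  have hcont : Continuous fun z : Par => y (z 0) :=
    h.smooth_y.continuous.comp (continuous_apply 0)
  have hev : ∀ᶠ z in nhds q, 0 < y (z 0) := (isOpen_lt continuous_const hcont).mem_nhds hy
  have hpos : positionGrad (revolve x y) v q =
      (x (q 0) * c (q 0) + y (q 0) * s (q 0)) / w (q 0) * pd 0 v q := by
    rw [positionGrad, h.metric_inv hy]
    simp only [Fin.sum_univ_two, Matrix.diagonal_apply, h.pd_zero, h.pd_one]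
    simp [revolve, PiLp.inner_apply, Fin.sum_univ_three]
    field_simp
    linear_combination (y (q 0) * s (q 0) * pd 0 v q) * h2
  have hlap : laplaceBeltrami (revolve x y) v q = (w (q 0) * y (q 0))⁻¹ *
      (((w (q 0) * s (q 0) * w (q 0) - y (q 0) * dw (q 0)) / w (q 0) ^ 2 * pd 0 v q +
        y (q 0) / w (q 0) * pd 0 (pd 0 v) q) + w (q 0) / y (q 0) * pd 1 (pd 1 v) q) := by
    rw [laplaceBeltrami, h.sqrt_det hy, Fin.sum_univ_two]
    congr 2
    · have e : (fun z => √(metric (revolve x y) z).det *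
          ∑ j, (metric (revolve x y) z)⁻¹ 0 j * pd j v z) =ᶠ[nhds q]
          fun z => y (z 0) / w (z 0) * pd 0 v z := by
        filter_upwards [hev] with z hz
        have := h.w_pos (z 0)
        rw [h.sqrt_det hz, h.metric_inv hz]
        simp [Matrix.diagonal_apply]
        field_simp
      rw [pd_congr e]
      have hd0 : DifferentiableAt ℝ (fun z : Par => y (z 0) / w (z 0)) q := by
        have hz : DifferentiableAt ℝ (fun z : Par => z 0) q := differentiableAt_apply 0 q
        have d1 : DifferentiableAt ℝ (fun z : Par => y (z 0)) q :=
          DifferentiableAt.comp q (g := y) (h.hy (q 0)).differentiableAt hz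
        have d2 : DifferentiableAt ℝ (fun z : Par => w (z 0)) q :=
          DifferentiableAt.comp q (g := w) (h.hw (q 0)).differentiableAt hz
        simp only [div_eq_mul_inv]; exact d1.fun_mul (d2.fun_inv hw.ne')
      have h3 := hasDerivAt_pd_zero (t := q 0) (θ := q 1) (hv1 0 _)
      rw [par_eta] at h3
      have h4 := ((h.hy (q 0)).div (h.hw (q 0)) hw.ne').mul h3
      rw [par_eta] at h4
      exact pd_zero_eq (hd0.mul (hv1 0 q)) h4
    · have e : (fun z => √(metric (revolve x y) z).det *
          ∑ j, (metric (revolve x y) z)⁻¹ 1 j * pd j v z) =ᶠ[nhds q]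
          fun z => w (z 0) / y (z 0) * pd 1 v z := by
        filter_upwards [hev] with z hz
        have := h.w_pos (z 0)
        rw [h.sqrt_det hz, h.metric_inv hz]
        simp [Matrix.diagonal_apply]
        field_simp
      rw [pd_congr e]
      have hd0 : DifferentiableAt ℝ (fun z : Par => w (z 0) / y (z 0)) q := by
        have hz : DifferentiableAt ℝ (fun z : Par => z 0) q := differentiableAt_apply 0 q
        have d1 : DifferentiableAt ℝ (fun z : Par => w (z 0)) q :=
          DifferentiableAt.comp q (g := w) (h.hw (q 0)).differentiableAt hz
        have d2 : DifferentiableAt ℝ (fun z : Par => y (z 0)) q :=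
          DifferentiableAt.comp q (g := y) (h.hy (q 0)).differentiableAt hz
        simp only [div_eq_mul_inv]; exact d1.fun_mul (d2.fun_inv hy.ne')
      have h3 := hasDerivAt_pd_one (t := q 0) (θ := q 1) (hv1 1 _)
      rw [par_eta] at h3
      exact pd_one_eq (hd0.mul (hv1 1 q)) (h3.const_mul (w (q 0) / y (q 0)))
  rw [stabilityOp, hlap, h.normSqA_eq hy, hpos]
  field_simp
  ring

theorem isPatch (h : IsMeridian x y w c s κ dw) {I : Set ℝ} (hI : IsOpen I)
    (hy : ∀ t ∈ I, 0 < y t) {S : Set E3} (hS : ∀ q : Par, q 0 ∈ I → revolve x y q ∈ S) :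
    IsPatch (revolve x y) {q | q 0 ∈ I} S where
  isOpen := hI.preimage (continuous_apply 0)
  smooth := h.contDiff.contDiffOn
  regular q hq := by
    have hw := h.w_pos (q 0)
    have hyq := hy (q 0) hq
    rw [LinearIndependent.pair_iff]
    intro a b hab
    have m := h.metric_eq q
    have m00 : inner ℝ (pd 0 (revolve x y) q) (pd 0 (revolve x y) q) = w (q 0) ^ 2 := by
      exact congrFun (congrFun m 0) 0
    have m10 : inner ℝ (pd 0 (revolve x y) q) (pd 1 (revolve x y) q) = 0 := by
      exact congrFun (congrFun m 0) 1
    have m01 : inner ℝ (pd 1 (revolve x y) q) (pd 0 (revolve x y) q) = 0 := by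
      exact congrFun (congrFun m 1) 0
    have m11 : inner ℝ (pd 1 (revolve x y) q) (pd 1 (revolve x y) q) = y (q 0) ^ 2 := by
      exact congrFun (congrFun m 1) 1
    have h0 := congrArg (inner ℝ (pd 0 (revolve x y) q)) hab
    have h1 := congrArg (inner ℝ (pd 1 (revolve x y) q)) hab
    rw [inner_add_right, inner_smul_right, inner_smul_right, inner_zero_right, m00, m10] at h0
    rw [inner_add_right, inner_smul_right, inner_smul_right, inner_zero_right, m01, m11] at h1
    simp [hw.ne', hyq.ne'] at h0 h1
    exact ⟨h0, h1⟩
  mapsTo q hq := hS q hq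

end IsMeridian

/-! ### Fourier decomposition in the angular variable -/

/-- A continuous function with period `L` vanishes if its Fourier coefficients do. -/
theorem eq_zero_of_fourier {g : ℝ → ℝ} (hg : Continuous g) {L : ℝ} (hL : 0 < L)
    (hper : Function.Periodic g L)
    (hc : ∀ n : ℕ, ∫ θ in 0..L, g θ * cos (2 * π * n / L * θ) = 0)
    (hs : ∀ n : ℕ, ∫ θ in 0..L, g θ * sin (2 * π * n / L * θ) = 0) (θ : ℝ) : g θ = 0 := by
  have : Fact (0 < L) := ⟨hL⟩
  have hc' : ∀ n : ℤ, ∫ θ in 0..L, g θ * cos (2 * π * n / L * θ) = 0 := fun n => by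
    obtain ⟨k, rfl | rfl⟩ := n.eq_nat_or_neg
    · exact_mod_cast hc k
    · have e : ∀ θ : ℝ, g θ * cos (2 * π * ((-(k : ℤ) : ℤ) : ℝ) / L * θ) =
          g θ * cos (2 * π * k / L * θ) := fun θ => by
        rw [← Real.cos_neg (2 * π * k / L * θ)]; congr 2; push_cast; ring
      simp only [e]
      exact hc k
  have hs' : ∀ n : ℤ, ∫ θ in 0..L, g θ * sin (2 * π * n / L * θ) = 0 := fun n => by
    obtain ⟨k, rfl | rfl⟩ := n.eq_nat_or_neg
    · exact_mod_cast hs k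
    · have e : ∀ θ : ℝ, g θ * sin (2 * π * ((-(k : ℤ) : ℤ) : ℝ) / L * θ) =
          -(g θ * sin (2 * π * k / L * θ)) := fun θ => by
        rw [← mul_neg, ← Real.sin_neg]; congr 2; push_cast; ring
      simp only [e, intervalIntegral.integral_neg, hs k, neg_zero]
  have hper' : Function.Periodic (fun θ => (g θ : ℂ)) L := fun θ => by
    simp only [hper θ]
  let f : C(AddCircle L, ℂ) := ⟨hper'.lift,
    continuous_quot_lift _ (Complex.continuous_ofReal.comp hg)⟩
  have hf : ∀ θ : ℝ, f (θ : AddCircle L) = g θ := fun θ => hper'.lift_coe θ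
  have hcoeff : fourierCoeff f = 0 := by
    funext n
    rw [fourierCoeff_eq_intervalIntegral f n 0, zero_add]
    have e : ∀ θ : ℝ, fourier (-n) (θ : AddCircle L) • f (θ : AddCircle L) =
        ((g θ * cos (2 * π * n / L * θ) : ℝ) : ℂ) -
          Complex.I * ((g θ * sin (2 * π * n / L * θ) : ℝ) : ℂ) := fun θ => by
      rw [fourier_coe_apply, hf]
      have e1 : 2 * (π : ℂ) * Complex.I * ((-n : ℤ) : ℂ) * (θ : ℂ) / (L : ℂ) =
          ((-(2 * π * n / L * θ) : ℝ) : ℂ) * Complex.I := by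
        push_cast; ring
      rw [e1, Complex.exp_mul_I, ← Complex.ofReal_cos, ← Complex.ofReal_sin, Real.cos_neg,
        Real.sin_neg]
      push_cast; simp only [smul_eq_mul]; ring
    have cc : Continuous fun θ : ℝ => cos (2 * π * n / L * θ) :=
      Real.continuous_cos.comp (continuous_const.mul continuous_id)
    have cs : Continuous fun θ : ℝ => sin (2 * π * n / L * θ) :=
      Real.continuous_sin.comp (continuous_const.mul continuous_id)
    simp only [e]
    rw [intervalIntegral.integral_sub, intervalIntegral.integral_const_mul,
      intervalIntegral.integral_ofReal, intervalIntegral.integral_ofReal, hc' n, hs' n]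
    · simp
    · exact (Complex.continuous_ofReal.comp (hg.mul cc)).intervalIntegrable _ _
    · exact (continuous_const.mul
        (Complex.continuous_ofReal.comp (hg.mul cs))).intervalIntegrable _ _
  have hsum := hasSum_fourier_series_of_summable (f := f) (by
    rw [hcoeff]; exact summable_zero)
  have h0 : f = 0 := by
    refine hsum.unique ?_
    simp only [hcoeff, Pi.zero_apply, zero_smul]
    exact hasSum_zero
  have := hf θ
  rw [h0] at this
  have h1 : (g θ : ℂ) = 0 := by simpa using this.symm
  exact_mod_cast h1

/-- The Fourier coefficient, with respect to `φ`, of the restriction of `v` to a circle. -/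
def mode (L : ℝ) (φ : ℝ → ℝ) (v : Par → ℝ) (t : ℝ) : ℝ := ∫ θ in 0..L, v ![t, θ] * φ θ

theorem continuous_par : Continuous fun p : ℝ × ℝ => (![p.1, p.2] : Par) := by
  refine continuous_pi fun i => ?_
  fin_cases i
  · exact continuous_fst
  · exact continuous_snd

theorem hasDerivAt_mode {L : ℝ} {φ : ℝ → ℝ} (hφ : Continuous φ) {v : Par → ℝ}
    (hv : ContDiff ℝ 1 v) (t : ℝ) : HasDerivAt (mode L φ v) (mode L φ (pd 0 v) t) t := by
  have hd : Differentiable ℝ v := hv.differentiable (by simp)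
  have hpc : Continuous (pd 0 v) := (contDiff_pd (m := 0) hv (by simp) 0).continuous
  have hF : Continuous fun p : ℝ × ℝ => v ![p.1, p.2] * φ p.2 :=
    (hv.continuous.comp continuous_par).mul (hφ.comp continuous_snd)
  have hF' : Continuous fun p : ℝ × ℝ => pd 0 v ![p.1, p.2] * φ p.2 :=
    (hpc.comp continuous_par).mul (hφ.comp continuous_snd)
  obtain ⟨C, hC⟩ := (isCompact_Icc.prod isCompact_uIcc :
    IsCompact (Icc (t - 1) (t + 1) ×ˢ uIcc 0 L)).exists_bound_of_continuousOn hF'.continuousOn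
  have sec : ∀ {G : ℝ × ℝ → ℝ}, Continuous G → ∀ t, Continuous fun θ => G (t, θ) :=
    fun hG t => hG.comp (continuous_const.prodMk continuous_id)
  refine (intervalIntegral.hasDerivAt_integral_of_dominated_loc_of_deriv_le
    (F := fun t θ => v ![t, θ] * φ θ) (F' := fun t θ => pd 0 v ![t, θ] * φ θ)
    (s := Icc (t - 1) (t + 1)) (bound := fun _ => C)
    (Icc_mem_nhds (by linarith) (by linarith))
    (Filter.Eventually.of_forall fun t => (sec hF t).aestronglyMeasurable)
    ((sec hF t).intervalIntegrable _ _) (sec hF' t).aestronglyMeasurable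
    (Filter.Eventually.of_forall fun θ hθ t ht => hC (t, θ) ⟨ht, uIoc_subset_uIcc hθ⟩)
    intervalIntegrable_const (Filter.Eventually.of_forall fun θ _ t _ => ?_)).2
  exact (hasDerivAt_pd_zero (hd _)).mul_const (φ θ)

/-- Integration by parts, twice, for a frequency `m` that is compatible with the period `L`. -/
theorem mode_pd_one_one {L m : ℝ} {φ φ' : ℝ → ℝ} (hφ : ∀ θ, HasDerivAt φ (φ' θ) θ)
    (hφ' : ∀ θ, HasDerivAt φ' (-(m ^ 2 * φ θ)) θ) (h0 : φ L = φ 0) (h0' : φ' L = φ' 0)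
    {v : Par → ℝ} (hv : ContDiff ℝ 2 v) {t : ℝ} (hper : ∀ θ, v ![t, θ + L] = v ![t, θ]) :
    mode L φ (pd 1 (pd 1 v)) t = -(m ^ 2 * mode L φ v t) := by
  have hc : Continuous φ := continuous_iff_continuousAt.2 fun θ => (hφ θ).continuousAt
  have hc' : Continuous φ' := continuous_iff_continuousAt.2 fun θ => (hφ' θ).continuousAt
  have hv1 : ContDiff ℝ 1 (pd 1 v) := contDiff_pd hv (by norm_num) 1
  have hv2 : Continuous (pd 1 (pd 1 v)) := (contDiff_pd (m := 0) hv1 (by simp) 1).continuous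
  have d1 : ∀ θ, HasDerivAt (fun θ => v ![t, θ]) (pd 1 v ![t, θ]) θ := fun θ =>
    hasDerivAt_pd_one (hv.differentiable (by simp) _)
  have d2 : ∀ θ, HasDerivAt (fun θ => pd 1 v ![t, θ]) (pd 1 (pd 1 v) ![t, θ]) θ := fun θ =>
    hasDerivAt_pd_one (hv1.differentiable (by simp) _)
  have sec : ∀ {G : Par → ℝ}, Continuous G → Continuous fun θ => G ![t, θ] :=
    fun hG => hG.comp (continuous_par.comp (continuous_const.prodMk continuous_id))
  have hper' : pd 1 v ![t, L] = pd 1 v ![t, 0] := by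
    have h1 := (d1 (0 + L)).comp_add_const 0 L
    simp only [hper, zero_add] at h1
    exact h1.unique (d1 0)
  have hperv : v ![t, L] = v ![t, 0] := by simpa using hper 0
  have i1 := intervalIntegral.integral_mul_deriv_eq_deriv_mul (a := 0) (b := L)
    (u := φ) (u' := φ') (v := fun θ => pd 1 v ![t, θ]) (v' := fun θ => pd 1 (pd 1 v) ![t, θ])
    (fun θ _ => hφ θ) (fun θ _ => d2 θ) (hc'.intervalIntegrable _ _)
    ((sec hv2).intervalIntegrable _ _)
  have i2 := intervalIntegral.integral_mul_deriv_eq_deriv_mul (a := 0) (b := L)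
    (u := φ') (u' := fun θ => -(m ^ 2 * φ θ)) (v := fun θ => v ![t, θ])
    (v' := fun θ => pd 1 v ![t, θ])
    (fun θ _ => hφ' θ) (fun θ _ => d1 θ) ((continuous_const.mul hc).neg.intervalIntegrable _ _)
    ((sec hv1.continuous).intervalIntegrable _ _)
  simp only [h0, h0', hper', hperv, sub_self, zero_sub] at i1 i2
  have e1 : mode L φ (pd 1 (pd 1 v)) t = ∫ θ in 0..L, φ θ * pd 1 (pd 1 v) ![t, θ] := by
    unfold mode; congr 1; funext θ; ring
  have e2 : ∫ θ in 0..L, -(m ^ 2 * φ θ) * v ![t, θ] = -(m ^ 2 * mode L φ v t) := by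
    unfold mode
    rw [← intervalIntegral.integral_const_mul, ← intervalIntegral.integral_neg]
    congr 1; funext θ; ring
  rw [e1, i1, i2, e2]; ring

/-- A function which is invariant under the rotation by `2 π / N`, and which solves a linear
equation whose coefficients do not depend on the angle, vanishes as soon as its Fourier modes do,
which solve ordinary differential equations. Only the modes whose frequency is a multiple of `N`
occur. The sets `EN` and `ED` are the places where Neumann and Dirichlet conditions hold. -/
theorem eq_zero_of_modes {v : Par → ℝ} (hv : ContDiff ℝ 2 v) {I EN ED : Set ℝ} {N : ℕ} (hN : 0 < N)
    (hper : ∀ t ∈ I, ∀ θ, v ![t, θ + 2 * π / N] = v ![t, θ]) {A B C D : ℝ → ℝ}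
    (heq : ∀ q : Par, q 0 ∈ I → A (q 0) * pd 0 (pd 0 v) q + B (q 0) * pd 0 v q + C (q 0) * v q +
      D (q 0) * pd 1 (pd 1 v) q = 0)
    (hEN : ∀ t ∈ EN, ∀ θ, pd 0 v ![t, θ] = 0) (hED : ∀ t ∈ ED, ∀ θ, v ![t, θ] = 0)
    (hmode : ∀ (n : ℕ) (f f₁ f₂ : ℝ → ℝ), (∀ t, HasDerivAt f (f₁ t) t) →
      (∀ t, HasDerivAt f₁ (f₂ t) t) →
      (∀ t ∈ I, A t * f₂ t + B t * f₁ t + (C t - ((n : ℝ) * N) ^ 2 * D t) * f t = 0) →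
      (∀ t ∈ EN, f₁ t = 0) → (∀ t ∈ ED, f t = 0) → ∀ t ∈ I, f t = 0) :
    ∀ q : Par, q 0 ∈ I → v q = 0 := by
  have hN' : (0 : ℝ) < N := by exact_mod_cast hN
  set L : ℝ := 2 * π / N with hL
  have hL0 : 0 < L := by have := Real.pi_pos; positivity
  have hv1 : ∀ i, ContDiff ℝ 1 (pd i v) := fun i => contDiff_pd hv (by norm_num) i
  have hv2 : ∀ i j, Continuous (pd i (pd j v)) := fun i j =>
    (contDiff_pd (m := 0) (hv1 j) (by simp) i).continuous
  have key : ∀ (n : ℕ) (φ φ' : ℝ → ℝ), (∀ θ, HasDerivAt φ (φ' θ) θ) →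
      (∀ θ, HasDerivAt φ' (-(((n : ℝ) * N) ^ 2 * φ θ)) θ) → φ L = φ 0 → φ' L = φ' 0 →
      ∀ t ∈ I, mode L φ v t = 0 := by
    intro n φ φ' hφ hφ' h0 h0'
    have hc : Continuous φ := continuous_iff_continuousAt.2 fun θ => (hφ θ).continuousAt
    refine hmode n (mode L φ v) (mode L φ (pd 0 v)) (mode L φ (pd 0 (pd 0 v)))
      (hasDerivAt_mode hc (hv.of_le (by norm_num))) (hasDerivAt_mode hc (hv1 0)) ?_ ?_ ?_
    · intro t ht
      have h1 := mode_pd_one_one hφ hφ' h0 h0' hv (hper t ht)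
      have int : ∀ {G : Par → ℝ}, Continuous G →
          IntervalIntegrable (fun θ => G ![t, θ] * φ θ) MeasureTheory.volume 0 L := fun hG =>
        ((hG.comp (continuous_par.comp (continuous_const.prodMk continuous_id))).mul
          hc).intervalIntegrable _ _
      have h2 : ∫ θ in 0..L, (A t * (pd 0 (pd 0 v) ![t, θ] * φ θ) + B t * (pd 0 v ![t, θ] * φ θ) +
          C t * (v ![t, θ] * φ θ) + D t * (pd 1 (pd 1 v) ![t, θ] * φ θ)) = 0 := by
        refine (intervalIntegral.integral_congr (g := fun _ => (0 : ℝ)) fun θ _ => ?_).trans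
          (by simp)
        have := heq ![t, θ] ht
        simp only [Matrix.cons_val_zero] at this
        linear_combination φ θ * this
      rw [intervalIntegral.integral_add, intervalIntegral.integral_add,
        intervalIntegral.integral_add, intervalIntegral.integral_const_mul,
        intervalIntegral.integral_const_mul, intervalIntegral.integral_const_mul,
        intervalIntegral.integral_const_mul] at h2
      · change A t * mode L φ (pd 0 (pd 0 v)) t + B t * mode L φ (pd 0 v) t + C t * mode L φ v t +
          D t * mode L φ (pd 1 (pd 1 v)) t = 0 at h2
        rw [h1] at h2
        linear_combination h2
      · exact (int (hv2 0 0)).const_mul _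
      · exact (int (hv1 0).continuous).const_mul _
      · exact ((int (hv2 0 0)).const_mul _).add ((int (hv1 0).continuous).const_mul _)
      · exact (int hv.continuous).const_mul _
      · exact (((int (hv2 0 0)).const_mul _).add ((int (hv1 0).continuous).const_mul _)).add
          ((int hv.continuous).const_mul _)
      · exact (int (hv2 1 1)).const_mul _
    · intro t ht; simp [mode, hEN t ht]
    · intro t ht; simp [mode, hED t ht]
  have hfreq : ∀ n : ℕ, 2 * π * n / L = n * N := fun n => by
    rw [hL]; field_simp
  have hend : ∀ n : ℕ, (n : ℝ) * N * L = n * (2 * π) := fun n => by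
    rw [hL]; field_simp
  have lin : ∀ (n : ℕ) (θ : ℝ), HasDerivAt (fun θ => (n : ℝ) * N * θ) (n * N) θ := fun n θ => by
    simpa using (hasDerivAt_id θ).const_mul ((n : ℝ) * N)
  have dcos : ∀ (n : ℕ) (θ : ℝ), HasDerivAt (fun θ => cos (n * N * θ))
      (-sin (n * N * θ) * (n * N)) θ := fun n θ => (lin n θ).cos
  have dsin : ∀ (n : ℕ) (θ : ℝ), HasDerivAt (fun θ => sin (n * N * θ))
      (cos (n * N * θ) * (n * N)) θ := fun n θ => (lin n θ).sin
  intro q hq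
  have := eq_zero_of_fourier (g := fun θ => v ![q 0, θ])
    (hv.continuous.comp (continuous_par.comp (continuous_const.prodMk continuous_id))) hL0
    (fun θ => hper _ hq θ) (fun n => ?_) (fun n => ?_) (q 1)
  · rwa [par_eta] at this
  · rw [hfreq]
    refine key n (fun θ => cos (n * N * θ)) (fun θ => -sin (n * N * θ) * (n * N)) (dcos n)
      (fun θ => ((dsin n θ).neg.mul_const _).congr_deriv (by ring)) ?_ ?_ (q 0) hq
    · simp only [hend, mul_zero, Real.cos_zero, Real.cos_nat_mul_two_pi]
    · simp only [hend, mul_zero, Real.sin_zero]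
      have e : sin (n * (2 * π)) = 0 := by
        have := Real.sin_nat_mul_pi (2 * n)
        push_cast at this; rw [← this]; congr 1; ring
      rw [e]
  · rw [hfreq]
    refine key n (fun θ => sin (n * N * θ)) (fun θ => cos (n * N * θ) * (n * N)) (dsin n)
      (fun θ => ((dcos n θ).mul_const _).congr_deriv (by ring)) ?_ ?_ (q 0) hq
    · simp only [hend, mul_zero, Real.sin_zero]
      have := Real.sin_nat_mul_pi (2 * n)
      push_cast at this; rw [← this]; congr 1; ring
    · simp only [hend, mul_zero, Real.cos_zero, Real.cos_nat_mul_two_pi]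

/-! ### Energy identities -/

/-- A solution of `(p h')' = R h`, with `p` and `R` positive, vanishes if `p h h'` does at both ends:
this product is monotone. -/
theorem eq_zero_of_energy {a b : ℝ} {h A p R : ℝ → ℝ}
    (hh : ∀ t ∈ Ioo a b, HasDerivAt h (A t / p t) t)
    (hA : ∀ t ∈ Ioo a b, HasDerivAt A (R t * h t) t)
    (hp : ∀ t ∈ Ioo a b, 0 < p t) (hR : ∀ t ∈ Ioo a b, 0 < R t)
    (hc : ContinuousOn (fun t => h t * A t) (Icc a b)) (ha : h a * A a = 0) (hb : h b * A b = 0) :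
    ∀ t ∈ Ioo a b, h t = 0 := by
  have hd : ∀ t ∈ Ioo a b, HasDerivAt (fun t => h t * A t) (A t ^ 2 / p t + R t * h t ^ 2) t :=
    fun t ht => ((hh t ht).mul (hA t ht)).congr_deriv (by ring)
  have hmono : MonotoneOn (fun t => h t * A t) (Icc a b) := by
    refine monotoneOn_of_deriv_nonneg (convex_Icc a b) hc (fun t ht => ?_) fun t ht => ?_
    · rw [interior_Icc] at ht
      exact (hd t ht).differentiableAt.differentiableWithinAt
    · rw [interior_Icc] at ht
      rw [(hd t ht).deriv]
      have := hp t ht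
      have := hR t ht
      positivity
  have hzero : ∀ t ∈ Icc a b, h t * A t = 0 := fun t ht => by
    have hab := ht.1.trans ht.2
    have h1 := hmono (left_mem_Icc.2 hab) ht ht.1
    have h2 := hmono ht (right_mem_Icc.2 hab) ht.2
    simp only [ha, hb] at h1 h2
    exact le_antisymm h2 h1
  intro t ht
  have h1 : HasDerivAt (fun t => h t * A t) 0 t := by
    refine (hasDerivAt_const t (0 : ℝ)).congr_of_eventuallyEq ?_
    filter_upwards [Ioo_mem_nhds ht.1 ht.2] with s hs
    exact hzero s (Ioo_subset_Icc_self hs)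
  have h2 := (hd t ht).unique h1
  have h3 : 0 ≤ A t ^ 2 / p t := by have := hp t ht; positivity
  have h4 := hR t ht
  have h5 : R t * h t ^ 2 = 0 := le_antisymm (by linarith) (by positivity)
  rcases mul_eq_zero.1 h5 with h6 | h6
  · exact absurd h6 h4.ne'
  · exact pow_eq_zero_iff (two_ne_zero) |>.1 h6

/-- If the equation `f'' + B f' + V f = 0` has a positive strict supersolution `w` on an interval,
then a solution `f` for which `p f (f' w - f w')` vanishes at the two ends is zero, where `p` is the
integrating factor. -/
theorem eq_zero_of_supersolution {a b : ℝ} {f f₁ f₂ w w₁ w₂ p B V : ℝ → ℝ}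
    (hf : ∀ t, HasDerivAt f (f₁ t) t) (hf₁ : ∀ t, HasDerivAt f₁ (f₂ t) t)
    (hw : ∀ t, HasDerivAt w (w₁ t) t) (hw₁ : ∀ t, HasDerivAt w₁ (w₂ t) t)
    (hpc : Continuous p) (hp : ∀ t ∈ Ioo a b, HasDerivAt p (p t * B t) t)
    (p_pos : ∀ t ∈ Ioo a b, 0 < p t) (w_pos : ∀ t ∈ Icc a b, 0 < w t)
    (hsol : ∀ t ∈ Ioo a b, f₂ t + B t * f₁ t + V t * f t = 0)
    (hsup : ∀ t ∈ Ioo a b, w₂ t + B t * w₁ t + V t * w t < 0)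
    (ha : p a * f a * (f₁ a * w a - f a * w₁ a) = 0)
    (hb : p b * f b * (f₁ b * w b - f b * w₁ b) = 0) : ∀ t ∈ Ioo a b, f t = 0 := by
  have cf : Continuous f := continuous_iff_continuousAt.2 fun t => (hf t).continuousAt
  have cf₁ : Continuous f₁ := continuous_iff_continuousAt.2 fun t => (hf₁ t).continuousAt
  have cw : Continuous w := continuous_iff_continuousAt.2 fun t => (hw t).continuousAt
  have cw₁ : Continuous w₁ := continuous_iff_continuousAt.2 fun t => (hw₁ t).continuousAt
  have key := eq_zero_of_energy (a := a) (b := b) (h := fun t => f t / w t)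
    (A := fun t => p t * (f₁ t * w t - f t * w₁ t)) (p := fun t => p t * w t ^ 2)
    (R := fun t => p t * w t * -(w₂ t + B t * w₁ t + V t * w t)) ?_ ?_ ?_ ?_ ?_ ?_ ?_
  · intro t ht
    have h1 := (div_eq_zero_iff.1 (key t ht)).resolve_right
      (w_pos t (Ioo_subset_Icc_self ht)).ne'
    exact h1
  · intro t ht
    have h1 := w_pos t (Ioo_subset_Icc_self ht)
    have h2 := p_pos t ht
    refine ((hf t).div (hw t) h1.ne').congr_deriv ?_
    field_simp
  · intro t ht
    have h1 := w_pos t (Ioo_subset_Icc_self ht)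
    refine ((hp t ht).fun_mul (((hf₁ t).fun_mul (hw t)).fun_sub
      ((hf t).fun_mul (hw₁ t)))).congr_deriv ?_
    have e : p t * w t * -(w₂ t + B t * w₁ t + V t * w t) * (f t / w t) =
        -(p t * (w₂ t + B t * w₁ t + V t * w t) * f t) := by field_simp
    rw [e]
    linear_combination p t * w t * hsol t ht
  · intro t ht
    have h1 := w_pos t (Ioo_subset_Icc_self ht)
    have h2 := p_pos t ht
    positivity
  · intro t ht
    have h1 := w_pos t (Ioo_subset_Icc_self ht)
    have h2 := p_pos t ht
    have h3 := hsup t ht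
    have h4 : 0 < -(w₂ t + B t * w₁ t + V t * w t) := by linarith
    positivity
  · refine ContinuousOn.mul (cf.continuousOn.div cw.continuousOn fun t ht => (w_pos t ht).ne') ?_
    exact (hpc.mul ((cf₁.mul cw).sub (cf.mul cw₁))).continuousOn
  · linear_combination (w a)⁻¹ * ha
  · linear_combination (w b)⁻¹ * hb

theorem eq_zero_on_Icc {a b : ℝ} (hab : a < b) {f f₁ : ℝ → ℝ} (hf : ∀ t, HasDerivAt f (f₁ t) t)
    (hc : Continuous f₁) (h0 : ∀ t ∈ Ioo a b, f t = 0) :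
    ∀ t ∈ Icc a b, f t = 0 ∧ f₁ t = 0 := by
  have cf : Continuous f := continuous_iff_continuousAt.2 fun t => (hf t).continuousAt
  have h1 : ∀ t ∈ Ioo a b, f₁ t = 0 := fun t ht => by
    refine (hf t).unique ((hasDerivAt_const t (0 : ℝ)).congr_of_eventuallyEq ?_)
    filter_upwards [Ioo_mem_nhds ht.1 ht.2] with s hs
    exact h0 s hs
  have ext : ∀ {g : ℝ → ℝ}, Continuous g → (∀ t ∈ Ioo a b, g t = 0) → ∀ t ∈ Icc a b, g t = 0 := by
    intro g hg h t ht
    rw [← closure_Ioo hab.ne] at ht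
    exact closure_minimal (fun t ht => h t ht) (isClosed_singleton.preimage hg) ht
  exact fun t ht => ⟨ext cf h0 t ht, ext hc h1 t ht⟩

/-! ### Pieces of surfaces of revolution -/

theorem rot_revolve (x y : ℝ → ℝ) (L t θ : ℝ) :
    rot L (revolve x y ![t, θ]) = revolve x y ![t, θ + L] := by
  ext i
  fin_cases i <;> simp [rot, revolve, Real.cos_add, Real.sin_add] <;> ring

theorem continuous_revolve {x y : ℝ → ℝ} (hx : Continuous x) (hy : Continuous y) :
    Continuous (revolve x y) := by
  refine (PiLp.continuous_toLp 2 _).comp (continuous_pi fun i => ?_)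
  have h0 : Continuous fun q : Par => q 0 := continuous_apply 0
  have h1 : Continuous fun q : Par => q 1 := continuous_apply 1
  fin_cases i
  · exact hx.comp h0
  · exact (hy.comp h0).mul (Real.continuous_cos.comp h1)
  · exact (hy.comp h0).mul (Real.continuous_sin.comp h1)

theorem mem_of_Icc {X : Type*} [TopologicalSpace X] {G : Par → X} (hG : Continuous G) {a b : ℝ}
    (hab : a < b) {S : Set X} (hS : ∀ q : Par, q 0 ∈ Ioo a b → G q ∈ S) {q : Par}
    (hq : q 0 ∈ Icc a b) : G q ∈ closure S := by
  rw [← par_eta q]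
  rw [← closure_Ioo hab.ne] at hq
  refine map_mem_closure (f := fun t => G ![t, q 1])
    (hG.comp (continuous_par.comp (continuous_id.prodMk continuous_const))) hq fun t ht => ?_
  exact hS _ ht

namespace IsMeridian
variable {x y w c s κ dw : ℝ → ℝ}

theorem pd_zero_eq_zero_of_neumann (h : IsMeridian x y w c s κ dw) {I : Set ℝ} (hI : IsOpen I)
    (hy : ∀ t ∈ I, 0 < y t) {M B : Set E3} (hM : ∀ q : Par, q 0 ∈ I → revolve x y q ∈ M)
    {u : E3 → ℝ} (hu : NeumannOn M B u) {q : Par} (hq : q 0 ∈ I) (hB : revolve x y q ∈ B)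
    (hc : c (q 0) ≠ 0) : pd 0 (u ∘ revolve x y) q = 0 := by
  have h1 := hu _ _ (h.isPatch hI hy hM) q hq hB
  rw [h.gradInner_eq (hy _ hq)] at h1
  exact (mul_eq_zero.1 h1).resolve_left (div_ne_zero hc (h.w_pos _).ne')

/-- The Jacobi equation on a piece of a surface of revolution, between two parallels, reduces to
the ordinary differential equations for the Fourier modes. -/
theorem eq_zero_on_piece (h : IsMeridian x y w c s κ dw) {a b : ℝ} (hab : a < b)
    (hy : ∀ t ∈ Ioo a b, 0 < y t) {S : Set E3} (hS : ∀ q : Par, q 0 ∈ Ioo a b → revolve x y q ∈ S)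
    {u : E3 → ℝ} (hu : ContDiff ℝ 2 u) {N : ℕ} (hN : 0 < N)
    (hrot : ∀ p ∈ S, u (rot (2 * π / N) p) = u p) (hJ : JacobiOn S u) {EN ED : Set ℝ}
    (hEN : ∀ t ∈ EN, ∀ θ, pd 0 (u ∘ revolve x y) ![t, θ] = 0)
    (hED : ∀ t ∈ ED, ∀ θ, u (revolve x y ![t, θ]) = 0)
    (hmode : ∀ (n : ℕ) (f f₁ f₂ : ℝ → ℝ), (∀ t, HasDerivAt f (f₁ t) t) →
      (∀ t, HasDerivAt f₁ (f₂ t) t) →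
      (∀ t ∈ Ioo a b, f₂ t +
        (w t * s t / y t - dw t / w t - w t * (x t * c t + y t * s t) / 2) * f₁ t +
        (w t ^ 2 * ((κ t / w t) ^ 2 + (c t / y t) ^ 2 + 1 / 2) -
          ((n : ℝ) * N) ^ 2 * (w t / y t) ^ 2) * f t = 0) →
      (∀ t ∈ EN, f₁ t = 0) → (∀ t ∈ ED, f t = 0) → ∀ t ∈ Ioo a b, f t = 0) :
    ∀ q : Par, q 0 ∈ Icc a b → u (revolve x y q) = 0 := by
  have hv : ContDiff ℝ 2 (u ∘ revolve x y) := hu.comp (h.contDiff.of_le (by norm_cast))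
  have hS' : ∀ q : Par, q 0 ∈ Ioo a b → revolve x y q ∈ S := hS
  have key := eq_zero_of_modes hv (I := Ioo a b) (EN := EN) (ED := ED) hN
    (A := fun _ => 1)
    (B := fun t => w t * s t / y t - dw t / w t - w t * (x t * c t + y t * s t) / 2)
    (C := fun t => w t ^ 2 * ((κ t / w t) ^ 2 + (c t / y t) ^ 2 + 1 / 2))
    (D := fun t => (w t / y t) ^ 2) ?_ ?_ hEN hED ?_
  · intro q hq
    have := mem_of_Icc hv.continuous hab (S := {0}) (fun q hq => key q hq) hq
    rwa [closure_singleton] at this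
  · intro t ht θ
    have := hrot _ (hS ![t, θ] ht)
    rwa [rot_revolve] at this
  · intro q hq
    have hw := h.w_pos (q 0)
    have hyq := hy _ hq
    have h1 := hJ _ _ (h.isPatch isOpen_Ioo hy hS') q hq
    rw [h.stabilityOp_eq hyq hv] at h1
    refine Eq.trans ?_ ((congrArg (fun z => w (q 0) ^ 2 * z) h1).trans (mul_zero _))
    field_simp
    ring
  · intro n f f₁ f₂ h1 h2 h3 h4 h5
    refine hmode n f f₁ f₂ h1 h2 (fun t ht => ?_) h4 h5
    rw [← h3 t ht]; ring

end IsMeridian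

/-! ### The sphere -/

section ode
variable {f f₁ f₂ : ℝ → ℝ}

/-- The modes of an angular frequency whose square `m` is larger than `4`: a positive constant is a
supersolution. -/
theorem sphere_mode_high {a b m : ℝ} (ha0 : 0 ≤ a) (hb0 : b ≤ π / 2) (hm : 4 < m)
    (hf : ∀ t, HasDerivAt f (f₁ t) t) (hf₁ : ∀ t, HasDerivAt f₁ (f₂ t) t)
    (hsol : ∀ t ∈ Ioo a b, f₂ t + cos t / sin t * f₁ t + (4 - m / sin t ^ 2) * f t = 0)
    (ha : sin a * f a * f₁ a = 0) (hb : sin b * f b * f₁ b = 0) : ∀ t ∈ Ioo a b, f t = 0 := by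
  have hs : ∀ t ∈ Ioo a b, 0 < sin t := fun t ht =>
    sin_pos_of_pos_of_lt_pi (by linarith [ht.1]) (by linarith [ht.2, pi_pos])
  refine eq_zero_of_supersolution (w := fun _ => 1) (w₁ := fun _ => 0) (w₂ := fun _ => 0) hf hf₁
    (fun t => hasDerivAt_const t _) (fun t => hasDerivAt_const t _) continuous_sin
    (fun t ht => ?_) hs (fun _ _ => one_pos) hsol (fun t ht => ?_) ?_ ?_
  · have := hs t ht
    exact (hasDerivAt_sin t).congr_deriv (by field_simp)
  · have h1 := hs t ht
    have h2 : m ≤ m / sin t ^ 2 := by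
      rw [le_div_iff₀ (by positivity)]
      have : sin t ^ 2 ≤ 1 := sin_sq_le_one t
      nlinarith
    simp only [mul_zero, zero_add, mul_one, add_zero]
    linarith
  · linear_combination ha
  · linear_combination hb

/-- A rotationally invariant solution on a polar cap that is slightly larger than the one cut out by
the torus vanishes if it does on the boundary. The supersolution is a quadratic polynomial in the
height below the pole. -/
theorem sphere_cap {b : ℝ} (hf : ∀ t, HasDerivAt f (f₁ t) t) (hf₁ : ∀ t, HasDerivAt f₁ (f₂ t) t)
    (hb0 : 0 ≤ b) (hb1 : b ≤ π / 2) (hb2 : 0.4525 ≤ cos b)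
    (hsol : ∀ t ∈ Ioo 0 b, f₂ t + cos t / sin t * f₁ t + 4 * f t = 0) (hb : f b = 0) :
    ∀ t ∈ Ioo 0 b, f t = 0 := by
  have hs : ∀ t ∈ Ioo 0 b, 0 < sin t := fun t ht =>
    sin_pos_of_pos_of_lt_pi ht.1 (by linarith [ht.2, pi_pos])
  have hcos : ∀ t ∈ Icc 0 b, 0.4525 ≤ cos t := fun t ht =>
    hb2.trans (cos_le_cos_of_nonneg_of_le_pi ht.1 (by linarith [pi_pos]) ht.2)
  refine eq_zero_of_supersolution (w := fun t => 1 - 41 / 20 * (1 - cos t) + (1 - cos t) ^ 2 / 2)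
    (w₁ := fun t => sin t * ((1 - cos t) - 41 / 20))
    (w₂ := fun t => cos t * ((1 - cos t) - 41 / 20) + sin t * sin t)
    (V := fun _ => 4) hf hf₁ (fun t => ?_) (fun t => ?_) continuous_sin
    (fun t ht => ?_) hs (fun t ht => ?_) hsol (fun t ht => ?_) (by simp) (by simp [hb])
  · have h1 := (hasDerivAt_cos t).const_sub 1
    exact (((h1.const_mul (41 / 20)).const_sub 1).add ((h1.pow 2).div_const 2)).congr_deriv
      (by push_cast; ring)
  · exact ((hasDerivAt_sin t).mul (((hasDerivAt_cos t).const_sub 1).sub_const _)).congr_deriv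
      (by ring)
  · have := hs t ht
    exact (hasDerivAt_sin t).congr_deriv (by field_simp)
  · have h1 := hcos t ht
    nlinarith [cos_le_one t]
  · have h1 := hs t ht
    have h2 : cos t / sin t * (sin t * ((1 - cos t) - 41 / 20)) =
        cos t * ((1 - cos t) - 41 / 20) := by
      field_simp
    simp only [h2]
    have h3 := sin_sq_add_cos_sq t
    nlinarith [cos_le_one t, sq_nonneg (1 - cos t)]

/-- The analogue for the equatorial band, which is slightly larger than the one cut out by the
torus, with a Neumann condition on the equator. -/
theorem sphere_band {a : ℝ} (hf : ∀ t, HasDerivAt f (f₁ t) t) (hf₁ : ∀ t, HasDerivAt f₁ (f₂ t) t)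
    (ha0 : 0 ≤ a) (ha1 : a ≤ π / 2) (ha2 : cos a ≤ 0.53)
    (hsol : ∀ t ∈ Ioo a (π / 2), f₂ t + cos t / sin t * f₁ t + 4 * f t = 0) (ha : f a = 0)
    (hb : f₁ (π / 2) = 0) : ∀ t ∈ Ioo a (π / 2), f t = 0 := by
  have hs : ∀ t ∈ Ioo a (π / 2), 0 < sin t := fun t ht =>
    sin_pos_of_pos_of_lt_pi (by linarith [ht.1]) (by linarith [ht.2, pi_pos])
  have hcos : ∀ t ∈ Icc a (π / 2), 0 ≤ cos t ∧ cos t ≤ 0.53 := fun t ht =>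
    ⟨cos_nonneg_of_neg_pi_div_two_le_of_le (by linarith [ht.1, pi_pos]) ht.2,
      (cos_le_cos_of_nonneg_of_le_pi ha0 (by linarith [pi_pos, ht.2]) ht.1).trans ha2⟩
  refine eq_zero_of_supersolution (w := fun t => 1 - 2.8 * cos t ^ 2)
    (w₁ := fun t => 5.6 * (cos t * sin t))
    (w₂ := fun t => 5.6 * (cos t * cos t - sin t * sin t))
    (V := fun _ => 4) hf hf₁ (fun t => ?_) (fun t => ?_) continuous_sin
    (fun t ht => ?_) hs (fun t ht => ?_) hsol (fun t ht => ?_) (by simp [ha]) (by simp [hb])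
  · exact ((((hasDerivAt_cos t).pow 2).const_mul 2.8).const_sub 1).congr_deriv
      (by push_cast; ring)
  · exact (((hasDerivAt_cos t).mul (hasDerivAt_sin t)).const_mul 5.6).congr_deriv
      (by ring)
  · have := hs t ht
    exact (hasDerivAt_sin t).congr_deriv (by field_simp)
  · have h1 := hcos t ht
    norm_num at h1 ⊢
    nlinarith
  · have h1 := hs t ht
    have h2 : cos t / sin t * (5.6 * (cos t * sin t)) = 5.6 * cos t ^ 2 := by
      field_simp
    simp only [h2]
    have h3 := sin_sq_add_cos_sq t
    have h4 := hcos t (Ioo_subset_Icc_self ht)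
    norm_num at h4 ⊢
    nlinarith

/-- A rotationally invariant solution on the hemisphere with a Neumann condition on the equator
vanishes. It suffices that it vanishes at the polar angle `π / 3`, to which both `sphere_cap` and
`sphere_band` apply. Otherwise, by these lemmas, it vanishes beyond its nearest zeros on both sides
(if there are any), so that `sin f'` vanishes at these or at the ends of the interval. But the
derivative `-4 sin f` of `sin f'` has no zero in between. -/
theorem sphere_half (hf : ∀ t, HasDerivAt f (f₁ t) t) (hf₁ : ∀ t, HasDerivAt f₁ (f₂ t) t)
    (hsol : ∀ t ∈ Ioo 0 (π / 2), f₂ t + cos t / sin t * f₁ t + 4 * f t = 0)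
    (hb : f₁ (π / 2) = 0) : ∀ t ∈ Ioo 0 (π / 2), f t = 0 := by
  have hpi := pi_pos
  have cf : Continuous f := continuous_iff_continuousAt.2 fun t => (hf t).continuousAt
  have cf₁ : Continuous f₁ := continuous_iff_continuousAt.2 fun t => (hf₁ t).continuousAt
  have hthird : π / 3 < π / 2 := by linarith
  have hcap : ∀ t ∈ Icc 0 (π / 3), f t = 0 → ∀ s ∈ Ioo 0 t, f s = 0 := fun t ht h0 => by
    refine sphere_cap hf hf₁ ht.1 (by linarith [ht.2]) ?_ (fun s hs => hsol s ⟨hs.1, ?_⟩) h0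
    · have := cos_le_cos_of_nonneg_of_le_pi ht.1 (by linarith) ht.2
      rw [cos_pi_div_three] at this
      norm_num at this ⊢; linarith
    · linarith [hs.2, ht.2]
  have hband : ∀ t ∈ Icc (π / 3) (π / 2), f t = 0 → ∀ s ∈ Ioo t (π / 2), f s = 0 := fun t ht h0 => by
    refine sphere_band hf hf₁ (by linarith [ht.1]) ht.2 ?_ (fun s hs => hsol s ⟨?_, hs.2⟩) h0 hb
    · have := cos_le_cos_of_nonneg_of_le_pi (by linarith : 0 ≤ π / 3) (by linarith [ht.2]) ht.1
      rw [cos_pi_div_three] at this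
      norm_num at this ⊢; linarith
    · linarith [hs.1, ht.1]
  have hmid : f (π / 3) = 0 := by
    by_contra hne
    -- the zeros next to `π / 3`, or the ends of the interval
    obtain ⟨t₁, ⟨ht₁, h1⟩, hmax⟩ := (isCompact_Icc.inter_right
      ((isClosed_singleton (x := (0 : ℝ)).preimage cf).union (isClosed_singleton (x := (0 : ℝ)))) :
      IsCompact (Icc 0 (π / 3) ∩ (f ⁻¹' {0} ∪ {0}))).exists_isGreatest
      ⟨0, ⟨le_rfl, by positivity⟩, Or.inr rfl⟩
    obtain ⟨t₂, ⟨ht₂, h2⟩, hmin⟩ := (isCompact_Icc.inter_right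
      ((isClosed_singleton (x := (0 : ℝ)).preimage cf).union (isClosed_singleton (x := π / 2))) :
      IsCompact (Icc (π / 3) (π / 2) ∩ (f ⁻¹' {0} ∪ {π / 2}))).exists_isLeast
      ⟨π / 2, ⟨hthird.le, le_rfl⟩, Or.inr rfl⟩
    have g1 : sin t₁ * f₁ t₁ = 0 := by
      rcases ht₁.1.eq_or_lt with h | h
      · rw [← h, sin_zero, zero_mul]
      · rcases h1 with h1 | h1
        · rw [(eq_zero_on_Icc h hf cf₁ (hcap t₁ ht₁ h1) t₁ (right_mem_Icc.2 h.le)).2, mul_zero]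
        · exact absurd h1 h.ne'
    have g2 : sin t₂ * f₁ t₂ = 0 := by
      rcases ht₂.2.eq_or_lt with h | h
      · rw [h, hb, mul_zero]
      · rcases h2 with h2 | h2
        · rw [(eq_zero_on_Icc h hf cf₁ (hband t₂ ht₂ h2) t₂ (left_mem_Icc.2 h.le)).2, mul_zero]
        · exact absurd h2 h.ne
    have l1 : t₁ < π / 3 := ht₁.2.lt_of_ne fun h => by
      rcases h1 with h1 | h1
      · exact hne (h ▸ h1)
      · have h1' : t₁ = 0 := h1
        linarith
    have l2 : π / 3 < t₂ := ht₂.1.lt_of_ne fun h => by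
      rcases h2 with h2 | h2
      · exact hne (h ▸ h2)
      · rw [← h] at h2; exact absurd h2 hthird.ne
    have hs : ∀ t ∈ Ioo t₁ t₂, 0 < sin t := fun t ht =>
      sin_pos_of_pos_of_lt_pi (ht₁.1.trans_lt ht.1) (by linarith [ht.2, ht₂.2])
    obtain ⟨t, ht, h3⟩ := exists_hasDerivAt_eq_zero (f := fun t => sin t * f₁ t)
      (f' := fun t => -4 * sin t * f t) (l1.trans l2)
      (continuous_sin.mul cf₁).continuousOn (by simp only [g1, g2]) fun t ht => by
        have h4 := hs t ht
        refine ((hasDerivAt_sin t).mul (hf₁ t)).congr_deriv ?_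
        have h5 := hsol t ⟨ht₁.1.trans_lt ht.1, ht.2.trans_le ht₂.2⟩
        field_simp at h5
        linear_combination h5
    have h4 : f t = 0 := (mul_eq_zero.1 h3).resolve_left (by have := hs t ht; nlinarith)
    rcases le_total t (π / 3) with h | h
    · exact absurd (hmax ⟨⟨ht₁.1.trans ht.1.le, h⟩, Or.inl h4⟩) (not_le.2 ht.1)
    · exact absurd (hmin ⟨⟨h, ht.2.le.trans ht₂.2⟩, Or.inl h4⟩) (not_le.2 ht.2)
  intro t ht
  rcases lt_trichotomy t (π / 3) with h | h | h
  · exact hcap _ ⟨by positivity, le_rfl⟩ hmid t ⟨ht.1, h⟩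
  · rw [h, hmid]
  · exact hband _ ⟨le_rfl, hthird.le⟩ hmid t ⟨h, ht.2⟩

end ode

/-- The first coordinate of the meridian of the round sphere, as a function of the polar angle. -/
def sphereX (t : ℝ) : ℝ := 2 * cos t

/-- The distance of the meridian of the round sphere from the axis. -/
def sphereY (t : ℝ) : ℝ := 2 * sin t

theorem isMeridian_sphere :
    IsMeridian sphereX sphereY (fun _ => 2) (fun t => -sin t) cos (fun _ => 1) (fun _ => 0) where
  hx t := ((hasDerivAt_cos t).const_mul 2)
  hy t := ((hasDerivAt_sin t).const_mul 2)
  hc t := (hasDerivAt_sin t).neg.congr_deriv (by ring)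
  hs t := (hasDerivAt_cos t).congr_deriv (by ring)
  hw t := hasDerivAt_const t _
  unit t := by rw [neg_sq, sin_sq_add_cos_sq]
  w_pos _ := two_pos
  smooth_x := contDiff_const.mul contDiff_cos
  smooth_y := contDiff_const.mul contDiff_sin

theorem mem_roundSphere_iff {p : E3} : p ∈ roundSphere ↔ p 0 ^ 2 + p 1 ^ 2 + p 2 ^ 2 = 4 := by
  rw [roundSphere, mem_sphere_zero_iff_norm, EuclideanSpace.norm_eq,
    Real.sqrt_eq_iff_mul_self_eq_of_pos two_pos, Fin.sum_univ_three]
  simp only [Real.norm_eq_abs, sq_abs]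
  constructor <;> intro h <;> linarith

theorem revolve_mem_roundSphere {x y : ℝ → ℝ} {q : Par} :
    revolve x y q ∈ roundSphere ↔ x (q 0) ^ 2 + y (q 0) ^ 2 = 4 := by
  rw [mem_roundSphere_iff]
  have := sin_sq_add_cos_sq (q 1)
  have e : revolve x y q 0 ^ 2 + revolve x y q 1 ^ 2 + revolve x y q 2 ^ 2 =
      x (q 0) ^ 2 + y (q 0) ^ 2 := by
    simp [revolve]
    linear_combination y (q 0) ^ 2 * this
  rw [e]

theorem sphere_mem (q : Par) : revolve sphereX sphereY q ∈ roundSphere := by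
  rw [revolve_mem_roundSphere]
  have := sin_sq_add_cos_sq (q 0)
  simp only [sphereX, sphereY]
  linear_combination 4 * this

theorem sphere_neumann {B : Set E3} {u : E3 → ℝ} (hu : NeumannOn roundSphere B u) (θ : ℝ)
    (hB : revolve sphereX sphereY ![π / 2, θ] ∈ B) :
    pd 0 (u ∘ revolve sphereX sphereY) ![π / 2, θ] = 0 :=
  isMeridian_sphere.pd_zero_eq_zero_of_neumann (I := Ioo 0 π) isOpen_Ioo
    (fun _ ht => mul_pos two_pos (sin_pos_of_mem_Ioo ht)) (fun q _ => sphere_mem q) hu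
    ⟨by simp only [Matrix.cons_val_zero]; linarith [pi_pos],
      by simp only [Matrix.cons_val_zero]; linarith [pi_pos]⟩ hB (by simp)

/-- Reduction of the Jacobi equation on a piece of the hemisphere to the rotationally invariant
solutions. -/
theorem sphere_piece {a b : ℝ} (hab : a < b) (ha0 : 0 ≤ a) (hb0 : b ≤ π / 2) {S : Set E3}
    (hS : ∀ q : Par, q 0 ∈ Ioo a b → revolve sphereX sphereY q ∈ S) {u : E3 → ℝ}
    (hu : ContDiff ℝ 2 u) {N : ℕ} (hN : 3 ≤ N) (hrot : ∀ p ∈ S, u (rot (2 * π / N) p) = u p)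
    (hJ : JacobiOn S u) {EN ED : Set ℝ}
    (hEN : ∀ t ∈ EN, ∀ θ, pd 0 (u ∘ revolve sphereX sphereY) ![t, θ] = 0)
    (hED : ∀ t ∈ ED, ∀ θ, u (revolve sphereX sphereY ![t, θ]) = 0)
    (ha : a = 0 ∨ a ∈ ED) (hb : b ∈ EN ∨ b ∈ ED)
    (hmode : ∀ f f₁ f₂ : ℝ → ℝ, (∀ t, HasDerivAt f (f₁ t) t) → (∀ t, HasDerivAt f₁ (f₂ t) t) →
      (∀ t ∈ Ioo a b, f₂ t + cos t / sin t * f₁ t + 4 * f t = 0) →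
      (∀ t ∈ EN, f₁ t = 0) → (∀ t ∈ ED, f t = 0) → ∀ t ∈ Ioo a b, f t = 0) :
    ∀ q : Par, q 0 ∈ Icc a b → u (revolve sphereX sphereY q) = 0 := by
  have hs : ∀ t ∈ Ioo a b, 0 < sin t := fun t ht =>
    sin_pos_of_pos_of_lt_pi (by linarith [ht.1]) (by linarith [ht.2, pi_pos])
  refine isMeridian_sphere.eq_zero_on_piece hab (fun t ht => mul_pos two_pos (hs t ht)) hS hu
    (by omega) hrot hJ hEN hED fun n f f₁ f₂ hf hf₁ hsol hN0 hD0 => ?_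
  have hsol' : ∀ t ∈ Ioo a b,
      f₂ t + cos t / sin t * f₁ t + (4 - ((n : ℝ) * N) ^ 2 / sin t ^ 2) * f t = 0 := fun t ht => by
    have h1 := hs t ht
    rw [← hsol t ht]
    simp only [sphereX, sphereY]
    field_simp
    ring
  rcases Nat.eq_zero_or_pos n with rfl | hn
  · exact hmode f f₁ f₂ hf hf₁ (fun t ht => by rw [← hsol' t ht]; push_cast; ring) hN0 hD0
  · have h3 : (3 : ℝ) ≤ n * N := by
      have h4 : (1 : ℝ) ≤ n := by exact_mod_cast hn
      have h5 : (3 : ℝ) ≤ N := by exact_mod_cast hN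
      nlinarith
    refine sphere_mode_high ha0 hb0 (m := ((n : ℝ) * N) ^ 2) (by nlinarith) hf hf₁ hsol' ?_ ?_
    · rcases ha with h | h
      · rw [h, sin_zero, zero_mul, zero_mul]
      · rw [hD0 a h, mul_zero, zero_mul]
    · rcases hb with h | h
      · rw [hN0 b h, mul_zero]
      · rw [hD0 b h, mul_zero, zero_mul]

/-! ### The torus -/

namespace ProfileCurve
variable {x y c s : ℝ → ℝ} {T : ℝ}

/-- The profile is smooth, because its equation expresses the derivatives of the four functions as
polynomials in them. -/
theorem contDiff (h : ProfileCurve x y c s T) : ContDiff ℝ ∞ x ∧ ContDiff ℝ ∞ y := by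
  have key : ∀ n : ℕ, ContDiff ℝ n x ∧ ContDiff ℝ n y ∧ ContDiff ℝ n c ∧ ContDiff ℝ n s := by
    intro n
    induction n with
    | zero =>
      refine ⟨?_, ?_, ?_, ?_⟩ <;>
        refine contDiff_zero.2 (continuous_iff_continuousAt.2 fun t => ?_)
      exacts [(h.hx t).continuousAt, (h.hy t).continuousAt, (h.hc t).continuousAt,
        (h.hs t).continuousAt]
    | succ n ih =>
      obtain ⟨ix, iy, ic, is⟩ := ih
      have it : ContDiff ℝ n fun t => turn (x t) (y t) (c t) (s t) :=
        ic.add ((iy.mul ((ix.mul is).sub (iy.mul ic))).div_const 2)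
      have step : ∀ {f f' : ℝ → ℝ}, (∀ t, HasDerivAt f (f' t) t) → ContDiff ℝ n f' →
          ContDiff ℝ (n + 1 : ℕ) f := fun {f f'} hf hc => by
        push_cast
        refine contDiff_succ_iff_deriv.2 ⟨fun t => (hf t).differentiableAt, by simp, ?_⟩
        rwa [show deriv f = f' from funext fun t => (hf t).deriv]
      exact ⟨step h.hx (iy.mul ic), step h.hy (iy.mul is), step h.hc (is.mul it).neg,
        step h.hs (ic.mul it)⟩
  exact ⟨contDiff_infty.2 fun n => (key n).1, contDiff_infty.2 fun n => (key n).2.1⟩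

theorem isMeridian (h : ProfileCurve x y c s T) : IsMeridian x y y c s
    (fun t => turn (x t) (y t) (c t) (s t)) (fun t => y t * s t) where
  hx := h.hx
  hy := h.hy
  hc := h.hc
  hs := h.hs
  hw := h.hy
  unit := h.unit
  w_pos := h.y_pos
  smooth_x := h.contDiff.1
  smooth_y := h.contDiff.2

theorem shrinkerEq (h : ProfileCurve x y c s T) (q : Par) : ShrinkerEq (revolve x y) q := by
  have hy := h.y_pos (q 0)
  rw [h.isMeridian.shrinkerEq_iff hy, turn]
  field_simp
  ring

end ProfileCurve

/-- `(f, g)` is a rotationally invariant solution of the Jacobi equation along the profile curve,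
with `f' = 2 g`. -/
structure IsJacobiSol (x y c s f g : ℝ → ℝ) (a b : ℝ) : Prop where
  cont_fst : ContinuousOn f (Icc a b)
  cont_snd : ContinuousOn g (Icc a b)
  deriv_fst : ∀ t ∈ Ioo a b, HasDerivAt f (2 * g t) t
  deriv_snd : ∀ t ∈ Ioo a b, HasDerivAt g
    (drift (x t) (y t) (c t) (s t) * g t - pot (x t) (y t) (c t) (s t) * f t / 2) t

section jacobi
variable {x y c s f g f' g' : ℝ → ℝ} {T a b : ℝ}

/-- The Gaussian weight is the integrating factor of the Jacobi equation. -/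
theorem ProfileCurve.hasDerivAt_weight (h : ProfileCurve x y c s T) (t : ℝ) :
    HasDerivAt (fun t => exp (-(x t ^ 2 + y t ^ 2) / 4))
      (exp (-(x t ^ 2 + y t ^ 2) / 4) * -drift (x t) (y t) (c t) (s t)) t := by
  refine (((((h.hx t).pow 2).add ((h.hy t).pow 2)).neg.div_const 4).exp).congr_deriv ?_
  simp only [Pi.add_apply, Pi.pow_apply, Pi.neg_apply, drift]
  push_cast
  ring

theorem ProfileCurve.continuous_weight (h : ProfileCurve x y c s T) :
    Continuous fun t => exp (-(x t ^ 2 + y t ^ 2) / 4) :=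
  continuous_iff_continuousAt.2 fun t => (h.hasDerivAt_weight t).continuousAt

/-- Liouville's formula for the Wronskian of two solutions. -/
theorem IsJacobiSol.wronskian_eq (h : ProfileCurve x y c s T) (hf : IsJacobiSol x y c s f g a b)
    (hf' : IsJacobiSol x y c s f' g' a b) {t₁ t₂ : ℝ} (h₁ : t₁ ∈ Icc a b) (h₂ : t₂ ∈ Icc a b)
    (h0 : f t₁ * g' t₁ - g t₁ * f' t₁ = 0) : f t₂ * g' t₂ - g t₂ * f' t₂ = 0 := by
  set p : ℝ → ℝ := fun t => exp (-(x t ^ 2 + y t ^ 2) / 4) with hp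
  have key : ∀ t ∈ Icc a b, p t * (f t * g' t - g t * f' t) = p a * (f a * g' a - g a * f' a) := by
    intro t ht
    rcases ht.1.eq_or_lt with e | e
    · rw [e]
    have hsub : Icc a t ⊆ Icc a b := Icc_subset_Icc_right ht.2
    obtain ⟨τ, hτ, e1⟩ := exists_hasDerivAt_eq_slope
      (fun t => p t * (f t * g' t - g t * f' t)) (fun _ => 0) e
      (h.continuous_weight.continuousOn.mul
        (((hf.cont_fst.mul hf'.cont_snd).sub (hf.cont_snd.mul hf'.cont_fst)).mono hsub))
      fun τ hτ => by
        have hτ' : τ ∈ Ioo a b := ⟨hτ.1, hτ.2.trans_le ht.2⟩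
        refine ((h.hasDerivAt_weight τ).fun_mul
          (((hf.deriv_fst τ hτ').fun_mul (hf'.deriv_snd τ hτ')).fun_sub
            ((hf.deriv_snd τ hτ').fun_mul (hf'.deriv_fst τ hτ')))).congr_deriv ?_
        ring
    have h3 := (div_eq_zero_iff.1 e1.symm).resolve_right (by linarith)
    linarith
  have k₁ := key t₁ h₁
  have k₂ := key t₂ h₂
  rw [h0, mul_zero] at k₁
  rw [← k₁] at k₂
  exact (mul_eq_zero.1 k₂).resolve_left (exp_pos _).ne'

theorem IsJacobiSol.mono (hf : IsJacobiSol x y c s f g a b) {a' b' : ℝ} (ha : a ≤ a')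
    (hb : b' ≤ b) : IsJacobiSol x y c s f g a' b' where
  cont_fst := hf.cont_fst.mono (Icc_subset_Icc ha hb)
  cont_snd := hf.cont_snd.mono (Icc_subset_Icc ha hb)
  deriv_fst t ht := hf.deriv_fst t (Ioo_subset_Ioo ha hb ht)
  deriv_snd t ht := hf.deriv_snd t (Ioo_subset_Ioo ha hb ht)

end jacobi

namespace TorusData
variable {x y c s u q v r f g : ℝ → ℝ} {T tc a b : ℝ}

theorem isJacobiSol_u (h : TorusData x y c s T tc u q v r) : IsJacobiSol x y c s u q 0 T where
  cont_fst t ht := (h.hu t ht).continuousAt.continuousWithinAt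
  cont_snd t ht := (h.hq t ht).continuousAt.continuousWithinAt
  deriv_fst t ht := h.hu t (Ioo_subset_Icc_self ht)
  deriv_snd t ht := h.hq t (Ioo_subset_Icc_self ht)

theorem isJacobiSol_v (h : TorusData x y c s T tc u q v r) : IsJacobiSol x y c s v r 0 T where
  cont_fst t ht := (h.hv t ht).continuousAt.continuousWithinAt
  cont_snd t ht := (h.hr t ht).continuousAt.continuousWithinAt
  deriv_fst t ht := h.hv t (Ioo_subset_Icc_self ht)
  deriv_snd t ht := h.hr t (Ioo_subset_Icc_self ht)

/-- Uniqueness for the initial value problem, from the nonvanishing of the Wronskian of the two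
known solutions. -/
theorem eq_zero_of_initial (h : TorusData x y c s T tc u q v r) (ha : 0 ≤ a) (hb : b ≤ T)
    (hf : IsJacobiSol x y c s f g a b) {t₀ : ℝ} (h₀ : t₀ ∈ Icc a b) (hf0 : f t₀ = 0)
    (hg0 : g t₀ = 0) : ∀ t ∈ Icc a b, f t = 0 := by
  intro t ht
  have e1 := hf.wronskian_eq h.toProfileCurve (h.isJacobiSol_u.mono ha hb) h₀ ht
    (by rw [hf0, hg0]; ring)
  have e2 := hf.wronskian_eq h.toProfileCurve (h.isJacobiSol_v.mono ha hb) h₀ ht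
    (by rw [hf0, hg0]; ring)
  have hT : t ∈ Icc 0 T := ⟨ha.trans ht.1, ht.2.trans hb⟩
  have hne : u t * r t - q t * v t ≠ 0 := fun h0 => by
    have := h.isJacobiSol_u.wronskian_eq h.toProfileCurve h.isJacobiSol_v hT
      (left_mem_Icc.2 h.T_pos.le) h0
    obtain ⟨i1, i2, i3, i4⟩ := h.init
    rw [i1, i2, i3, i4] at this
    norm_num at this
  have e3 : f t * (u t * r t - q t * v t) = 0 := by linear_combination u t * e2 - v t * e1
  exact (mul_eq_zero.1 e3).resolve_right hne

/-- On the whole right half, with Neumann conditions at both ends: the Wronskian with `u`, which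
satisfies the condition at `0`, shows that the solution vanishes at `T`. -/
theorem eq_zero_half (h : TorusData x y c s T tc u q v r) (hf : IsJacobiSol x y c s f g 0 T)
    (h0 : g 0 = 0) (h1 : g T = 0) : ∀ t ∈ Icc 0 T, f t = 0 := by
  have hT := right_mem_Icc.2 h.T_pos.le
  have e1 := hf.wronskian_eq h.toProfileCurve h.isJacobiSol_u (left_mem_Icc.2 h.T_pos.le) hT
    (by rw [h0, h.init.2.1]; ring)
  rw [h1, zero_mul, sub_zero] at e1
  exact h.eq_zero_of_initial le_rfl le_rfl hf hT ((mul_eq_zero.1 e1).resolve_right h.q_T) h1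

/-- Outside the sphere, with a Neumann condition at `0` and a Dirichlet condition at `tc`. -/
theorem eq_zero_outer (h : TorusData x y c s T tc u q v r) (hf : IsJacobiSol x y c s f g 0 tc)
    (h0 : g 0 = 0) (h1 : f tc = 0) : ∀ t ∈ Icc 0 tc, f t = 0 := by
  have hT := right_mem_Icc.2 h.tc_mem.1.le
  have e1 := hf.wronskian_eq h.toProfileCurve (h.isJacobiSol_u.mono le_rfl h.tc_mem.2.le)
    (left_mem_Icc.2 h.tc_mem.1.le) hT (by rw [h0, h.init.2.1]; ring)
  rw [h1, zero_mul, zero_sub, neg_eq_zero] at e1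
  exact h.eq_zero_of_initial le_rfl h.tc_mem.2.le hf hT h1 ((mul_eq_zero.1 e1).resolve_right h.u_tc)

/-- Inside the sphere, with a Dirichlet condition at `tc` and a Neumann condition at `T`. -/
theorem eq_zero_inner (h : TorusData x y c s T tc u q v r) (hf : IsJacobiSol x y c s f g tc T)
    (h0 : f tc = 0) (h1 : g T = 0) : ∀ t ∈ Icc tc T, f t = 0 := by
  have hT := right_mem_Icc.2 h.tc_mem.2.le
  -- the solution with zero value at `tc`
  have hψ : IsJacobiSol x y c s (fun t => u tc * v t - v tc * u t)
      (fun t => u tc * r t - v tc * q t) tc T := by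
    have hu := h.isJacobiSol_u.mono h.tc_mem.1.le le_rfl
    have hv := h.isJacobiSol_v.mono h.tc_mem.1.le le_rfl
    exact ⟨(hv.cont_fst.const_mul _).sub (hu.cont_fst.const_mul _),
      (hv.cont_snd.const_mul _).sub (hu.cont_snd.const_mul _),
      fun t ht => (((hv.deriv_fst t ht).const_mul _).sub
        ((hu.deriv_fst t ht).const_mul _)).congr_deriv (by ring),
      fun t ht => (((hv.deriv_snd t ht).const_mul _).sub
        ((hu.deriv_snd t ht).const_mul _)).congr_deriv (by ring)⟩
  have e1 := hf.wronskian_eq h.toProfileCurve hψ (left_mem_Icc.2 h.tc_mem.2.le) hT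
    (by simp only [h0]; ring)
  rw [h1, zero_mul, sub_zero] at e1
  exact h.eq_zero_of_initial h.tc_mem.1.le le_rfl hf hT
    ((mul_eq_zero.1 e1).resolve_right h.wronskian) h1

/-- The frequency beyond which the nonconstant modes have a positive constant as a supersolution. -/
theorem exists_pot_lt (h : TorusData x y c s T tc u q v r) : ∃ N₀ : ℕ, 3 ≤ N₀ ∧
    ∀ t ∈ Icc 0 T, pot (x t) (y t) (c t) (s t) < (N₀ : ℝ) ^ 2 := by
  have cx : Continuous x := continuous_iff_continuousAt.2 fun t => (h.hx t).continuousAt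
  have cy : Continuous y := continuous_iff_continuousAt.2 fun t => (h.hy t).continuousAt
  have cc : Continuous c := continuous_iff_continuousAt.2 fun t => (h.hc t).continuousAt
  have cs : Continuous s := continuous_iff_continuousAt.2 fun t => (h.hs t).continuousAt
  have ct : Continuous fun t => pot (x t) (y t) (c t) (s t) := by
    unfold pot turn; fun_prop
  obtain ⟨K, hK⟩ := isCompact_Icc.exists_bound_of_continuousOn (s := Icc 0 T) ct.continuousOn
  obtain ⟨n, hn⟩ := exists_nat_gt K
  refine ⟨n + 3, by omega, fun t ht => ?_⟩
  have h1 := (le_abs_self _).trans (hK t ht)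
  have h2 : (0 : ℝ) ≤ n := n.cast_nonneg
  push_cast
  nlinarith

theorem pd_zero_eq_zero (h : TorusData x y c s T tc u q v r) {B : Set E3} {F : E3 → ℝ}
    (hF : NeumannOn (range (revolve x y)) B F) {p : Par} (hs : s (p 0) = 0)
    (hB : revolve x y p ∈ B) : pd 0 (F ∘ revolve x y) p = 0 := by
  refine h.isMeridian.pd_zero_eq_zero_of_neumann isOpen_univ (fun t _ => h.y_pos t)
    (fun q _ => mem_range_self q) hF (mem_univ _) hB fun hc => ?_
  have := h.unit (p 0)
  rw [hs, hc] at this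
  norm_num at this

/-- Reduction of the Jacobi equation on a piece of the half torus to the rotationally invariant
solutions. -/
theorem piece (h : TorusData x y c s T tc u q v r) {N₀ : ℕ} (h3 : 3 ≤ N₀)
    (hN₀ : ∀ t ∈ Icc 0 T, pot (x t) (y t) (c t) (s t) < (N₀ : ℝ) ^ 2)
    (hab : a < b) (ha0 : 0 ≤ a) (hb0 : b ≤ T) {S : Set E3}
    (hS : ∀ p : Par, p 0 ∈ Ioo a b → revolve x y p ∈ S) {F : E3 → ℝ}
    (hF : ContDiff ℝ 2 F) {N : ℕ} (hN : N₀ ≤ N) (hrot : ∀ p ∈ S, F (rot (2 * π / N) p) = F p)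
    (hJ : JacobiOn S F) {EN ED : Set ℝ}
    (hEN : ∀ t ∈ EN, ∀ θ, pd 0 (F ∘ revolve x y) ![t, θ] = 0)
    (hED : ∀ t ∈ ED, ∀ θ, F (revolve x y ![t, θ]) = 0)
    (ha : a ∈ EN ∨ a ∈ ED) (hb : b ∈ EN ∨ b ∈ ED)
    (hmode : ∀ f g : ℝ → ℝ, IsJacobiSol x y c s f g a b →
      (∀ t ∈ EN, g t = 0) → (∀ t ∈ ED, f t = 0) → ∀ t ∈ Icc a b, f t = 0) :
    ∀ p : Par, p 0 ∈ Icc a b → F (revolve x y p) = 0 := by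
  refine h.isMeridian.eq_zero_on_piece hab (fun t _ => h.y_pos t) hS hF
    (by omega) hrot hJ hEN hED fun n f f₁ f₂ hf hf₁ hsol hN0 hD0 => ?_
  have hsol' : ∀ t ∈ Ioo a b, f₂ t + -drift (x t) (y t) (c t) (s t) * f₁ t +
      (pot (x t) (y t) (c t) (s t) - ((n : ℝ) * N) ^ 2) * f t = 0 := fun t ht => by
    have h1 := h.y_pos t
    rw [← hsol t ht]
    unfold pot drift
    field_simp
    ring
  rcases Nat.eq_zero_or_pos n with rfl | hn
  · have hJf : IsJacobiSol x y c s f (fun t => f₁ t / 2) a b :=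
      ⟨fun t _ => (hf t).continuousAt.continuousWithinAt,
        fun t _ => ((hf₁ t).div_const 2).continuousAt.continuousWithinAt,
        fun t _ => (hf t).congr_deriv (by ring), fun t ht => ((hf₁ t).div_const 2).congr_deriv (by
          have := hsol' t ht
          push_cast at this
          linear_combination this / 2)⟩
    intro t ht
    exact hmode f _ hJf (fun t ht => by simp only [hN0 t ht, zero_div]) hD0 t
      (Ioo_subset_Icc_self ht)
  · refine eq_zero_of_supersolution (w := fun _ => 1) (w₁ := fun _ => 0) (w₂ := fun _ => 0) hf hf₁
      (fun t => hasDerivAt_const t _) (fun t => hasDerivAt_const t _) h.continuous_weight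
      (fun t _ => h.hasDerivAt_weight t) (fun t _ => exp_pos _) (fun _ _ => one_pos) hsol'
      (fun t ht => ?_) ?_ ?_
    · have h4 := hN₀ t ⟨ha0.trans ht.1.le, ht.2.le.trans hb0⟩
      have h5 : (N₀ : ℝ) ≤ n * N := by
        have h6 : (1 : ℝ) ≤ n := by exact_mod_cast hn
        have h7 : (N₀ : ℝ) ≤ N := by exact_mod_cast hN
        have h8 : (0 : ℝ) ≤ N := N.cast_nonneg
        nlinarith
      have h6 := pow_le_pow_left₀ (Nat.cast_nonneg N₀) h5 2
      simp only [mul_zero, zero_add, mul_one, add_zero]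
      linarith
    · rcases ha with h' | h'
      · simp [hN0 a h']
      · simp [hD0 a h']
    · rcases hb with h' | h'
      · simp [hN0 b h']
      · simp [hD0 b h']

end TorusData

/-! ### Connected components -/

/-- Two connected sets that are separated by the values of a continuous function are the connected
components of their union. -/
theorem components_eq_pair {M A B : Set E3} (hM : M = A ∪ B) (hA : IsPreconnected A)
    (hB : IsPreconnected B) (nA : A.Nonempty) (nB : B.Nonempty) {φ : E3 → ℝ} (hφ : Continuous φ)
    {k : ℝ} (h1 : ∀ p ∈ A, φ p < k) (h2 : ∀ p ∈ B, k < φ p) :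
    A ≠ B ∧ components M = {A, B} := by
  have sep : ∀ C ⊆ M, IsPreconnected C → ∀ p ∈ C, ∀ z ∈ C, p ∈ A → z ∈ B → False := by
    intro C hC hpre p hp z hz hpA hzB
    obtain ⟨z', hz', e⟩ := hpre.intermediate_value hp hz hφ.continuousOn
      ⟨(h1 p hpA).le, (h2 z hzB).le⟩
    rcases hM ▸ hC hz' with h | h
    · exact absurd e (h1 _ h).ne
    · exact absurd e (h2 _ h).ne'
  have cA : ∀ p ∈ A, connectedComponentIn M p = A := fun p hp => by
    have hpM : p ∈ M := hM ▸ Or.inl hp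
    refine Subset.antisymm (fun z hz => ?_)
      (hA.subset_connectedComponentIn hp (hM ▸ subset_union_left))
    rcases hM ▸ connectedComponentIn_subset M p hz with h | h
    · exact h
    · exact (sep _ (connectedComponentIn_subset M p) isPreconnected_connectedComponentIn p
        (mem_connectedComponentIn hpM) z hz hp h).elim
  have cB : ∀ p ∈ B, connectedComponentIn M p = B := fun p hp => by
    have hpM : p ∈ M := hM ▸ Or.inr hp
    refine Subset.antisymm (fun z hz => ?_)
      (hB.subset_connectedComponentIn hp (hM ▸ subset_union_right))
    rcases hM ▸ connectedComponentIn_subset M p hz with h | h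
    · exact (sep _ (connectedComponentIn_subset M p) isPreconnected_connectedComponentIn z hz p
        (mem_connectedComponentIn hpM) h hp).elim
    · exact h
  obtain ⟨pA, hpA⟩ := nA
  obtain ⟨pB, hpB⟩ := nB
  refine ⟨fun e => lt_asymm (h1 pA hpA) (h2 pA (e ▸ hpA)), ?_⟩
  ext C
  simp only [components, mem_ofPred_eq, mem_insert_iff, mem_singleton_iff]
  constructor
  · rintro ⟨p, hp, rfl⟩
    rcases hM ▸ hp with h | h
    · exact Or.inl (cA p h)
    · exact Or.inr (cB p h)
  · rintro (rfl | rfl)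
    · exact ⟨pA, hM ▸ Or.inl hpA, (cA pA hpA).symm⟩
    · exact ⟨pB, hM ▸ Or.inr hpB, (cB pB hpB).symm⟩

/-- The part of a surface of revolution over a set of parameters of the profile curve. -/
def band (x y : ℝ → ℝ) (I : Set ℝ) : Set E3 := revolve x y '' {q | q 0 ∈ I}

theorem isPreconnected_band {x y : ℝ → ℝ} (hx : Continuous x) (hy : Continuous y) {I : Set ℝ}
    (hI : Convex ℝ I) : IsPreconnected (band x y I) :=
  ((hI.linear_preimage (LinearMap.proj (R := ℝ) (φ := fun _ : Fin 2 => ℝ) 0)).isPreconnected).image _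
    (continuous_revolve hx hy).continuousOn

theorem revolve_mem_band {x y : ℝ → ℝ} {I : Set ℝ} {q : Par} (hq : q 0 ∈ I) :
    revolve x y q ∈ band x y I := mem_image_of_mem _ hq

theorem exists_polar_angle (a b : ℝ) :
    ∃ θ, √(a ^ 2 + b ^ 2) * cos θ = a ∧ √(a ^ 2 + b ^ 2) * sin θ = b := by
  refine ⟨Complex.arg ⟨a, b⟩, ?_⟩
  have e : ‖(⟨a, b⟩ : ℂ)‖ = √(a ^ 2 + b ^ 2) := by
    rw [Complex.norm_def, Complex.normSq_mk]; ring_nf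
  rw [← e]
  exact ⟨Complex.norm_mul_cos_arg _, Complex.norm_mul_sin_arg _⟩

/-- A point lies on a surface of revolution if it has the same position along the axis and the same
distance from it as a point of the profile. -/
theorem exists_revolve_eq {x y : ℝ → ℝ} {t : ℝ} (hy : 0 ≤ y t) {p : E3} (h0 : p 0 = x t)
    (h1 : p 1 ^ 2 + p 2 ^ 2 = y t ^ 2) : ∃ θ, revolve x y ![t, θ] = p := by
  obtain ⟨θ, e1, e2⟩ := exists_polar_angle (p 1) (p 2)
  rw [h1, Real.sqrt_sq hy] at e1 e2
  refine ⟨θ, ?_⟩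
  ext i
  fin_cases i
  · exact h0.symm
  · exact e1
  · exact e2

theorem sphere_half_eq {p : E3} (hp : p ∈ roundSphere) (h0 : 0 ≤ p 0) :
    ∃ q : Par, q 0 ∈ Icc 0 (π / 2) ∧ revolve sphereX sphereY q = p := by
  rw [mem_roundSphere_iff] at hp
  have h2 : p 0 ≤ 2 := by nlinarith [sq_nonneg (p 1), sq_nonneg (p 2)]
  have hc : cos (arccos (p 0 / 2)) = p 0 / 2 := cos_arccos (by linarith) (by linarith)
  have hs := sin_sq_add_cos_sq (arccos (p 0 / 2))
  rw [hc] at hs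
  obtain ⟨θ, hθ⟩ := exists_revolve_eq (x := sphereX) (y := sphereY) (t := arccos (p 0 / 2)) (p := p)
    (mul_nonneg zero_le_two (sin_nonneg_of_nonneg_of_le_pi (arccos_nonneg _) (arccos_le_pi _)))
    (by rw [sphereX, hc]; ring) (by rw [sphereY]; linear_combination hp - 4 * hs)
  exact ⟨_, ⟨arccos_nonneg _, arccos_le_pi_div_two.2 (by linarith)⟩, hθ⟩

/-! ### The profile curve -/

namespace ProfileCurve
variable {x y c s : ℝ → ℝ} {T : ℝ}

theorem x_zero (h : ProfileCurve x y c s T) : x 0 = 0 := by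
  have := (h.symm 0).1
  rw [neg_zero] at this; linarith

theorem s_zero (h : ProfileCurve x y c s T) : s 0 = 0 := by
  have := (h.symm 0).2.2.2
  rw [neg_zero] at this; linarith

theorem strictAntiOn_y (h : ProfileCurve x y c s T) : StrictAntiOn y (Icc 0 T) := by
  refine strictAntiOn_of_deriv_neg (convex_Icc 0 T) h.contDiff.2.continuous.continuousOn
    fun t ht => ?_
  rw [interior_Icc] at ht
  rw [(h.hy t).deriv]
  exact mul_neg_of_pos_of_neg (h.y_pos t) (h.s_neg t ht)

theorem x_nonneg (h : ProfileCurve x y c s T) {t : ℝ} (ht : t ∈ Icc 0 T) : 0 ≤ x t := by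
  rcases ht.1.eq_or_lt with e | e
  · rw [← e, h.x_zero]
  rcases ht.2.eq_or_lt with e' | e'
  · rw [e', h.x_T]
  · exact (h.x_pos t ⟨e, e'⟩).le

/-- Reduction to one period. -/
theorem exists_fundamental (h : ProfileCurve x y c s T) (t : ℝ) :
    ∃ t' ∈ Ico (-T) T, x t = x t' ∧ y t = y t' ∧ deriv y t = deriv y t' := by
  have hper : Function.Periodic (fun t => (x t, y t, deriv y t)) (2 * T) := fun t => by
    have e : deriv y (t + 2 * T) = deriv y t := by
      rw [← deriv_comp_add_const]
      exact congrArg (fun f => deriv f t) (funext fun t => (h.per t).2)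
    simp only [(h.per t).1, (h.per t).2, e]
  obtain ⟨t', ht', e⟩ := hper.exists_mem_Ico (by linarith [h.T_pos]) t (-T)
  rw [show -T + 2 * T = T by ring] at ht'
  simp only [Prod.mk.injEq] at e
  exact ⟨t', ht', e⟩

/-- Up to the reflection, every point of the profile belongs to its right half. -/
theorem exists_half (h : ProfileCurve x y c s T) (t : ℝ) :
    ∃ t' ∈ Icc 0 T, |x t| = x t' ∧ y t = y t' := by
  obtain ⟨t', ht', e1, e2, -⟩ := h.exists_fundamental t
  rcases le_total 0 t' with h0 | h0
  · have hm : t' ∈ Icc 0 T := ⟨h0, ht'.2.le⟩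
    exact ⟨t', hm, by rw [e1, abs_of_nonneg (h.x_nonneg hm)], e2⟩
  · have hm : -t' ∈ Icc 0 T := ⟨by linarith, by linarith [ht'.1]⟩
    have hs := h.symm t'
    refine ⟨-t', hm, ?_, by rw [hs.2.1, e2]⟩
    have := h.x_nonneg hm
    rw [hs.1] at this ⊢
    rw [e1, abs_of_nonpos (by linarith)]

theorem injOn (h : ProfileCurve x y c s T) : InjOn (fun t => (x t, y t)) (Ico 0 (2 * T)) := by
  have refl : ∀ t, x (2 * T - t) = -x t ∧ y (2 * T - t) = y t := fun t => by
    have h1 := h.per (-t)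
    have h2 := h.symm t
    rw [show 2 * T - t = -t + 2 * T by ring, h1.1, h1.2, h2.1, h2.2.1]
    exact ⟨rfl, rfl⟩
  have hneg : ∀ t ∈ Ioo T (2 * T), x t < 0 := fun t ht => by
    have := h.x_pos (2 * T - t) ⟨by linarith [ht.2], by linarith [ht.1]⟩
    rw [(refl t).1] at this; linarith
  intro t₁ h₁ t₂ h₂ e
  simp only [Prod.mk.injEq] at e
  rcases le_or_gt t₁ T with l₁ | l₁ <;> rcases le_or_gt t₂ T with l₂ | l₂
  · exact h.strictAntiOn_y.injOn ⟨h₁.1, l₁⟩ ⟨h₂.1, l₂⟩ e.2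
  · have k1 := hneg t₂ ⟨l₂, h₂.2⟩
    have k2 := h.x_nonneg ⟨h₁.1, l₁⟩
    linarith [e.1]
  · have k1 := hneg t₁ ⟨l₁, h₁.2⟩
    have k2 := h.x_nonneg ⟨h₂.1, l₂⟩
    linarith [e.1]
  · have := h.strictAntiOn_y.injOn (x₁ := 2 * T - t₁) (x₂ := 2 * T - t₂)
      ⟨by linarith [h₁.2], by linarith⟩ ⟨by linarith [h₂.2], by linarith⟩
      (by rw [(refl t₁).2, (refl t₂).2, e.2])
    linarith

theorem isTorusProfile (h : ProfileCurve x y c s T) : IsTorusProfile x y where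
  smooth_x := h.contDiff.1
  smooth_y := h.contDiff.2
  pos := h.y_pos
  regular t := by
    by_contra! hd
    rw [(h.hx t).deriv, (h.hy t).deriv] at hd
    have hy := (h.y_pos t).ne'
    have h1 := (mul_eq_zero.1 hd.1).resolve_left hy
    have h2 := (mul_eq_zero.1 hd.2).resolve_left hy
    have := h.unit t
    rw [h1, h2] at this
    norm_num at this
  closed := ⟨2 * T, by linarith [h.T_pos], fun t => (h.per t).1, fun t => (h.per t).2, h.injOn⟩

theorem eq_of_x_eq_zero (h : ProfileCurve x y c s T) {t : ℝ} (h0 : x t = 0) :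
    (y t = y 0 ∨ y t = y T) ∧ deriv y t = 0 := by
  obtain ⟨t', ht', e1, e2, e3⟩ := h.exists_fundamental t
  rw [e1] at h0
  rw [e2, e3, (h.hy t').deriv]
  have hs := h.symm t'
  rcases lt_trichotomy t' 0 with l | l | l
  · rcases ht'.1.eq_or_lt with l' | l'
    · have hT := h.symm T
      rw [← l', hT.2.1, hT.2.2.2, h.s_T]
      simp
    · have := h.x_pos (-t') ⟨by linarith, by linarith⟩
      rw [hs.1] at this; linarith
  · rw [l, h.s_zero]; simp
  · exact absurd h0 (h.x_pos t' ⟨l, ht'.2⟩).ne'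

theorem half_torus_eq (h : ProfileCurve x y c s T) :
    range (revolve x y) ∩ halfSpace = band x y (Icc 0 T) := by
  ext p
  constructor
  · rintro ⟨⟨q, rfl⟩, hq⟩
    have hq' : 0 ≤ x (q 0) := hq
    obtain ⟨t', ht', e1, e2⟩ := h.exists_half (q 0)
    rw [abs_of_nonneg hq'] at e1
    refine ⟨![t', q 1], ht', ?_⟩
    simp [revolve, e1, e2]
  · rintro ⟨q, hq, rfl⟩
    exact ⟨mem_range_self q, h.x_nonneg hq⟩

end ProfileCurve

/-! ### The intersection of the torus and the sphere -/

namespace TorusData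
variable {x y c s u q v r : ℝ → ℝ} {T tc : ℝ}

/-- The right half of the profile meets the circle of radius `2` once. -/
theorem eq_tc (h : TorusData x y c s T tc u q v r) {t : ℝ} (ht : t ∈ Icc 0 T)
    (h4 : x t ^ 2 + y t ^ 2 = 4) : t = tc := by
  rcases lt_trichotomy t tc with l | l | l
  · exact absurd h4 (h.outside t ⟨ht.1, l⟩).ne'
  · exact l
  · exact absurd h4 (h.inside t ⟨l, ht.2⟩).ne

theorem circle_eq (h : TorusData x y c s T tc u q v r) :
    {z : ℝ × ℝ | ∃ t, z = (x t, y t) ∧ z.1 ^ 2 + z.2 ^ 2 = 4} =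
      {(x tc, y tc), (-x tc, y tc)} := by
  ext z
  simp only [mem_ofPred_eq, mem_insert_iff, mem_singleton_iff]
  constructor
  · rintro ⟨t, rfl, h4⟩
    simp only at h4
    obtain ⟨t', ht', e1, e2⟩ := h.exists_half t
    have : t' = tc := h.eq_tc ht' (by rw [← e1, ← e2, sq_abs, h4])
    rw [this] at e1 e2
    rw [← e1, ← e2]
    rcases abs_choice (x t) with h0 | h0 <;> rw [h0]
    · exact Or.inl rfl
    · exact Or.inr (by rw [neg_neg])
  · rintro (rfl | rfl)
    · exact ⟨tc, rfl, h.norm_tc⟩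
    · have := h.symm tc
      exact ⟨-tc, by rw [this.1, this.2.1], by simp only [neg_sq]; exact h.norm_tc⟩

theorem mem_torus_iff (h : TorusData x y c s T tc u q v r) {p : E3} (hp : p ∈ roundSphere)
    (h0 : 0 ≤ p 0) : p ∈ range (revolve x y) ↔ p 0 = x tc := by
  constructor
  · intro hT
    obtain ⟨z, hz, rfl⟩ := h.half_torus_eq.subset ⟨hT, h0⟩
    rw [revolve_mem_roundSphere] at hp
    have := h.eq_tc hz hp
    change x (z 0) = x tc
    rw [this]
  · intro e
    rw [mem_roundSphere_iff] at hp
    obtain ⟨θ, hθ⟩ := exists_revolve_eq (h.y_pos tc).le e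
      (by have := h.norm_tc; rw [← e] at this; linarith)
    exact ⟨_, hθ⟩

/-- The polar angle of the circle along which the torus and the sphere meet. -/
theorem exists_polar (h : TorusData x y c s T tc u q v r) : ∃ α ∈ Ioo 0 (π / 2),
    sphereX α = x tc ∧ sphereY α = y tc ∧ 0.4525 ≤ cos α ∧ cos α ≤ 0.53 := by
  have hx := h.x_tc
  have hc : cos (arccos (x tc / 2)) = x tc / 2 :=
    cos_arccos (by linarith [hx.1]) (by linarith [hx.2])
  have hs := sin_sq_add_cos_sq (arccos (x tc / 2))
  rw [hc] at hs
  refine ⟨arccos (x tc / 2), ⟨arccos_pos.2 (by linarith [hx.2]), ?_⟩, ?_, ?_, ?_, ?_⟩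
  · exact arccos_lt_pi_div_two.2 (by linarith [hx.1])
  · rw [sphereX, hc]; ring
  · rw [sphereY]
    have := h.norm_tc
    refine (pow_left_inj₀ (mul_nonneg zero_le_two (sin_nonneg_of_nonneg_of_le_pi (arccos_nonneg _)
      (arccos_le_pi _))) (h.y_pos tc).le two_ne_zero).1 ?_
    linear_combination 4 * hs - this
  · rw [hc]; norm_num at hx ⊢; linarith [hx.1]
  · rw [hc]; norm_num at hx ⊢; linarith [hx.2]

theorem components_sphere (h : TorusData x y c s T tc u q v r) {α : ℝ} (hα : α ∈ Ioo 0 (π / 2))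
    (hαx : sphereX α = x tc) :
    band sphereX sphereY (Ico 0 α) ≠ band sphereX sphereY (Ioc α (π / 2)) ∧
    components ((halfSpace ∩ roundSphere) \ (roundSphere ∩ range (revolve x y))) =
      {band sphereX sphereY (Ico 0 α), band sphereX sphereY (Ioc α (π / 2))} := by
  have hpi := pi_pos
  have cX : Continuous sphereX := isMeridian_sphere.smooth_x.continuous
  have cY : Continuous sphereY := isMeridian_sphere.smooth_y.continuous
  have lt1 : ∀ t ∈ Ico 0 α, x tc < sphereX t := fun t ht => by
    rw [← hαx]
    exact mul_lt_mul_of_pos_left (cos_lt_cos_of_nonneg_of_le_pi ht.1 (by linarith [hα.2]) ht.2)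
      two_pos
  have lt2 : ∀ t ∈ Ioc α (π / 2), sphereX t < x tc := fun t ht => by
    rw [← hαx]
    exact mul_lt_mul_of_pos_left (cos_lt_cos_of_nonneg_of_le_pi hα.1.le (by linarith [ht.2]) ht.1)
      two_pos
  have nn : ∀ t ∈ Icc 0 (π / 2), 0 ≤ sphereX t := fun t ht => mul_nonneg zero_le_two
    (cos_nonneg_of_neg_pi_div_two_le_of_le (by linarith [ht.1]) ht.2)
  refine components_eq_pair (φ := fun p => -p 0) (k := -x tc) ?_
    (isPreconnected_band cX cY (convex_Ico 0 α)) (isPreconnected_band cX cY (convex_Ioc α (π / 2)))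
    ⟨_, revolve_mem_band (q := ![0, 0]) ⟨le_rfl, hα.1⟩⟩
    ⟨_, revolve_mem_band (q := ![π / 2, 0]) ⟨hα.2, le_rfl⟩⟩
    (by fun_prop) ?_ ?_
  · ext p
    constructor
    · rintro ⟨⟨h0, hp⟩, hT⟩
      have hne : p 0 ≠ x tc := fun e => hT ⟨hp, (h.mem_torus_iff hp h0).2 e⟩
      obtain ⟨z, hz, rfl⟩ := sphere_half_eq hp h0
      rcases lt_trichotomy (z 0) α with l | l | l
      · exact Or.inl (revolve_mem_band ⟨hz.1, l⟩)
      · exact absurd (by rw [← hαx, ← l]; rfl) hne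
      · exact Or.inr (revolve_mem_band ⟨l, hz.2⟩)
    · have main : ∀ z : Par, z 0 ∈ Icc 0 (π / 2) → sphereX (z 0) ≠ x tc →
          revolve sphereX sphereY z ∈
            (halfSpace ∩ roundSphere) \ (roundSphere ∩ range (revolve x y)) := fun z hz hne =>
        ⟨⟨nn _ hz, sphere_mem z⟩, fun hT => hne ((h.mem_torus_iff hT.1 (nn _ hz)).1 hT.2)⟩
      rintro (⟨z, hz, rfl⟩ | ⟨z, hz, rfl⟩)
      · exact main z ⟨hz.1, by linarith [hz.2, hα.2]⟩ (lt1 _ hz).ne'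
      · exact main z ⟨by linarith [hz.1, hα.1], hz.2⟩ (lt2 _ hz).ne
  · rintro _ ⟨z, hz, rfl⟩
    exact neg_lt_neg (lt1 _ hz)
  · rintro _ ⟨z, hz, rfl⟩
    exact neg_lt_neg (lt2 _ hz)

theorem components_torus (h : TorusData x y c s T tc u q v r) :
    band x y (Ico 0 tc) ≠ band x y (Ioc tc T) ∧
    components ((halfSpace ∩ range (revolve x y)) \ (roundSphere ∩ range (revolve x y))) =
      {band x y (Ico 0 tc), band x y (Ioc tc T)} := by
  have cX : Continuous x := h.contDiff.1.continuous
  have cY : Continuous y := h.contDiff.2.continuous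
  have e : ∀ z : Par, revolve x y z 0 ^ 2 + revolve x y z 1 ^ 2 + revolve x y z 2 ^ 2 =
      x (z 0) ^ 2 + y (z 0) ^ 2 := fun z => by
    simp [revolve]
    linear_combination y (z 0) ^ 2 * sin_sq_add_cos_sq (z 1)
  refine components_eq_pair (φ := fun p => -(p 0 ^ 2 + p 1 ^ 2 + p 2 ^ 2)) (k := -4) ?_
    (isPreconnected_band cX cY (convex_Ico 0 tc)) (isPreconnected_band cX cY (convex_Ioc tc T))
    ⟨_, revolve_mem_band (q := ![0, 0]) ⟨le_rfl, h.tc_mem.1⟩⟩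
    ⟨_, revolve_mem_band (q := ![T, 0]) ⟨h.tc_mem.2, le_rfl⟩⟩
    (by fun_prop) ?_ ?_
  · rw [inter_comm halfSpace, h.half_torus_eq]
    ext p
    constructor
    · rintro ⟨⟨z, hz, rfl⟩, hT⟩
      rcases lt_trichotomy (z 0) tc with l | l | l
      · exact Or.inl (revolve_mem_band ⟨hz.1, l⟩)
      · exact absurd ⟨revolve_mem_roundSphere.2 (by rw [l]; exact h.norm_tc), mem_range_self z⟩ hT
      · exact Or.inr (revolve_mem_band ⟨l, hz.2⟩)
    · rintro (⟨z, hz, rfl⟩ | ⟨z, hz, rfl⟩)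
      · exact ⟨revolve_mem_band ⟨hz.1, hz.2.le.trans h.tc_mem.2.le⟩, fun hT =>
          (h.outside _ hz).ne' (revolve_mem_roundSphere.1 hT.1)⟩
      · exact ⟨revolve_mem_band ⟨h.tc_mem.1.le.trans hz.1.le, hz.2⟩, fun hT =>
          (h.inside _ hz).ne (revolve_mem_roundSphere.1 hT.1)⟩
  · rintro _ ⟨z, hz, rfl⟩
    simp only [e]
    exact neg_lt_neg (h.outside _ hz)
  · rintro _ ⟨z, hz, rfl⟩
    simp only [e]
    exact neg_lt_neg (h.inside _ hz)

end TorusData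

/-! ### The quantitative estimates -/

/-- Numerical values of the cosine, from its quadratic approximation at an eighth of the angle. -/
theorem cos_bounds : cos 1.105 ≤ 0.452 ∧ 0.455 ≤ cos 1.095 := by
  have double : ∀ z : ℝ, cos (2 * z) = 2 * cos z ^ 2 - 1 := cos_two_mul
  constructor
  · have h := abs_le.1 (cos_bound (x := 0.138125) (by norm_num [abs_of_pos]))
    have e : cos 1.105 = 2 * (2 * (2 * cos 0.138125 ^ 2 - 1) ^ 2 - 1) ^ 2 - 1 := by
      rw [← double, ← double, ← double]; norm_num
    rw [abs_of_pos (by norm_num)] at h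
    have h1 : cos 0.138125 ≤ 0.99049 := by norm_num at h ⊢; linarith [h.2]
    have h0 : 0.99 ≤ cos 0.138125 := by norm_num at h ⊢; linarith [h.1]
    have h2 : 2 * cos 0.138125 ^ 2 - 1 ≤ 0.96215 := by norm_num at h0 h1 ⊢; nlinarith
    have h2' : 0.9 ≤ 2 * cos 0.138125 ^ 2 - 1 := by norm_num at h0 h1 ⊢; nlinarith
    have h3 : 2 * (2 * cos 0.138125 ^ 2 - 1) ^ 2 - 1 ≤ 0.85147 := by
      norm_num at h2 h2' ⊢; nlinarith
    have h3' : 0 ≤ 2 * (2 * cos 0.138125 ^ 2 - 1) ^ 2 - 1 := by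
      norm_num at h2 h2' ⊢; nlinarith
    rw [e]
    norm_num at h3 h3' ⊢; nlinarith
  · have h := abs_le.1 (cos_bound (x := 0.136875) (by norm_num [abs_of_pos]))
    have e : cos 1.095 = 2 * (2 * (2 * cos 0.136875 ^ 2 - 1) ^ 2 - 1) ^ 2 - 1 := by
      rw [← double, ← double, ← double]; norm_num
    rw [abs_of_pos (by norm_num)] at h
    have h1 : 0.9906 ≤ cos 0.136875 := by norm_num at h ⊢; linarith [h.1]
    have h2 : 0.96256 ≤ 2 * cos 0.136875 ^ 2 - 1 := by norm_num at h1 ⊢; nlinarith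
    have h3 : 0.853 ≤ 2 * (2 * cos 0.136875 ^ 2 - 1) ^ 2 - 1 := by norm_num at h2 ⊢; nlinarith
    rw [e]
    norm_num at h3 ⊢; nlinarith

theorem angle_bound {a b : ℝ} (h : a ^ 2 + b ^ 2 = 4) (h1 : 0.904 ≤ a) (h2 : a ≤ 0.91) :
    |InnerProductGeometry.angle (!₂[1, 0] : EuclideanSpace ℝ (Fin 2)) !₂[a, b] - 11 / 10|
      ≤ 5 * epsGap := by
  have n1 : ‖(!₂[1, 0] : EuclideanSpace ℝ (Fin 2))‖ = 1 := by
    simp [EuclideanSpace.norm_eq]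
  have n2 : ‖(!₂[a, b] : EuclideanSpace ℝ (Fin 2))‖ = 2 := by
    rw [EuclideanSpace.norm_eq, Real.sqrt_eq_iff_mul_self_eq_of_pos two_pos]
    simp [Fin.sum_univ_two, h]; norm_num
  have i1 : inner ℝ (!₂[1, 0] : EuclideanSpace ℝ (Fin 2)) !₂[a, b] = a := by
    simp [PiLp.inner_apply, Fin.sum_univ_two]
  rw [InnerProductGeometry.angle, n1, n2, i1, one_mul]
  have hc : cos (arccos (a / 2)) = a / 2 := cos_arccos (by linarith) (by norm_num at h2; linarith)
  have hpi := pi_gt_three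
  have hmem : arccos (a / 2) ∈ Icc 0 π := ⟨arccos_nonneg _, arccos_le_pi _⟩
  obtain ⟨c1, c2⟩ := cos_bounds
  have l1 : arccos (a / 2) ≤ 1.105 := by
    refine (strictAntiOn_cos.le_iff_ge ⟨by norm_num, by norm_num; linarith⟩ hmem).1 ?_
    rw [hc]; norm_num at h1 c1 ⊢; linarith
  have l2 : 1.095 ≤ arccos (a / 2) := by
    refine (strictAntiOn_cos.le_iff_ge hmem ⟨by norm_num, by norm_num; linarith⟩).1 ?_
    rw [hc]; norm_num at h2 c2 ⊢; linarith
  rw [epsGap, abs_le]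
  norm_num at l1 l2 ⊢
  constructor <;> linarith

namespace TorusData
variable {x y c s u q v r : ℝ → ℝ} {T tc : ℝ}

theorem isQuantitativeTorus (h : TorusData x y c s T tc u q v r) :
    IsQuantitativeTorus (range (revolve x y)) := by
  have hx := h.x_tc
  have hn := h.norm_tc
  have hy := h.y_pos tc
  have hT := h.symm T
  refine ⟨x, y, h.isTorusProfile, rfl, h.shrinkerEq, ?_, ⟨y 0, y T, h.y_pos T, ?_, ?_,
    fun t ht => (h.eq_of_x_eq_zero ht).2, h.y_zero, h.y_T⟩,
    ⟨x tc, y tc, h.circle_eq, ?_, angle_bound hn ?_ ?_⟩⟩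
  · rintro _ ⟨z, rfl⟩
    have := h.symm (z 0)
    exact ⟨![-z 0, z 1], by simp [revolve, this.1, this.2.1]⟩
  · exact h.strictAntiOn_y (left_mem_Icc.2 h.T_pos.le) (right_mem_Icc.2 h.T_pos.le) h.T_pos
  · ext a
    simp only [mem_ofPred_eq, mem_insert_iff, mem_singleton_iff]
    constructor
    · rintro ⟨t, h0, rfl⟩
      exact (h.eq_of_x_eq_zero h0).1
    · rintro (rfl | rfl)
      · exact ⟨0, h.x_zero, rfl⟩
      · exact ⟨T, h.x_T, rfl⟩
  · norm_num at hx
    have y1 : 1.78 ≤ y tc := by norm_num; nlinarith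
    have y2 : y tc ≤ 1.785 := by norm_num; nlinarith
    rw [EuclideanSpace.norm_eq, epsGap]
    refine Real.sqrt_le_iff.2 ⟨by norm_num, ?_⟩
    simp only [Fin.sum_univ_two, Real.norm_eq_abs, sq_abs]
    simp
    norm_num at y1 y2 ⊢
    have a1 : |x tc - 29 / 32| ≤ 2 / 1000 := abs_le.2 ⟨by linarith, by linarith⟩
    have a2 : |y tc - 41 / 23| ≤ 3 / 1000 := abs_le.2 ⟨by linarith, by linarith⟩
    have b1 := pow_le_pow_left₀ (abs_nonneg _) a1 2
    have b2 := pow_le_pow_left₀ (abs_nonneg _) a2 2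
    rw [sq_abs] at b1 b2
    linarith
  · norm_num at hx ⊢; linarith
  · norm_num at hx ⊢; linarith

end TorusData

/-! ### The six pieces -/

theorem trivialKernel_half_sphere {N : ℕ} (hN : 3 ≤ N) :
    TrivialKernel roundSphere (roundSphere ∩ halfSpace) ∅ N := by
  intro F hF hrot hJ hNeu _ p hp
  have hpi := pi_pos
  have hS : ∀ z : Par, z 0 ∈ Icc 0 (π / 2) →
      revolve sphereX sphereY z ∈ roundSphere ∩ halfSpace := fun z hz =>
    ⟨sphere_mem z, mul_nonneg zero_le_two (cos_nonneg_of_neg_pi_div_two_le_of_le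
      (by linarith [hz.1]) hz.2)⟩
  obtain ⟨z, hz, rfl⟩ := sphere_half_eq hp.1 hp.2
  refine sphere_piece (a := 0) (b := π / 2) (EN := {π / 2}) (ED := ∅) (by linarith) le_rfl le_rfl
    (fun z hz => hS z (Ioo_subset_Icc_self hz)) hF hN hrot hJ ?_ (by simp) (Or.inl rfl)
    (Or.inl rfl) ?_ z hz
  · rintro t rfl θ
    refine sphere_neumann hNeu θ ⟨subset_closure (hS _ ⟨?_, le_rfl⟩), ?_⟩
    · change 0 ≤ π / 2; linarith
    · simp [symPlane, revolve, sphereX]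
  · intro f f₁ f₂ hf hf₁ hsol hEN _
    exact sphere_half hf hf₁ hsol (hEN _ rfl)

namespace TorusData
variable {x y c s u q v r : ℝ → ℝ} {T tc : ℝ}

theorem trivialKernel_half (h : TorusData x y c s T tc u q v r) {N₀ : ℕ} (h3 : 3 ≤ N₀)
    (hN₀ : ∀ t ∈ Icc 0 T, pot (x t) (y t) (c t) (s t) < (N₀ : ℝ) ^ 2) {N : ℕ} (hN : N₀ ≤ N) :
    TrivialKernel (range (revolve x y)) (range (revolve x y) ∩ halfSpace) ∅ N := by
  rw [h.half_torus_eq]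
  rintro F hF hrot hJ hNeu - _ ⟨z, hz, rfl⟩
  refine h.piece (a := 0) (b := T) (EN := {0, T}) (ED := ∅) h3 hN₀ h.T_pos le_rfl le_rfl
    (fun z hz => revolve_mem_band (Ioo_subset_Icc_self hz)) hF hN hrot hJ ?_ (by simp)
    (Or.inl (by simp)) (Or.inl (by simp)) ?_ z hz
  · intro t ht θ
    have h0 : t ∈ Icc 0 T ∧ s t = 0 ∧ x t = 0 := by
      rcases ht with rfl | rfl
      · exact ⟨left_mem_Icc.2 h.T_pos.le, h.s_zero, h.x_zero⟩
      · exact ⟨right_mem_Icc.2 h.T_pos.le, h.s_T, h.x_T⟩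
    exact h.pd_zero_eq_zero hNeu h0.2.1 ⟨subset_closure (revolve_mem_band h0.1), h0.2.2⟩
  · intro f g hf hEN _
    exact h.eq_zero_half hf (hEN 0 (by simp)) (hEN T (by simp))

theorem trivialKernel_outer (h : TorusData x y c s T tc u q v r) {N₀ : ℕ} (h3 : 3 ≤ N₀)
    (hN₀ : ∀ t ∈ Icc 0 T, pot (x t) (y t) (c t) (s t) < (N₀ : ℝ) ^ 2) {N : ℕ} (hN : N₀ ≤ N) :
    TrivialKernel (range (revolve x y)) (band x y (Ico 0 tc)) (roundSphere ∩ range (revolve x y))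
      N := by
  rintro F hF hrot hJ hNeu hDir _ ⟨z, hz, rfl⟩
  have hS : ∀ z : Par, z 0 ∈ Ioo 0 tc → revolve x y z ∈ band x y (Ico 0 tc) := fun z hz =>
    revolve_mem_band (Ioo_subset_Ico_self hz)
  refine h.piece (a := 0) (b := tc) (EN := {0}) (ED := {tc}) h3 hN₀ h.tc_mem.1 le_rfl h.tc_mem.2.le
    hS hF hN hrot hJ ?_ ?_ (Or.inl rfl) (Or.inr rfl) ?_ z (Ico_subset_Icc_self hz)
  · rintro t rfl θ
    exact h.pd_zero_eq_zero hNeu h.s_zero ⟨subset_closure (revolve_mem_band ⟨le_rfl, h.tc_mem.1⟩),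
      h.x_zero⟩
  · rintro t rfl θ
    exact hDir _ ⟨mem_of_Icc h.isMeridian.contDiff.continuous h.tc_mem.1 hS
      (right_mem_Icc.2 h.tc_mem.1.le), revolve_mem_roundSphere.2 h.norm_tc, mem_range_self _⟩
  · intro f g hf hEN hED
    exact h.eq_zero_outer hf (hEN 0 rfl) (hED tc rfl)

theorem trivialKernel_inner (h : TorusData x y c s T tc u q v r) {N₀ : ℕ} (h3 : 3 ≤ N₀)
    (hN₀ : ∀ t ∈ Icc 0 T, pot (x t) (y t) (c t) (s t) < (N₀ : ℝ) ^ 2) {N : ℕ} (hN : N₀ ≤ N) :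
    TrivialKernel (range (revolve x y)) (band x y (Ioc tc T)) (roundSphere ∩ range (revolve x y))
      N := by
  rintro F hF hrot hJ hNeu hDir _ ⟨z, hz, rfl⟩
  have hS : ∀ z : Par, z 0 ∈ Ioo tc T → revolve x y z ∈ band x y (Ioc tc T) := fun z hz =>
    revolve_mem_band (Ioo_subset_Ioc_self hz)
  refine h.piece (a := tc) (b := T) (EN := {T}) (ED := {tc}) h3 hN₀ h.tc_mem.2 h.tc_mem.1.le le_rfl
    hS hF hN hrot hJ ?_ ?_ (Or.inr rfl) (Or.inl rfl) ?_ z (Ioc_subset_Icc_self hz)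
  · rintro t rfl θ
    exact h.pd_zero_eq_zero hNeu h.s_T ⟨subset_closure (revolve_mem_band ⟨h.tc_mem.2, le_rfl⟩),
      h.x_T⟩
  · rintro t rfl θ
    exact hDir _ ⟨mem_of_Icc h.isMeridian.contDiff.continuous h.tc_mem.2 hS
      (left_mem_Icc.2 h.tc_mem.2.le), revolve_mem_roundSphere.2 h.norm_tc, mem_range_self _⟩
  · intro f g hf hEN hED
    exact h.eq_zero_inner hf (hED tc rfl) (hEN T rfl)

theorem mem_inter_of_polar {α : ℝ} (hx : sphereX α = x tc) (hy : sphereY α = y tc) (θ : ℝ) :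
    revolve sphereX sphereY ![α, θ] ∈ roundSphere ∩ range (revolve x y) :=
  ⟨sphere_mem _, ![tc, θ], by simp [revolve, hx, hy]⟩

theorem trivialKernel_cap {α : ℝ} (hα : α ∈ Ioo 0 (π / 2)) (hx : sphereX α = x tc)
    (hy : sphereY α = y tc) (hcos : 0.4525 ≤ cos α) {N : ℕ} (hN : 3 ≤ N) :
    TrivialKernel roundSphere (band sphereX sphereY (Ico 0 α)) (roundSphere ∩ range (revolve x y))
      N := by
  rintro F hF hrot hJ - hDir _ ⟨z, hz, rfl⟩
  have hS : ∀ z : Par, z 0 ∈ Ioo 0 α →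
      revolve sphereX sphereY z ∈ band sphereX sphereY (Ico 0 α) := fun z hz =>
    revolve_mem_band (Ioo_subset_Ico_self hz)
  refine sphere_piece (a := 0) (b := α) (EN := ∅) (ED := {α}) hα.1 le_rfl hα.2.le hS hF hN hrot hJ
    (by simp) ?_ (Or.inl rfl) (Or.inr rfl) ?_ z (Ico_subset_Icc_self hz)
  · rintro t rfl θ
    exact hDir _ ⟨mem_of_Icc isMeridian_sphere.contDiff.continuous hα.1 hS
      (right_mem_Icc.2 hα.1.le), mem_inter_of_polar hx hy θ⟩
  · intro f f₁ f₂ hf hf₁ hsol _ hED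
    exact sphere_cap hf hf₁ hα.1.le hα.2.le hcos hsol (hED _ rfl)

theorem trivialKernel_band {α : ℝ} (hα : α ∈ Ioo 0 (π / 2)) (hx : sphereX α = x tc)
    (hy : sphereY α = y tc) (hcos : cos α ≤ 0.53) {N : ℕ} (hN : 3 ≤ N) :
    TrivialKernel roundSphere (band sphereX sphereY (Ioc α (π / 2)))
      (roundSphere ∩ range (revolve x y)) N := by
  rintro F hF hrot hJ hNeu hDir _ ⟨z, hz, rfl⟩
  have hS : ∀ z : Par, z 0 ∈ Ioo α (π / 2) →
      revolve sphereX sphereY z ∈ band sphereX sphereY (Ioc α (π / 2)) := fun z hz =>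
    revolve_mem_band (Ioo_subset_Ioc_self hz)
  refine sphere_piece (a := α) (b := π / 2) (EN := {π / 2}) (ED := {α}) hα.2 hα.1.le le_rfl hS hF hN
    hrot hJ ?_ ?_ (Or.inr rfl) (Or.inl rfl) ?_ z (Ioc_subset_Icc_self hz)
  · rintro t rfl θ
    refine sphere_neumann hNeu θ ⟨subset_closure (revolve_mem_band ⟨hα.2, le_rfl⟩), ?_⟩
    simp [symPlane, revolve, sphereX]
  · rintro t rfl θ
    exact hDir _ ⟨mem_of_Icc isMeridian_sphere.contDiff.continuous hα.2 hS
      (left_mem_Icc.2 hα.2.le), mem_inter_of_polar hx hy θ⟩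
  · intro f f₁ f₂ hf hf₁ hsol hEN hED
    exact sphere_band hf hf₁ hα.1.le hα.2.le hcos hsol (hED _ rfl) (hEN _ rfl)

end TorusData

end Shrinker

end

open Shrinker in
theorem mainTheorem3 :
    ∃ T : Set E3, IsQuantitativeTorus T ∧
      ∃ S₃ S₄ S₅ S₆ : Set E3,
        S₃ ≠ S₄ ∧ components ((halfSpace ∩ roundSphere) \ (roundSphere ∩ T)) = {S₃, S₄} ∧
        S₅ ≠ S₆ ∧ components ((halfSpace ∩ T) \ (roundSphere ∩ T)) = {S₅, S₆} ∧
        ∃ N₀ : ℕ, 0 < N₀ ∧ ∀ N : ℕ, N₀ ≤ N →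
          TrivialKernel roundSphere (roundSphere ∩ halfSpace) ∅ N ∧
          TrivialKernel T (T ∩ halfSpace) ∅ N ∧
          TrivialKernel roundSphere S₃ (roundSphere ∩ T) N ∧
          TrivialKernel roundSphere S₄ (roundSphere ∩ T) N ∧
          TrivialKernel T S₅ (roundSphere ∩ T) N ∧
          TrivialKernel T S₆ (roundSphere ∩ T) N := by
  obtain ⟨x, y, c, s, T, tc, u, q, v, r, h⟩ := exists_torusData
  obtain ⟨α, hα, hx, hy, hcos₁, hcos₂⟩ := h.exists_polar
  obtain ⟨N₀, h3, hN₀⟩ := h.exists_pot_lt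
  obtain ⟨ne₁, hc₁⟩ := h.components_sphere hα hx
  obtain ⟨ne₂, hc₂⟩ := h.components_torus
  exact ⟨range (revolve x y), h.isQuantitativeTorus, _, _, _, _, ne₁, hc₁, ne₂, hc₂, N₀, by omega,
    fun N hN => ⟨trivialKernel_half_sphere (h3.trans hN), h.trivialKernel_half h3 hN₀ hN,
      TorusData.trivialKernel_cap hα hx hy hcos₁ (h3.trans hN),
      TorusData.trivialKernel_band hα hx hy hcos₂ (h3.trans hN),
      h.trivialKernel_outer h3 hN₀ hN, h.trivialKernel_inner h3 hN₀ hN⟩⟩
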